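/- Let $n\ge 1$ and let $S$ be the closed oriented surface of genus $n$ obtained from a $4n$-gon (a closed disc with its standard orientation) by identifying its sides, read counterclockwise, according to the boundary word $x_1y_1x_1^{-1}y_1^{-1}\cdots x_ny_nx_n^{-1}y_n^{-1}$; thus $x_1,y_1,\dots,x_n,y_n$ represent the standard symplectic basis of $H_1(S,\mathbb Z)$. For a character $\chi\in H^1(S,\mathbb C)=\operatorname{Hom}(H_1(S,\mathbb Z),\mathbb C)$ put $$\omega_j(\chi)=\det\begin{pmatrix}\operatorname{Re}\chi(x_j)&\operatorname{Re}\chi(y_j)\\ \operatorname{Im}\chi(x_j)&\operatorname{Im}\chi(y_j)\end{pmatrix},\qquad \omega(\chi)=\sum_{j=1}^n\operatorname{Im}\bigl(\overline{\chi(x_j)}\,\chi(y_j)\bigr)=\sum_{j=1}^n\omega_j(\chi),$$ and let $$X=\{\chi\in H^1(S,\mathbb C):\omega(\chi)=1\},\qquad X_+=\{\chi\in X:\omega_j(\chi)>0,\ j=1,\dots,n\}.$$ Let $\Sigma\subset X$ be the set of those $\chi\in X$ for which there are a marked Riemann surface $S_\tau$ (a Riemann surface together with an orientation-preserving homeomorphism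 from $S$ onto it) and an abelian differential (holomorphic $1$-form) $\alpha$ on $S_\tau$ whose period character is $\chi$, that is, $\int_c\alpha=\chi(c)$ for all $c\in H_1(S,\mathbb Z)$, where $c$ is carried to $S_\tau$ by the marking. Then $$X_+\subset\Sigma .$$ -/

import Mathlib

open scoped Manifold ContDiff Topology unitInterval

namespace AbelianPeriods

noncomputable section

/-! ### The closed oriented surface of genus `n` and its standard generators -/

/-- The closed unit disc of `ℂ`, viewed as a `4n`-gon whose boundary circle carries `4n` sides. -/
abbrev Disc : Type := Metric.closedBall (0 : ℂ) 1

/-- The point with parameter `s ∈ [0,1]` on the `k`-th side of the `4n`-gon. The sides are the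
consecutive arcs of length `2π/(4n)` of the unit circle, in counterclockwise order, starting
at `1`. -/
def side (n k : ℕ) (s : I) : Disc :=
  ⟨Complex.exp ((2 * Real.pi * ((k + (s : ℝ)) / (4 * n)) : ℝ) * Complex.I), by
    rw [mem_closedBall_zero_iff, Complex.norm_exp_ofReal_mul_I]⟩

/-- The side identifications: the boundary word of the `4n`-gon is
`x₁ y₁ x₁⁻¹ y₁⁻¹ ⋯ xₙ yₙ xₙ⁻¹ yₙ⁻¹`. -/
inductive SideRel (n : ℕ) : Disc → Disc → Prop
  | x (j : Fin n) (s : I) :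
      SideRel n (side n (4 * j) s) (side n (4 * j + 2) (unitInterval.symm s))
  | y (j : Fin n) (s : I) :
      SideRel n (side n (4 * j + 1) s) (side n (4 * j + 3) (unitInterval.symm s))

/-- The closed surface `S` of genus `n` (for `n ≥ 1`): the `4n`-gon with its sides identified,
with the quotient topology. It is oriented by the standard orientation of the disc. -/
def Surface (n : ℕ) : Type := Quot (SideRel n)

instance (n : ℕ) : TopologicalSpace (Surface n) :=
  inferInstanceAs (TopologicalSpace (Quot (SideRel n)))

/-- The quotient map from the `4n`-gon to the surface. -/
def Surface.proj (n : ℕ) (p : Disc) : Surface n := Quot.mk _ p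

/-- The base point of the surface: the common image of all vertices of the `4n`-gon. -/
def Surface.base (n : ℕ) : Surface n := Surface.proj n (side n 0 0)

theorem continuous_side (n k : ℕ) : Continuous (side n k) := by
  unfold side
  fun_prop

theorem Surface.continuous_proj (n : ℕ) : Continuous (Surface.proj n) :=
  continuous_quot_mk

theorem side_one (n k : ℕ) : side n k 1 = side n (k + 1) 0 := by
  apply Subtype.ext
  simp [side]

theorem Surface.proj_side_x (n : ℕ) (j : Fin n) (s : I) :
    proj n (side n (4 * j) s) = proj n (side n (4 * j + 2) (unitInterval.symm s)) :=
  Quot.sound (SideRel.x j s)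

theorem Surface.proj_side_y (n : ℕ) (j : Fin n) (s : I) :
    proj n (side n (4 * j + 1) s) = proj n (side n (4 * j + 3) (unitInterval.symm s)) :=
  Quot.sound (SideRel.y j s)

/-- The vertices around one handle have the same image. -/
theorem Surface.proj_handle (n : ℕ) (j : Fin n) :
    proj n (side n (4 * j + 1) 0) = proj n (side n (4 * j) 0) ∧
    proj n (side n (4 * j + 2) 0) = proj n (side n (4 * j) 0) ∧
    proj n (side n (4 * j + 4) 0) = proj n (side n (4 * j) 0) := by
  have x0 := proj_side_x n j 0
  have x1 := proj_side_x n j 1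
  have y0 := proj_side_y n j 0
  have y1 := proj_side_y n j 1
  simp only [unitInterval.symm_zero, unitInterval.symm_one, side_one] at x0 x1 y0 y1
  have h2 := y1.trans x0.symm
  have h1 := x1.trans h2
  exact ⟨h1, h2, y0.symm.trans h1⟩

theorem Surface.proj_vertex (n : ℕ) (j : ℕ) (hj : j ≤ n) :
    proj n (side n (4 * j) 0) = base n := by
  induction j with
  | zero => rfl
  | succ j ih =>
    have h := (proj_handle n ⟨j, hj⟩).2.2
    exact h.trans (ih (by omega))

/-- The standard generator `x_j`, as a loop in the surface. -/
def Surface.xLoop (n : ℕ) (j : Fin n) : Path (Surface.base n) (Surface.base n) where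
  toFun s := Surface.proj n (side n (4 * j) s)
  continuous_toFun := (Surface.continuous_proj n).comp (continuous_side n _)
  source' := Surface.proj_vertex n j j.2.le
  target' := by
    rw [side_one]
    exact (Surface.proj_handle n j).1.trans (Surface.proj_vertex n j j.2.le)

/-- The standard generator `y_j`, as a loop in the surface. -/
def Surface.yLoop (n : ℕ) (j : Fin n) : Path (Surface.base n) (Surface.base n) where
  toFun s := Surface.proj n (side n (4 * j + 1) s)
  continuous_toFun := (Surface.continuous_proj n).comp (continuous_side n _)
  source' := (Surface.proj_handle n j).1.trans (Surface.proj_vertex n j j.2.le)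
  target' := by
    rw [side_one]
    exact (Surface.proj_handle n j).2.1.trans (Surface.proj_vertex n j j.2.le)

/-! ### Homology and characters -/

/-- `H₁(S, ℤ)`, the abelianized fundamental group, written additively. -/
abbrev H1 (n : ℕ) : Type :=
  Additive (Abelianization (FundamentalGroup (Surface n) (Surface.base n)))

/-- The homology class of a loop. -/
def homologyClass {n : ℕ} (γ : Path (Surface.base n) (Surface.base n)) : H1 n :=
  Additive.ofMul (Abelianization.of (FundamentalGroup.fromPath (Path.Homotopic.Quotient.mk γ)))

/-- `H¹(S, ℂ) = Hom(H₁(S, ℤ), ℂ)`, the additive characters. -/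
abbrev Character (n : ℕ) : Type := H1 n →+ ℂ

/-- `ω_j(χ)`, the determinant of the block `M_j(χ)` whose columns are `χ(x_j)` and `χ(y_j)` in
`ℂ = ℝ²`. -/
def omegaBlock {n : ℕ} (χ : Character n) (j : Fin n) : ℝ :=
  Matrix.det
    !![(χ (homologyClass (Surface.xLoop n j))).re, (χ (homologyClass (Surface.yLoop n j))).re;
       (χ (homologyClass (Surface.xLoop n j))).im, (χ (homologyClass (Surface.yLoop n j))).im]

/-- `ω(χ) = ∑ j, Im (conj χ(x_j) * χ(y_j))`, the pairing of the real and imaginary parts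
of `χ`. -/
def omega {n : ℕ} (χ : Character n) : ℝ :=
  ∑ j : Fin n, ((starRingEnd ℂ) (χ (homologyClass (Surface.xLoop n j))) *
    χ (homologyClass (Surface.yLoop n j))).im

theorem omega_eq_sum_omegaBlock {n : ℕ} (χ : Character n) : omega χ = ∑ j, omegaBlock χ j := by
  refine Finset.sum_congr rfl fun j _ => ?_
  simp only [omegaBlock, Matrix.det_fin_two_of, Complex.mul_im, Complex.conj_re, Complex.conj_im]
  ring

/-! ### Marked Riemann surfaces -/

/-- `g` preserves the orientation at the interior point `p` of the disc: the image under `g` of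
every small positively oriented circle around `p` winds exactly once, positively, around `g p`.
(Used for `g` continuous and injective near `p`; `θ` is a continuous choice of the argument.) -/
def PreservesOrientationAt (g : Disc → ℂ) (p : Disc) : Prop :=
  ∀ᶠ r : ℝ in 𝓝[>] 0, ∃ θ : ℝ → ℝ, Continuous θ ∧
    (∀ t, θ (t + 2 * Real.pi) = θ t + 2 * Real.pi) ∧
    ∀ (t : ℝ) (q : Disc), (q : ℂ) = p + r * Complex.exp (t * Complex.I) →
      g q - g p = ‖g q - g p‖ * Complex.exp (θ t * Complex.I)

/-- A marked Riemann surface of genus `n`, i.e. a representative of a point of the Teichmüller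
space `T(S)`: a one-dimensional complex manifold with an orientation-preserving homeomorphism from
the oriented surface `S`. (Compactness, connectedness and the Hausdorff property come from `S`.) -/
structure MarkedRiemannSurface (n : ℕ) where
  carrier : Type
  [top : TopologicalSpace carrier]
  [charted : ChartedSpace ℂ carrier]
  [complexManifold : IsManifold 𝓘(ℂ, ℂ) ω carrier]
  marking : Surface n ≃ₜ carrier
  preservesOrientation : ∀ p : Disc, ‖(p : ℂ)‖ < 1 → ∀ e ∈ atlas ℂ carrier,
    marking (Surface.proj n p) ∈ e.source →
      PreservesOrientationAt (fun q => e (marking (Surface.proj n q))) p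

attribute [instance] MarkedRiemannSurface.top MarkedRiemannSurface.charted
  MarkedRiemannSurface.complexManifold

/-! ### Abelian differentials and their periods -/

section Differentials

variable {R : Type*} [TopologicalSpace R] [ChartedSpace ℂ R]

/-- A field of complex-linear forms on the tangent spaces of a Riemann surface is an abelian
differential (a holomorphic 1-form) if in every chart it reads `f(z) dz` with `f` holomorphic. -/
def IsAbelianDifferential (α : ∀ x : R, TangentSpace 𝓘(ℂ, ℂ) x →L[ℂ] ℂ) : Prop :=
  ∀ e ∈ atlas ℂ R, DifferentiableOn ℂ
    (fun z : ℂ => α (e.symm z) (mfderiv 𝓘(ℂ, ℂ) 𝓘(ℂ, ℂ) e.symm z (1 : ℂ))) e.target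

/-- `F` is a primitive of `α` near `x`, i.e. `dF = α` near `x`. -/
def IsPrimitiveNear (α : ∀ x : R, TangentSpace 𝓘(ℂ, ℂ) x →L[ℂ] ℂ) (x : R) (F : R → ℂ) : Prop :=
  ∀ᶠ y in 𝓝 x, HasMFDerivAt 𝓘(ℂ, ℂ) 𝓘(ℂ, ℂ) F y (α y)

/-- `∫_γ α = c` for a continuous path `γ`: there is a continuous primitive `φ` of `α` along `γ`
(near each parameter it is a local primitive of `α` composed with `γ`), and the
increment of `φ` is `c`. -/
def HasPathIntegral (α : ∀ x : R, TangentSpace 𝓘(ℂ, ℂ) x →L[ℂ] ℂ) (γ : I → R) (c : ℂ) : Prop :=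
  ∃ φ : I → ℂ, Continuous φ ∧
    (∀ t : I, ∃ F : R → ℂ, IsPrimitiveNear α (γ t) F ∧ ∀ᶠ s in 𝓝 t, φ s = F (γ s)) ∧
    φ 1 - φ 0 = c

end Differentials

/-- `H^{1,0}(S_τ, ℂ)`: the characters `χ` which are period characters of abelian differentials `α`
of the marked Riemann surface `τ`, i.e. `χ(c) = ∫_c α` for all `c ∈ H₁(S, ℤ)`. -/
def H10 {n : ℕ} (τ : MarkedRiemannSurface n) : Set (Character n) :=
  {χ | ∃ α : ∀ x : τ.carrier, TangentSpace 𝓘(ℂ, ℂ) x →L[ℂ] ℂ, IsAbelianDifferential α ∧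
    ∀ γ : Path (Surface.base n) (Surface.base n),
      HasPathIntegral α (fun t => τ.marking (γ t)) (χ (homologyClass γ))}

/-! ### The sets `X`, `X₊` and `Σ` -/

/-- The normalized characters. -/
def X (n : ℕ) : Set (Character n) := {χ | omega χ = 1}

/-- The normalized characters with positive blocks. -/
def XPlus (n : ℕ) : Set (Character n) := {χ | χ ∈ X n ∧ ∀ j : Fin n, 0 < omegaBlock χ j}

/-- The normalized characters which are period characters of an abelian differential for some
complex structure. -/
def SigmaSet (n : ℕ) : Set (Character n) := X n ∩ ⋃ τ : MarkedRiemannSurface n, H10 τ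

end

end AbelianPeriods

namespace AbelianPeriods

noncomputable section

/-! ### Real-linear maps of the plane -/

/-! Cut the `4n`-gon along the `n` rays from its centre to the vertices where the handles begin. The
`j`-th sector carries the sides `x_j y_j x_j⁻¹ y_j⁻¹`; gluing these turns it into a torus slit along
a segment, and the surface is the union of the `n` slit tori glued cyclically along their slits.
Since `ω_j(χ) > 0`, the numbers `χ(x_j)`, `χ(y_j)` form a positively oriented basis of `ℂ`, so the
`j`-th torus can be given the flat structure with these periods. If all slits are cut along one and
the same short vector, the flat structures match. The result is a Riemann surface on which `dz` is
an abelian differential, with zeros of order `n - 1` at the two ends of the slit, and its period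
character is `χ`.

The topological surface is modelled once and for all by `CyclicCover`, the covering `u ^ n = slitFun
t` of a square torus, branched over the ends `0` and `1` of the slit. Off the slit the principal
`n`-th root separates the sheets. The homeomorphism `marking` sends `q` to the point over `toDiamond
(q ^ n)`: the `n`-th power wraps the polygon `n` times around the disc, sides going to quarter
circles, and `toDiamond` carries the disc to a square fundamental domain of the torus.

The flat structures enter through `exists_handleHomeomorph`: the linear map realizing the periods of
a handle is modified periodically so that near the slit it becomes a similarity, whose small ratio
can be chosen the same for all handles. Composing these maps with local lifts of the torus gives the
charts away from the slit; near it, charts `w` with `w ^ n` a Möbius function of the torus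
coordinate are used. `PrimitiveAtlas` derives the complex structure and the differential from the
fact that the local primitives differ by constants.

The periods are found without a presentation of the homology. The developing map on the polygon
jumps between paired sides by the prescribed periods, so by `sub_eq_loopValue` its values at any two
representatives of a point differ by the value of `χ` on a loop; `hasPathIntegral_of_developingMap`
turns this into a primitive along every path. That the marking preserves orientation is reduced to a
positive Jacobian determinant at each interior point (`OrientedDiffAt`). -/

/-- The real-linear map `z ↦ a z + b z̄`. -/
def planeMap (a b : ℂ) : ℂ →L[ℝ] ℂ :=
  ContinuousLinearMap.mul ℝ ℂ a + (ContinuousLinearMap.mul ℝ ℂ b).comp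
    (Complex.conjCLE : ℂ →L[ℝ] ℂ)

@[simp] theorem planeMap_apply (a b z : ℂ) :
    planeMap a b z = a * z + b * (starRingEnd ℂ) z := by
  simp [planeMap]

theorem planeMap_eq (L : ℂ →L[ℝ] ℂ) :
    L = planeMap ((L 1 - Complex.I * L Complex.I) / 2) ((L 1 + Complex.I * L Complex.I) / 2) := by
  have key : ∀ z : ℂ, L z = z.re * L 1 + z.im * L Complex.I := by
    intro z
    have : z = z.re • (1 : ℂ) + z.im • Complex.I := by
      simp [Complex.re_add_im]
    conv_lhs => rw [this]
    rw [map_add, map_smul, map_smul]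
    simp
  refine ContinuousLinearMap.ext fun z => ?_
  rw [planeMap_apply, key z]
  apply Complex.ext <;> simp <;> ring

theorem planeMap_comp (a b c d : ℂ) : (planeMap a b).comp (planeMap c d) =
    planeMap (a * c + b * (starRingEnd ℂ) d) (a * d + b * (starRingEnd ℂ) c) := by
  refine ContinuousLinearMap.ext fun z => ?_
  simp only [ContinuousLinearMap.comp_apply, planeMap_apply, map_add, map_mul, Complex.conj_conj]
  ring

theorem planeMap_one_zero : planeMap 1 0 = 1 := by
  refine ContinuousLinearMap.ext fun z => ?_
  simp

theorem continuous_planeMap : Continuous fun p : ℂ × ℂ => planeMap p.1 p.2 := by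
  unfold planeMap
  fun_prop

/-- The quantity `‖a‖ ^ 2 - ‖b‖ ^ 2` is the determinant of `z ↦ a z + b z̄`, and this is its
multiplicativity. -/
theorem norm_sq_sub_norm_sq_comp (a b c d : ℂ) :
    ‖a * c + b * (starRingEnd ℂ) d‖ ^ 2 - ‖a * d + b * (starRingEnd ℂ) c‖ ^ 2 =
      (‖a‖ ^ 2 - ‖b‖ ^ 2) * (‖c‖ ^ 2 - ‖d‖ ^ 2) := by
  simp only [← Complex.normSq_eq_norm_sq, Complex.normSq_apply, Complex.add_re, Complex.add_im,
    Complex.mul_re, Complex.mul_im, Complex.conj_re, Complex.conj_im]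
  ring

theorem norm_lt_comp {a b c d : ℂ} (h : ‖b‖ < ‖a‖) (h' : ‖d‖ < ‖c‖) :
    ‖a * d + b * (starRingEnd ℂ) c‖ < ‖a * c + b * (starRingEnd ℂ) d‖ := by
  have := norm_sq_sub_norm_sq_comp a b c d
  have h1 : 0 < ‖a‖ ^ 2 - ‖b‖ ^ 2 := by nlinarith [norm_nonneg a, norm_nonneg b]
  have h2 : 0 < ‖c‖ ^ 2 - ‖d‖ ^ 2 := by nlinarith [norm_nonneg c, norm_nonneg d]
  have h3 := mul_pos h1 h2
  refine lt_of_pow_lt_pow_left₀ 2 (norm_nonneg _) ?_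
  linarith

/-- There is a unit vector `z` for which `a z` and `b z̄` both have argument `(arg a + arg b) / 2`,
so that their norms add. -/
theorem norm_add_norm_le_planeMap (a b : ℂ) : ‖a‖ + ‖b‖ ≤ ‖planeMap a b‖ := by
  set z : ℂ := Complex.exp (((b.arg - a.arg) / 2 : ℝ) * Complex.I) with hz
  have hz1 : ‖z‖ = 1 := Complex.norm_exp_ofReal_mul_I _
  have hc : (starRingEnd ℂ) z = Complex.exp (-(((b.arg - a.arg) / 2 : ℝ) * Complex.I)) := by
    rw [hz, ← Complex.exp_conj, map_mul, Complex.conj_ofReal, Complex.conj_I, mul_neg]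
  have e1 : a * z = ‖a‖ * Complex.exp (((b.arg + a.arg) / 2 : ℝ) * Complex.I) := by
    conv_lhs => rw [← Complex.norm_mul_exp_arg_mul_I a]
    rw [hz, mul_assoc, ← Complex.exp_add]
    congr 2
    push_cast
    ring
  have e2 : b * (starRingEnd ℂ) z =
      ‖b‖ * Complex.exp (((b.arg + a.arg) / 2 : ℝ) * Complex.I) := by
    conv_lhs => rw [← Complex.norm_mul_exp_arg_mul_I b]
    rw [hc, mul_assoc, ← Complex.exp_add]
    congr 2
    push_cast
    ring
  have e3 : ‖planeMap a b z‖ = ‖a‖ + ‖b‖ := by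
    rw [planeMap_apply, e1, e2, ← add_mul, norm_mul, Complex.norm_exp_ofReal_mul_I, mul_one,
      ← Complex.ofReal_add, Complex.norm_real, Real.norm_of_nonneg (by positivity)]
  calc ‖a‖ + ‖b‖ = ‖planeMap a b z‖ := e3.symm
    _ ≤ ‖planeMap a b‖ * ‖z‖ := ContinuousLinearMap.le_opNorm _ _
    _ = _ := by rw [hz1, mul_one]

/-- A real-linear map at distance less than one from the identity preserves orientation. -/
theorem exists_planeMap_of_norm_sub_one_lt {L : ℂ →L[ℝ] ℂ} (h : ‖L - 1‖ < 1) :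
    ∃ a b : ℂ, ‖b‖ < ‖a‖ ∧ L = planeMap a b := by
  refine ⟨_, _, ?_, planeMap_eq L⟩
  set a := (L 1 - Complex.I * L Complex.I) / 2
  set b := (L 1 + Complex.I * L Complex.I) / 2
  have hL : L - 1 = planeMap (a - 1) b := by
    rw [planeMap_eq L]
    refine ContinuousLinearMap.ext fun z => ?_
    simp only [sub_apply, planeMap_apply, one_apply_eq_self]
    ring
  have h1 := norm_add_norm_le_planeMap (a - 1) b
  rw [← hL] at h1
  have h2 : (1 : ℝ) ≤ ‖a‖ + ‖a - 1‖ := by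
    calc (1 : ℝ) = ‖a - (a - 1)‖ := by simp
      _ ≤ _ := norm_sub_le _ _
  linarith

/-! ### Orientation preserving real differentiability -/

/-- `g` is real differentiable at `p` with a derivative of positive determinant. -/
def OrientedDiffAt (g : ℂ → ℂ) (p : ℂ) : Prop :=
  ∃ a b : ℂ, ‖b‖ < ‖a‖ ∧ HasFDerivAt g (planeMap a b) p

theorem OrientedDiffAt.comp {f g : ℂ → ℂ} {p : ℂ} (hf : OrientedDiffAt f (g p))
    (hg : OrientedDiffAt g p) : OrientedDiffAt (f ∘ g) p := by
  obtain ⟨a, b, hab, hf⟩ := hf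
  obtain ⟨c, d, hcd, hg⟩ := hg
  refine ⟨_, _, norm_lt_comp hab hcd, ?_⟩
  rw [← planeMap_comp]
  exact hf.comp p hg

theorem OrientedDiffAt.congr {f g : ℂ → ℂ} {p : ℂ} (hf : OrientedDiffAt f p)
    (h : g =ᶠ[𝓝 p] f) : OrientedDiffAt g p := by
  obtain ⟨a, b, hab, hf⟩ := hf
  exact ⟨a, b, hab, hf.congr_of_eventuallyEq h⟩

theorem OrientedDiffAt.continuousAt {f : ℂ → ℂ} {p : ℂ} (hf : OrientedDiffAt f p) :
    ContinuousAt f p := by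
  obtain ⟨a, b, hab, hf⟩ := hf
  exact hf.continuousAt

theorem orientedDiffAt_of_hasDerivAt {f : ℂ → ℂ} {p c : ℂ} (hc : c ≠ 0)
    (hf : HasDerivAt f c p) : OrientedDiffAt f p := by
  refine ⟨c, 0, by simpa using hc, ?_⟩
  refine (hf.hasFDerivAt.restrictScalars ℝ).congr_fderiv ?_
  refine ContinuousLinearMap.ext fun z => ?_
  simp [mul_comm]

theorem orientedDiffAt_planeMap {a b : ℂ} (h : ‖b‖ < ‖a‖) (p : ℂ) :
    OrientedDiffAt (planeMap a b) p :=
  ⟨a, b, h, (planeMap a b).hasFDerivAt⟩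

theorem OrientedDiffAt.add_const {f : ℂ → ℂ} {p : ℂ} (hf : OrientedDiffAt f p) (c : ℂ) :
    OrientedDiffAt (fun z => f z + c) p := by
  obtain ⟨a, b, hab, hf⟩ := hf
  exact ⟨a, b, hab, hf.add_const c⟩

/-- The slope at `0` is `c` itself, so continuity of `c` is enough. This serves at the centre of the
polygon, where the factor `c` is only known to be continuous. -/
theorem orientedDiffAt_mul_self {c : ℂ → ℂ} (hc : ContinuousAt c 0) (h0 : c 0 ≠ 0) :
    OrientedDiffAt (fun z => z * c z) 0 := by
  refine orientedDiffAt_of_hasDerivAt h0 ?_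
  rw [hasDerivAt_iff_tendsto_slope]
  refine (hc.tendsto.mono_left nhdsWithin_le_nhds).congr' ?_
  filter_upwards [self_mem_nhdsWithin] with z hz
  have : z ≠ 0 := hz
  simp [slope_def_field, this]

/-- A continuous root of an orientation preserving map is locally an orientation preserving
function. -/
theorem OrientedDiffAt.exists_root {G : ℂ → ℂ} {p w : ℂ} {n : ℕ} (hn : n ≠ 0) (hw : w ≠ 0)
    (hG : OrientedDiffAt G p) (hp : w ^ n = G p) :
    ∃ r : ℂ → ℂ, OrientedDiffAt (r ∘ G) p ∧ (∀ᶠ y in 𝓝 (G p), ContinuousAt r y) ∧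
      ∀ᶠ v in 𝓝 w, r (v ^ n) = v := by
  have hd : HasStrictDerivAt (fun v : ℂ => v ^ n) (n * w ^ (n - 1)) w := hasStrictDerivAt_pow n w
  have hne : (n : ℂ) * w ^ (n - 1) ≠ 0 := mul_ne_zero (by exact_mod_cast hn) (pow_ne_zero _ hw)
  have hi := hd.to_localInverse hne
  refine ⟨hd.localInverse _ _ _ hne, ?_, ?_, ?_⟩
  · refine OrientedDiffAt.comp ?_ hG
    rw [← hp]
    exact orientedDiffAt_of_hasDerivAt (inv_ne_zero hne) hi.hasDerivAt
  · rw [← hp]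
    let e := (hd.hasStrictFDerivAt_equiv hne).toOpenPartialHomeomorph _
    have : w ^ n ∈ e.target := (hd.hasStrictFDerivAt_equiv hne).image_mem_toOpenPartialHomeomorph_target
    filter_upwards [e.open_target.mem_nhds this] with y hy
    exact e.symm.continuousAt hy
  · exact (hd.hasStrictFDerivAt_equiv hne).eventually_left_inverse

/-! ### Orientation of maps from the disc -/

/-- On a small circle `p + γ` write `G (p + γ) - G p = a γ w`. Because `‖b‖ < ‖a‖`, the factor `w`
stays within distance `1` of `1`, hence in the right half plane, and `t + arg a + arg w` is an
argument with the right increment. Differentiability is needed at `p` only; continuity near `p`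
makes the argument continuous. -/
theorem preservesOrientationAt_of_orientedDiffAt {g : Disc → ℂ} {G : ℂ → ℂ} {p : Disc}
    (hG : OrientedDiffAt G p) (hc : ∀ᶠ z in 𝓝 (p : ℂ), ContinuousAt G z)
    (hg : ∀ᶠ q in 𝓝 p, g q = G q) : PreservesOrientationAt g p := by
  obtain ⟨a, b, hab, hd⟩ := hG
  have ha : 0 < ‖a‖ := lt_of_le_of_lt (norm_nonneg b) hab
  have ha0 : a ≠ 0 := norm_pos_iff.1 ha
  -- With this tolerance the remainder and `b γ̄` together stay smaller than `a γ`.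
  have hlo := hd.isLittleO.def (show 0 < (‖a‖ - ‖b‖) / 2 by linarith)
  obtain ⟨r₁, hr₁, h₁⟩ := Metric.eventually_nhds_iff.1 (hlo.and hc)
  obtain ⟨r₂, hr₂, h₂⟩ := Metric.eventually_nhds_iff.1 hg
  have hr : ∀ᶠ r : ℝ in 𝓝[>] 0, r < min r₁ r₂ ∧ 0 < r := by
    refine Filter.Eventually.and ?_ self_mem_nhdsWithin
    exact nhdsWithin_le_nhds (gt_mem_nhds (lt_min hr₁ hr₂))
  filter_upwards [hr] with r hr
  obtain ⟨hr, hr0⟩ := hr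
  set γ : ℝ → ℂ := fun t => r * Complex.exp (t * Complex.I) with hγ
  have hγn : ∀ t, ‖γ t‖ = r := fun t => by
    simp only [hγ, norm_mul, Complex.norm_exp_ofReal_mul_I, Complex.norm_real, mul_one]
    exact Real.norm_of_nonneg hr0.le
  have hγ0 : ∀ t, γ t ≠ 0 := fun t => norm_pos_iff.1 (by rw [hγn]; exact hr0)
  have hγc : Continuous γ := by fun_prop
  have hγp : ∀ t, γ (t + 2 * Real.pi) = γ t := fun t => by
    simp only [hγ]
    congr 1
    rw [Complex.exp_eq_exp_iff_exists_int]
    exact ⟨1, by push_cast; ring⟩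
  have hball : ∀ t, dist ((p : ℂ) + γ t) p < min r₁ r₂ := fun t => by
    rw [dist_eq_norm, add_sub_cancel_left, hγn]; exact hr
  set w : ℝ → ℂ := fun t => (G (p + γ t) - G p) / (a * γ t) with hw
  have hwre : ∀ t, 0 < (w t).re := by
    intro t
    have h := (h₁ ((hball t).trans_le (min_le_left _ _))).1
    rw [add_sub_cancel_left, hγn, planeMap_apply] at h
    have hn : ‖w t - 1‖ < 1 := by
      have e : w t - 1 = ((G (p + γ t) - G p - (a * γ t + b * (starRingEnd ℂ) (γ t))) +
          b * (starRingEnd ℂ) (γ t)) / (a * γ t) := by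
        simp only [hw]
        field_simp [hγ0 t]
        ring
      rw [e, norm_div, norm_mul, hγn, div_lt_one (by positivity)]
      refine lt_of_le_of_lt (norm_add_le _ _) ?_
      have : ‖b * (starRingEnd ℂ) (γ t)‖ = ‖b‖ * r := by
        rw [norm_mul, RCLike.norm_conj, hγn]
      rw [this]
      nlinarith
    have h3 := (Complex.abs_re_le_norm (w t - 1)).trans_lt hn
    rw [abs_lt] at h3
    simp only [Complex.sub_re, Complex.one_re] at h3
    linarith [h3.1]
  have hwc : Continuous w := by
    rw [continuous_iff_continuousAt]
    intro t
    have h := (h₁ ((hball t).trans_le (min_le_left _ _))).2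
    refine ContinuousAt.div ?_ (by fun_prop) (mul_ne_zero ha0 (hγ0 t))
    refine ContinuousAt.sub ?_ continuousAt_const
    exact ContinuousAt.comp' h (by fun_prop)
  refine ⟨fun t => t + (a.arg + (w t).arg), ?_, ?_, ?_⟩
  · refine continuous_id.add (continuous_const.add ?_)
    rw [continuous_iff_continuousAt]
    intro t
    exact ContinuousAt.comp (Complex.continuousAt_arg (Or.inl (hwre t))) hwc.continuousAt
  · intro t
    have : w (t + 2 * Real.pi) = w t := by simp only [hw, hγp]
    simp only [this]
    ring
  · intro t q hq
    have hq' : (q : ℂ) = p + γ t := hq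
    have hgq : g q = G q := h₂ (by
      rw [Subtype.dist_eq, hq']
      exact (hball t).trans_le (min_le_right _ _))
    have hgp : g p = G p := h₂ (by rw [dist_self]; exact hr₂)
    have e : g q - g p = a * γ t * w t := by
      rw [hgq, hgp, hq']
      simp only [hw]
      field_simp [hγ0 t]
    have e1 : ‖g q - g p‖ = ‖a‖ * r * ‖w t‖ := by rw [e, norm_mul, norm_mul, hγn]
    rw [e1, e]
    conv_lhs => rw [← Complex.norm_mul_exp_arg_mul_I a, ← Complex.norm_mul_exp_arg_mul_I (w t)]
    simp only [hγ]
    push_cast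
    rw [add_mul, add_mul, Complex.exp_add, Complex.exp_add]
    ring

/-- A continuous `n`-th root of `G` that does not vanish at `p` is locally a holomorphic branch of
the root composed with `G`, so `g` need not be known to be differentiable beforehand. -/
theorem preservesOrientationAt_of_pow {g : Disc → ℂ} {G : ℂ → ℂ} {p : Disc} {n : ℕ} (hn : n ≠ 0)
    (hG : OrientedDiffAt G p) (hc : ∀ᶠ z in 𝓝 (p : ℂ), ContinuousAt G z)
    (hg : ContinuousAt g p) (h0 : g p ≠ 0) (h : ∀ᶠ q in 𝓝 p, g q ^ n = G q) :
    PreservesOrientationAt g p := by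
  obtain ⟨r, h1, h2, h3⟩ := hG.exists_root hn h0 h.self_of_nhds
  refine preservesOrientationAt_of_orientedDiffAt h1 ?_ ?_
  · filter_upwards [hc, hG.continuousAt.eventually h2] with z hz hz'
    exact ContinuousAt.comp hz' hz
  · filter_upwards [h, hg.eventually h3] with q hq hq'
    rw [Function.comp_apply, ← hq, hq']

end

end AbelianPeriods

namespace AbelianPeriods

noncomputable section

/-! ### Compactly supported homeomorphisms with a prescribed linear germ -/

/-- The linear map `B` is the restriction to the disc of radius `3/5` of an orientation preserving
homeomorphism of the plane which is the identity away from the disc of radius `13/20`. -/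
def ExtendsByIdentity (B : ℂ →L[ℝ] ℂ) : Prop :=
  ∃ k : ℂ ≃ₜ ℂ, (∀ z, ‖z‖ ≤ 3 / 5 → k z = B z) ∧ (∀ z, 13 / 20 ≤ ‖z‖ → k z = z) ∧
    ∀ z, OrientedDiffAt k z

theorem extendsByIdentity_one : ExtendsByIdentity 1 :=
  ⟨Homeomorph.refl ℂ, fun _ _ => rfl, fun _ _ => rfl,
    fun _ => orientedDiffAt_of_hasDerivAt one_ne_zero (hasDerivAt_id _)⟩

/-- The bound `‖A‖ ≤ 1` keeps the disc of radius `3/5` inside itself, where the second homeomorphism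
is still linear. -/
theorem ExtendsByIdentity.comp {A B : ℂ →L[ℝ] ℂ} (hB : ExtendsByIdentity B)
    (hA : ExtendsByIdentity A) (h : ‖A‖ ≤ 1) : ExtendsByIdentity (B.comp A) := by
  obtain ⟨k, k1, k2, k3⟩ := hA
  obtain ⟨l, l1, l2, l3⟩ := hB
  refine ⟨k.trans l, fun z hz => ?_, fun z hz => ?_, fun z => (l3 (k z)).comp (k3 z)⟩
  · have : ‖A z‖ ≤ 3 / 5 := by
      refine (A.le_opNorm z).trans ?_
      nlinarith [norm_nonneg z, norm_nonneg A]
    rw [Homeomorph.trans_apply, k1 z hz, l1 _ this, ContinuousLinearMap.comp_apply]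
  · rw [Homeomorph.trans_apply, k2 z hz, l2 z hz]

/-- The map `z + (B - 1) (φ z • z)` with a bump function `φ` interpolates between `B` and the
identity. For `B` close to `1` the perturbation has Lipschitz constant below `1`, so the map is a
homeomorphism and its derivative stays at distance below `1` from the identity. -/
theorem exists_extendsByIdentity_of_near :
    ∃ δ > 0, ∀ B : ℂ →L[ℝ] ℂ, ‖B - 1‖ < δ → ExtendsByIdentity B := by
  let φ : ContDiffBump (0 : ℂ) := ⟨3 / 5, 13 / 20, by norm_num, by norm_num⟩
  set Φ : ℂ → ℂ := fun z => φ z • z with hΦ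
  have hΦc : ContDiff ℝ 1 Φ := (φ.contDiff (n := 1)).smul contDiff_id
  have hΦs : HasCompactSupport Φ := φ.hasCompactSupport.smul_right
  obtain ⟨K, hK⟩ := hΦc.lipschitzWith_of_hasCompactSupport hΦs one_ne_zero
  refine ⟨1 / (K + 1), by positivity, fun B hB => ?_⟩
  have hlt : ‖B - 1‖₊ * K < 1 := by
    have h1 : ‖B - 1‖ * (K + 1) < 1 := by rwa [lt_div_iff₀ (by positivity)] at hB
    have : ‖B - 1‖ * K < 1 := by nlinarith [norm_nonneg (B - 1)]
    exact_mod_cast this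
  have hL : LipschitzWith (‖B - 1‖₊ * K) fun z => (B - 1) (Φ z) :=
    (B - 1).lipschitz.comp hK
  set g : ℂ → ℂ := fun z => z + (B - 1) (Φ z) with hg
  have happ : ApproximatesLinearOn g ((ContinuousLinearEquiv.refl ℝ ℂ : ℂ ≃L[ℝ] ℂ) : ℂ →L[ℝ] ℂ)
      Set.univ (‖B - 1‖₊ * K) := by
    intro x _ y _
    have := hL.dist_le_mul x y
    rw [dist_eq_norm, dist_eq_norm] at this
    refine le_trans (le_of_eq ?_) this
    congr 1
    simp only [hg, ContinuousLinearEquiv.coe_refl, ContinuousLinearMap.id_apply]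
    ring
  have hc : Subsingleton ℂ ∨ ‖B - 1‖₊ * K <
      ‖((ContinuousLinearEquiv.refl ℝ ℂ).symm : ℂ →L[ℝ] ℂ)‖₊⁻¹ := by
    right
    have : ‖((ContinuousLinearEquiv.refl ℝ ℂ).symm : ℂ →L[ℝ] ℂ)‖₊ = 1 := by
      have : ((ContinuousLinearEquiv.refl ℝ ℂ).symm : ℂ →L[ℝ] ℂ) = 1 := rfl
      rw [this, nnnorm_one]
    rwa [this, inv_one]
  refine ⟨happ.toHomeomorph g hc, fun z hz => ?_, fun z hz => ?_, fun z => ?_⟩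
  · change g z = B z
    have : φ z = 1 := φ.one_of_mem_closedBall (by simpa using hz)
    simp [hg, hΦ, this]
  · change g z = z
    have : φ z = 0 := φ.zero_of_le_dist (by simpa using hz)
    simp [hg, hΦ, this]
  · change OrientedDiffAt g z
    have h1 : HasFDerivAt (fun z => (B - 1) (Φ z)) ((B - 1).comp (fderiv ℝ Φ z)) z :=
      (B - 1).hasFDerivAt.comp z (hΦc.differentiable one_ne_zero z).hasFDerivAt
    have h2 : ‖(B - 1).comp (fderiv ℝ Φ z)‖ < 1 :=
      lt_of_le_of_lt (h1.le_of_lipschitz hL) (by exact_mod_cast hlt)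
    have h3 : HasFDerivAt g (1 + (B - 1).comp (fderiv ℝ Φ z)) z := (hasFDerivAt_id z).add h1
    obtain ⟨a, b, hab, e⟩ :=
      exists_planeMap_of_norm_sub_one_lt (L := 1 + (B - 1).comp (fderiv ℝ Φ z))
        (by rwa [add_sub_cancel_left])
    exact ⟨a, b, hab, e ▸ h3⟩

theorem norm_planeMap_le (a b : ℂ) : ‖planeMap a b‖ ≤ ‖a‖ + ‖b‖ := by
  refine ContinuousLinearMap.opNorm_le_bound _ (by positivity) fun z => ?_
  rw [planeMap_apply]
  refine (norm_add_le _ _).trans ?_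
  rw [norm_mul, norm_mul, RCLike.norm_conj, add_mul]

/-- The inverse of a real-linear orientation preserving map. -/
theorem planeMap_inverse {a b : ℂ} (h : ‖b‖ < ‖a‖) :
    (planeMap a b).comp (planeMap ((starRingEnd ℂ) a / (‖a‖ ^ 2 - ‖b‖ ^ 2 : ℝ))
      (-b / (‖a‖ ^ 2 - ‖b‖ ^ 2 : ℝ))) = 1 ∧
    (planeMap ((starRingEnd ℂ) a / (‖a‖ ^ 2 - ‖b‖ ^ 2 : ℝ))
      (-b / (‖a‖ ^ 2 - ‖b‖ ^ 2 : ℝ))).comp (planeMap a b) = 1 := by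
  have h0 : ((‖a‖ ^ 2 - ‖b‖ ^ 2 : ℝ) : ℂ) ≠ 0 := by
    have : 0 < ‖a‖ ^ 2 - ‖b‖ ^ 2 := by nlinarith [norm_nonneg a, norm_nonneg b]
    exact_mod_cast this.ne'
  have e : ((‖a‖ ^ 2 - ‖b‖ ^ 2 : ℝ) : ℂ) =
      a * (starRingEnd ℂ) a - b * (starRingEnd ℂ) b := by
    push_cast
    rw [Complex.mul_conj', Complex.mul_conj']
  rw [planeMap_comp, planeMap_comp, ← planeMap_one_zero]
  simp only [map_div₀, map_neg, Complex.conj_ofReal, Complex.conj_conj]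
  constructor <;> congr 1
  · field_simp; rw [e]; ring
  · field_simp; ring
  · field_simp; rw [e]; ring
  · field_simp; ring

/-- Extendability is locally constant along the path: for `t'` near `t` the map at `t'` is the map
at `t` followed by a map close to `1`, and the norm bound allows the two extensions to be composed.
The parameter interval is connected. -/
theorem extendsByIdentity_of_path {p q : I → ℂ} (hp : Continuous p) (hq : Continuous q)
    (hpq : ∀ t, ‖q t‖ < ‖p t‖) (hle : ∀ t, ‖p t‖ + ‖q t‖ ≤ 1) (hp0 : p 0 = 1) (hq0 : q 0 = 0) :
    ExtendsByIdentity (planeMap (p 1) (q 1)) := by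
  obtain ⟨δ, hδ, hnear⟩ := exists_extendsByIdentity_of_near
  let P : I → I → Prop := fun s t => ExtendsByIdentity (planeMap (p s) (q s)) ↔
    ExtendsByIdentity (planeMap (p t) (q t))
  have : Std.Symm P := ⟨fun _ _ h => h.symm⟩
  have key : P 0 1 := by
    refine PreconnectedSpace.induction₂ P ?_ ⟨fun _ _ _ h h' => h.trans h'⟩ 0 1
    intro s
    set γ : I → ℂ →L[ℝ] ℂ := fun t => planeMap (p t) (q t) with hγ
    set γi : I → ℂ →L[ℝ] ℂ := fun t =>
      planeMap ((starRingEnd ℂ) (p t) / (‖p t‖ ^ 2 - ‖q t‖ ^ 2 : ℝ))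
        (-(q t) / (‖p t‖ ^ 2 - ‖q t‖ ^ 2 : ℝ)) with hγi
    have hinv : ∀ t, (γ t).comp (γi t) = 1 ∧ (γi t).comp (γ t) = 1 :=
      fun t => planeMap_inverse (hpq t)
    have hγc : Continuous γ := continuous_planeMap.comp (hp.prodMk hq)
    have hγic : Continuous γi := by
      have h0 : ∀ t, ((‖p t‖ ^ 2 - ‖q t‖ ^ 2 : ℝ) : ℂ) ≠ 0 := fun t => by
        have : 0 < ‖p t‖ ^ 2 - ‖q t‖ ^ 2 := by
          nlinarith [hpq t, norm_nonneg (p t), norm_nonneg (q t)]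
        exact_mod_cast this.ne'
      have hd : Continuous fun t => ((‖p t‖ ^ 2 - ‖q t‖ ^ 2 : ℝ) : ℂ) := by fun_prop
      exact continuous_planeMap.comp
        (((Complex.continuous_conj.comp hp).div hd h0).prodMk (hq.neg.div hd h0))
    have hstep : ∀ t t', ‖(γ t').comp (γi t) - 1‖ < δ → ExtendsByIdentity (γ t) →
        ExtendsByIdentity (γ t') := by
      intro t t' h ht
      have := (hnear _ h).comp ht ((norm_planeMap_le _ _).trans (hle t))
      have e : ((γ t').comp (γi t)).comp (γ t) = γ t' := by
        rw [ContinuousLinearMap.comp_assoc, (hinv t).2]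
        rfl
      rwa [e] at this
    have c1 : Continuous fun t => ‖(γ t).comp (γi s) - 1‖ :=
      ((hγc.clm_comp continuous_const).sub continuous_const).norm
    have c2 : Continuous fun t => ‖(γ s).comp (γi t) - 1‖ :=
      ((continuous_const.clm_comp hγic).sub continuous_const).norm
    have e0 : ‖(γ s).comp (γi s) - 1‖ < δ := by rw [(hinv s).1, sub_self, norm_zero]; exact hδ
    filter_upwards [c1.continuousAt.eventually_lt continuousAt_const e0,
      c2.continuousAt.eventually_lt continuousAt_const e0] with t h1 h2
    exact ⟨hstep _ _ h1, hstep _ _ h2⟩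
  refine key.1 ?_
  rw [hp0, hq0, planeMap_one_zero]
  exact extendsByIdentity_one

/-- Small multiples of an orientation preserving linear map extend by the identity. -/
theorem exists_extendsByIdentity_exp_smul {a b : ℂ} (h : ‖b‖ < ‖a‖) :
    ∃ C₀ : ℝ, ∀ C ≥ C₀, ExtendsByIdentity
      (planeMap ((Real.exp (-C) : ℝ) * a) ((Real.exp (-C) : ℝ) * b)) := by
  have ha : 0 < ‖a‖ := (norm_nonneg b).trans_lt h
  have ha0 : a ≠ 0 := norm_pos_iff.1 ha
  -- The extra `1` absorbs the factor `1 + t ‖b / a‖ ≤ exp t` in the norm bound along the path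
  -- below.
  refine ⟨Real.log ‖a‖ + 1, fun C hC => ?_⟩
  -- The holomorphic part moves from `1` to `exp (-C) * a` along an exponential, while the
  -- dilatation grows linearly as `t * (b / a)` and so stays below `1`.
  set p : I → ℂ := fun t => Complex.exp ((t : ℝ) * (Complex.log a - C)) with hp
  have hpn : ∀ t : I, ‖p t‖ = Real.exp (t * (Real.log ‖a‖ - C)) := fun t => by
    simp [hp, Complex.norm_exp, Complex.log_re]
  have h1 : p 1 = (Real.exp (-C) : ℝ) * a := by
    simp only [hp, Set.Icc.coe_one, Complex.ofReal_one, one_mul, sub_eq_add_neg, Complex.exp_add,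
      Complex.exp_log ha0]
    push_cast
    ring
  have hμ : ‖b / a‖ < 1 := by rwa [norm_div, div_lt_one ha]
  have ht : ∀ t : I, ‖((t : ℝ) : ℂ)‖ = t := fun t => by
    rw [Complex.norm_real]; exact Real.norm_of_nonneg t.2.1
  have := extendsByIdentity_of_path (p := p) (q := fun t => (t : ℝ) * p t * (b / a))
    (by fun_prop) (by fun_prop) ?_ ?_ (by simp [hp]) (by simp)
  · have e : ((1 : I) : ℝ) * p 1 * (b / a) = (Real.exp (-C) : ℝ) * b := by
      rw [h1]
      simp only [Set.Icc.coe_one, Complex.ofReal_one, one_mul]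
      field_simp
    simp only [e] at this
    rwa [h1] at this
  · intro t
    have hpos : 0 < ‖p t‖ := by rw [hpn]; positivity
    rw [norm_mul, norm_mul, ht]
    have : (t : ℝ) * ‖b / a‖ < 1 := by
      nlinarith [t.2.1, t.2.2, norm_nonneg (b / a)]
    nlinarith
  · intro t
    rw [norm_mul, norm_mul, ht, hpn]
    have h2 : (t : ℝ) * ‖b / a‖ ≤ t := by nlinarith [t.2.1, norm_nonneg (b / a)]
    have h3 : 1 + (t : ℝ) * ‖b / a‖ ≤ Real.exp t := by
      linarith [Real.add_one_le_exp (t : ℝ)]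
    calc Real.exp (t * (Real.log ‖a‖ - C)) + t * Real.exp (t * (Real.log ‖a‖ - C)) * ‖b / a‖
        = Real.exp (t * (Real.log ‖a‖ - C)) * (1 + t * ‖b / a‖) := by ring
      _ ≤ Real.exp (t * (Real.log ‖a‖ - C)) * Real.exp t := by gcongr
      _ = Real.exp (t * (Real.log ‖a‖ - C + 1)) := by rw [← Real.exp_add]; ring_nf
      _ ≤ Real.exp 0 := by
        rw [Real.exp_le_exp]
        nlinarith [t.2.1]
      _ = 1 := Real.exp_zero

end

end AbelianPeriods

namespace AbelianPeriods

noncomputable section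

/-! ### The square torus -/

instance fact_zero_lt_two_real : Fact ((0 : ℝ) < 2) := ⟨two_pos⟩

/-- The quotient of the plane by the lattice generated by `-1 + i` and `-1 - i`, in the coordinates
`re + im` and `im - re`. -/
abbrev Torus : Type := AddCircle (2 : ℝ) × AddCircle (2 : ℝ)

/-- The linear coordinates `(re + im, im - re)` of the plane. -/
def diagCoord : ℂ ≃ₜ ℝ × ℝ where
  toFun z := (z.re + z.im, z.im - z.re)
  invFun p := ⟨(p.1 - p.2) / 2, (p.1 + p.2) / 2⟩
  left_inv z := by apply Complex.ext <;> simp <;> ring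
  right_inv p := by apply Prod.ext <;> simp <;> ring
  continuous_toFun := by fun_prop
  continuous_invFun := Complex.equivRealProdCLM.symm.continuous.comp
    (f := fun p : ℝ × ℝ => ((p.1 - p.2) / 2, (p.1 + p.2) / 2)) (by fun_prop)

theorem diagCoord_apply (z : ℂ) : diagCoord z = (z.re + z.im, z.im - z.re) := rfl

/-- The projection of the plane onto the torus. -/
def toTorus : ℂ →+ Torus where
  toFun z := ((z.re + z.im : ℝ), (z.im - z.re : ℝ))
  map_zero' := by simp
  map_add' z w := by
    apply Prod.ext
    · simp only [Complex.add_re, Complex.add_im, Prod.mk_add_mk, ← AddCircle.coe_add]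
      congr 1; ring
    · simp only [Complex.add_re, Complex.add_im, Prod.mk_add_mk, ← AddCircle.coe_add]
      congr 1; ring

theorem toTorus_apply (z : ℂ) : toTorus z = (((z.re + z.im : ℝ) : AddCircle (2 : ℝ)),
    ((z.im - z.re : ℝ) : AddCircle (2 : ℝ))) := rfl

theorem continuous_toTorus : Continuous toTorus := by
  have : (toTorus : ℂ → Torus) = fun z => (((z.re + z.im : ℝ) : AddCircle (2 : ℝ)),
    ((z.im - z.re : ℝ) : AddCircle (2 : ℝ))) := rfl
  rw [this]
  exact ((AddCircle.continuous_mk' 2).comp (by fun_prop)).prodMk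
    ((AddCircle.continuous_mk' 2).comp (by fun_prop))

/-- The local inverse of `toTorus` with values in the open diamond centred at `c`. -/
def torusLift (c : ℂ) : OpenPartialHomeomorph Torus ℂ :=
  ((AddCircle.openPartialHomeomorphCoe (2 : ℝ) (c.re + c.im - 1)).prod
    (AddCircle.openPartialHomeomorphCoe (2 : ℝ) (c.im - c.re - 1))).symm.trans
    diagCoord.symm.toOpenPartialHomeomorph

/-- `z` lies in the open diamond centred at `c`. -/
def InDiamond (c z : ℂ) : Prop :=
  |z.re + z.im - (c.re + c.im)| < 1 ∧ |z.im - z.re - (c.im - c.re)| < 1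

theorem mem_torusLift_target {c z : ℂ} : z ∈ (torusLift c).target ↔ InDiamond c z := by
  simp only [torusLift, InDiamond, OpenPartialHomeomorph.trans_target, abs_lt]
  simp [diagCoord_apply]
  constructor <;> rintro ⟨⟨h1, h2⟩, h3, h4⟩ <;> refine ⟨⟨?_, ?_⟩, ?_, ?_⟩ <;> linarith

theorem torusLift_symm_apply (c z : ℂ) : (torusLift c).symm z = toTorus z := by
  simp [torusLift, diagCoord_apply, toTorus_apply]

theorem torusLift_toTorus {c z : ℂ} (h : InDiamond c z) : torusLift c (toTorus z) = z := by
  rw [← torusLift_symm_apply c]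
  exact (torusLift c).right_inv (mem_torusLift_target.2 h)

theorem toTorus_mem_source {c z : ℂ} (h : InDiamond c z) : toTorus z ∈ (torusLift c).source := by
  rw [← torusLift_symm_apply c]
  exact (torusLift c).map_target (mem_torusLift_target.2 h)

theorem toTorus_torusLift (c : ℂ) (t : Torus) : toTorus (torusLift c t) = t := by
  have : torusLift c t = diagCoord.symm
      (AddCircle.equivIco (2 : ℝ) (c.re + c.im - 1) t.1,
        AddCircle.equivIco (2 : ℝ) (c.im - c.re - 1) t.2) := by
    simp [torusLift]
  rw [this]
  set p : ℝ × ℝ := (↑(AddCircle.equivIco (2 : ℝ) (c.re + c.im - 1) t.1),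
        ↑(AddCircle.equivIco (2 : ℝ) (c.im - c.re - 1) t.2)) with hp
  have h : diagCoord (diagCoord.symm p) = p := diagCoord.apply_symm_apply p
  have e : ∀ z, toTorus z = (((diagCoord z).1 : AddCircle (2 : ℝ)),
    ((diagCoord z).2 : AddCircle (2 : ℝ))) := fun _ => rfl
  rw [e, h]
  apply Prod.ext
  · exact (AddCircle.equivIco (2 : ℝ) (c.re + c.im - 1)).symm_apply_apply t.1
  · exact (AddCircle.equivIco (2 : ℝ) (c.im - c.re - 1)).symm_apply_apply t.2

theorem inDiamond_torusLift {c : ℂ} {t : Torus} (h : t ∈ (torusLift c).source) :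
    InDiamond c (torusLift c t) :=
  mem_torusLift_target.1 ((torusLift c).map_source h)

theorem inDiamond_self (c : ℂ) : InDiamond c c := by simp [InDiamond]

theorem isOpen_inDiamond (c : ℂ) : IsOpen {z | InDiamond c z} := by
  have : {z | InDiamond c z} = (torusLift c).target := Set.ext fun _ => mem_torusLift_target.symm
  rw [this]
  exact (torusLift c).open_target

/-- The inradius of the diamond is `1 / √2 > 7 / 10`. The radii used around the slit satisfy `1/2 <
3/5 < 13/20 < 7/10`: half the slit, the region of linearity, the support, the diamond. -/
theorem inDiamond_of_norm_lt {c z : ℂ} (h : ‖z - c‖ < 7 / 10) : InDiamond c z := by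
  have h2 : (z.re - c.re) ^ 2 + (z.im - c.im) ^ 2 < (7 / 10) ^ 2 := by
    have := Complex.sq_norm (z - c)
    rw [Complex.normSq_apply, Complex.sub_re, Complex.sub_im] at this
    nlinarith [norm_nonneg (z - c)]
  constructor
  · rw [← sq_lt_one_iff_abs_lt_one]
    nlinarith [sq_nonneg ((z.re - c.re) - (z.im - c.im))]
  · rw [← sq_lt_one_iff_abs_lt_one]
    nlinarith [sq_nonneg ((z.re - c.re) + (z.im - c.im))]

theorem eq_zero_of_toTorus_eq_zero {l : ℂ} (h : toTorus l = 0) (hl : ‖l‖ < 7 / 10) : l = 0 := by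
  have h1 : InDiamond 0 l := inDiamond_of_norm_lt (by simpa using hl)
  have h2 : torusLift 0 (toTorus l) = l := torusLift_toTorus h1
  rw [h, ← map_zero toTorus, torusLift_toTorus (inDiamond_self 0)] at h2
  exact h2.symm

/-- A continuous function with values in the lattice is locally constant. -/
theorem eventually_eq_of_toTorus_eq_zero {Y : Type*} [TopologicalSpace Y] {g : Y → ℂ} {y : Y}
    (hg : ContinuousAt g y) (h : ∀ x, toTorus (g x) = 0) : ∀ᶠ x in 𝓝 y, g x = g y := by
  filter_upwards [hg.eventually (Metric.ball_mem_nhds (g y) (show (0 : ℝ) < 7 / 10 by norm_num))]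
    with x hx
  refine sub_eq_zero.1 (eq_zero_of_toTorus_eq_zero ?_ (by rwa [← dist_eq_norm]))
  rw [map_sub, h, h, sub_zero]

/-- Near a point of the diamond, the lift is a translation. -/
theorem torusLift_eventually {c z : ℂ} (h : toTorus z ∈ (torusLift c).source) :
    ∀ᶠ w in 𝓝 z, torusLift c (toTorus w) = w + (torusLift c (toTorus z) - z) := by
  have h1 : InDiamond c (z + (torusLift c (toTorus z) - z)) := by
    rw [add_sub_cancel]; exact inDiamond_torusLift h
  have h2 : Continuous fun w : ℂ => w + (torusLift c (toTorus z) - z) := by fun_prop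
  filter_upwards [h2.continuousAt.eventually ((isOpen_inDiamond c).mem_nhds h1)] with w hw
  rw [← torusLift_toTorus hw, map_add, map_sub, toTorus_torusLift, sub_self, add_zero]

/-! ### Periodic extension of compactly supported homeomorphisms -/

/-- The midpoint of the slit. -/
def slitMid : ℂ := 1 / 2

theorem toTorus_lift_mid_of_norm_lt {z : ℂ} (h : ‖z - slitMid‖ < 7 / 10) :
    torusLift slitMid (toTorus z) = z ∧ toTorus z ∈ (torusLift slitMid).source :=
  ⟨torusLift_toTorus (inDiamond_of_norm_lt h), toTorus_mem_source (inDiamond_of_norm_lt h)⟩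

theorem mem_source_of_norm_lt {t : Torus} (h : ‖torusLift slitMid t - slitMid‖ < 7 / 10) :
    t ∈ (torusLift slitMid).source := by
  rw [← toTorus_torusLift slitMid t]
  exact (toTorus_lift_mid_of_norm_lt h).2

/-- The lift jumps at the boundary of the diamond, so its continuity cannot be used. Instead, the
torus points within distance `13/20` of the midpoint form the image of a compact disc, which is
closed. -/
theorem eventually_far {t : Torus} (h : 13 / 20 < ‖torusLift slitMid t - slitMid‖) :
    ∀ᶠ t' in 𝓝 t, 13 / 20 ≤ ‖torusLift slitMid t' - slitMid‖ := by
  have hK : IsClosed (toTorus '' Metric.closedBall slitMid (13 / 20)) :=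
    ((isCompact_closedBall slitMid (13 / 20)).image continuous_toTorus).isClosed
  have ht : t ∉ toTorus '' Metric.closedBall slitMid (13 / 20) := by
    rintro ⟨z, hz, rfl⟩
    rw [mem_closedBall_iff_norm] at hz
    rw [(toTorus_lift_mid_of_norm_lt (by linarith)).1] at h
    linarith
  filter_upwards [hK.isOpen_compl.mem_nhds ht] with t' ht'
  by_contra hlt
  push Not at hlt
  exact ht' ⟨_, mem_closedBall_iff_norm.2 hlt.le, toTorus_torusLift _ _⟩

/-- The lift jumps only where `g` vanishes. -/
theorem continuous_comp_torusLift {g : ℂ → ℂ} (hg : Continuous g)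
    (h0 : ∀ z, 13 / 20 ≤ ‖z - slitMid‖ → g z = 0) : Continuous fun t => g (torusLift slitMid t) := by
  rw [continuous_iff_continuousAt]
  intro t
  rcases lt_or_ge (13 / 20) ‖torusLift slitMid t - slitMid‖ with h | h
  · have : (fun t => g (torusLift slitMid t)) =ᶠ[𝓝 t] fun _ => 0 := by
      filter_upwards [eventually_far h] with t' ht'
      exact h0 _ ht'
    exact continuousAt_const.congr this.symm
  · exact ContinuousAt.comp hg.continuousAt
      ((torusLift slitMid).continuousAt (mem_source_of_norm_lt (by linarith)))

/-- The periodic extension of a homeomorphism supported in the disc of radius `13/20`. -/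
def periodicFun (k : ℂ → ℂ) (z : ℂ) : ℂ :=
  z + (k (torusLift slitMid (toTorus z)) - torusLift slitMid (toTorus z))

theorem continuous_periodicFun {k : ℂ → ℂ} (hk : Continuous k)
    (h0 : ∀ z, 13 / 20 ≤ ‖z - slitMid‖ → k z = z) : Continuous (periodicFun k) := by
  have := continuous_comp_torusLift (g := fun z => k z - z) (by fun_prop)
    (fun z hz => sub_eq_zero.2 (h0 z hz))
  exact continuous_id.add (this.comp continuous_toTorus)

/-- Being the identity outside the supporting disc, the bijection `k` maps that disc to itself, so
there the image under `k` is still its own lift. -/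
theorem torusLift_periodicFun {k : ℂ ≃ₜ ℂ}
    (h0 : ∀ z, 13 / 20 ≤ ‖z - slitMid‖ → k z = z) (z : ℂ) :
    torusLift slitMid (toTorus (periodicFun k z)) = k (torusLift slitMid (toTorus z)) := by
  set w := torusLift slitMid (toTorus z) with hw
  have e : toTorus (periodicFun k z) = toTorus (k w) := by
    rw [periodicFun, ← hw, map_add, map_sub, hw, toTorus_torusLift]
    abel
  rw [e]
  by_cases h : 13 / 20 ≤ ‖w - slitMid‖
  · rw [h0 w h, hw, toTorus_torusLift]
  · refine (toTorus_lift_mid_of_norm_lt ?_).1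
    by_contra h'
    -- An image outside the disc would be fixed by `k`, and injectivity would put `w` outside as
    -- well.
    have h1 : k (k w) = k w := h0 _ (by linarith)
    rw [k.injective h1] at h'
    linarith

/-- The periodic extension, as a homeomorphism. -/
def periodicHomeomorph (k : ℂ ≃ₜ ℂ) (h0 : ∀ z, 13 / 20 ≤ ‖z - slitMid‖ → k z = z) : ℂ ≃ₜ ℂ where
  toFun := periodicFun k
  invFun := periodicFun k.symm
  left_inv z := by
    rw [periodicFun, torusLift_periodicFun h0, k.symm_apply_apply, periodicFun]
    ring
  right_inv z := by
    rw [periodicFun, torusLift_periodicFun (k := k.symm), k.apply_symm_apply, periodicFun]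
    · ring
    · intro z hz
      rw [k.symm_apply_eq, h0 z hz]
  continuous_toFun := continuous_periodicFun k.continuous h0
  continuous_invFun := continuous_periodicFun k.symm.continuous fun z hz => by
    rw [k.symm_apply_eq, h0 z hz]

theorem orientedDiffAt_periodicFun {k : ℂ → ℂ} (hk : ∀ z, OrientedDiffAt k z)
    (h0 : ∀ z, 13 / 20 ≤ ‖z - slitMid‖ → k z = z) (z : ℂ) : OrientedDiffAt (periodicFun k) z := by
  rcases lt_or_ge (13 / 20) ‖torusLift slitMid (toTorus z) - slitMid‖ with h | h
  · refine (orientedDiffAt_of_hasDerivAt one_ne_zero (hasDerivAt_id z)).congr ?_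
    filter_upwards [continuous_toTorus.continuousAt.eventually (eventually_far h)] with w hw
    rw [periodicFun, h0 _ hw, sub_self, add_zero, id]
  · have hs := torusLift_eventually (mem_source_of_norm_lt (t := toTorus z) (by linarith))
    set l := torusLift slitMid (toTorus z) - z
    have : OrientedDiffAt (fun w => k (w + l) + -l) z :=
      ((hk (z + l)).comp (g := fun w => w + l)
        (orientedDiffAt_of_hasDerivAt one_ne_zero ((hasDerivAt_id z).add_const l))).add_const _
    refine this.congr ?_
    filter_upwards [hs] with w hw
    rw [periodicFun, hw]
    ring

/-! ### The developing map of a single handle -/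

/-- The developing map of a handle: an orientation preserving homeomorphism of the plane which is
equivariant with respect to a given linear map on the lattice, and a fixed similarity near the
slit. -/
theorem exists_handleHomeomorph {a b : ℂ} (h : ‖b‖ < ‖a‖) :
    ∃ C₀ : ℝ, ∀ C ≥ C₀, ∃ H : ℂ ≃ₜ ℂ,
      (∀ z l, toTorus l = 0 → H (z + l) = H z + planeMap a b l) ∧
      (∀ z, ‖z - slitMid‖ ≤ 3 / 5 → H z = (Real.exp (-C) : ℝ) * (z - slitMid)) ∧
      ∀ z, OrientedDiffAt H z := by
  obtain ⟨i1, i2⟩ := planeMap_inverse h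
  set Δ : ℝ := ‖a‖ ^ 2 - ‖b‖ ^ 2
  have hΔ : 0 < Δ := by
    have := norm_nonneg b
    simp only [Δ]; nlinarith
  have h' : ‖-b / (Δ : ℂ)‖ < ‖(starRingEnd ℂ) a / (Δ : ℂ)‖ := by
    rw [norm_div, norm_div, norm_neg, RCLike.norm_conj]
    have : 0 < ‖(Δ : ℂ)‖ := by rw [Complex.norm_real]; exact norm_pos_iff.2 hΔ.ne'
    gcongr
  obtain ⟨C₀, hC₀⟩ := exists_extendsByIdentity_exp_smul h'
  refine ⟨C₀, fun C hC => ?_⟩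
  obtain ⟨k, k1, k2, k3⟩ := hC₀ C hC
  let k' : ℂ ≃ₜ ℂ := ((Homeomorph.addRight (-slitMid)).trans k).trans (Homeomorph.addRight slitMid)
  have hk' : ∀ z, k' z = k (z - slitMid) + slitMid := fun z => by
    simp [k', sub_eq_add_neg]
  have h0 : ∀ z, 13 / 20 ≤ ‖z - slitMid‖ → k' z = z := fun z hz => by
    rw [hk', k2 _ hz, sub_add_cancel]
  let A : ℂ ≃L[ℝ] ℂ := ContinuousLinearEquiv.equivOfInverse (planeMap a b) (planeMap _ _)
    (fun z => by rw [← ContinuousLinearMap.comp_apply, i2]; rfl)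
    (fun z => by rw [← ContinuousLinearMap.comp_apply, i1]; rfl)
  have hA : ∀ z, A z = planeMap a b z := fun z => rfl
  -- With `A` the given linear map, the homeomorphism `k'` is `exp (-C) A⁻¹` around the midpoint.
  -- Extending it periodically, recentring and applying `A` leaves the bare factor `exp (-C)` near
  -- the slit; the periodic displacement does not affect lattice translations, which therefore act
  -- through `A`.
  refine ⟨((periodicHomeomorph k' h0).trans (Homeomorph.addRight (-slitMid))).trans
    A.toHomeomorph, ?_, ?_, ?_⟩
  · intro z l hl
    change A (periodicFun k' (z + l) + -slitMid) = A (periodicFun k' z + -slitMid) + _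
    have : periodicFun k' (z + l) = periodicFun k' z + l := by
      rw [periodicFun, periodicFun, map_add, hl, add_zero]
      ring
    rw [this, hA, hA, ← map_add]
    congr 1
    ring
  · intro z hz
    change A (periodicFun k' z + -slitMid) = _
    rw [periodicFun, (toTorus_lift_mid_of_norm_lt (by linarith)).1, hk', k1 _ hz, hA]
    have : z + (planeMap (↑(Real.exp (-C)) * ((starRingEnd ℂ) a / (Δ : ℂ)))
        (↑(Real.exp (-C)) * (-b / (Δ : ℂ))) (z - slitMid) + slitMid - z) + -slitMid =
        Real.exp (-C) • planeMap ((starRingEnd ℂ) a / (Δ : ℂ)) (-b / (Δ : ℂ)) (z - slitMid) := by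
      simp only [planeMap_apply, Complex.real_smul]
      ring
    rw [this, map_smul, ← ContinuousLinearMap.comp_apply, i1, Complex.real_smul]
    rfl
  · intro z
    have hk3 : ∀ z, OrientedDiffAt k' z := fun z => by
      have : OrientedDiffAt (fun w => k (w + -slitMid) + slitMid) z :=
        ((k3 (z + -slitMid)).comp (g := fun w => w + -slitMid)
          (orientedDiffAt_of_hasDerivAt one_ne_zero ((hasDerivAt_id z).add_const _))).add_const _
      exact this
    exact (orientedDiffAt_planeMap h _).comp
      ((orientedDiffAt_periodicFun hk3 h0 z).add_const (-slitMid))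

end

end AbelianPeriods

namespace AbelianPeriods

set_option linter.unusedSectionVars false

noncomputable section

/-! ### The cyclic branched covering of the torus -/

/-- A cut-off function around the slit. -/
def slitBump : ContDiffBump slitMid := ⟨3 / 5, 13 / 20, by norm_num, by norm_num⟩

/-- A function on the torus which near the slit `[0,1]` is `z * conj (z - 1)`, and which takes
values in the slit plane exactly away from the slit. -/
def slitFun (t : Torus) : ℂ :=
  -- The zeros of `z` and of `conj (z - 1)` have indices `1` and `-1`. There is thus no winding
  -- around the whole slit, which allows the function to be cut off to the constant `1`.
  1 + slitBump (torusLift slitMid t) •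
    (torusLift slitMid t * (starRingEnd ℂ) (torusLift slitMid t - 1) - 1)

theorem continuous_slitFun : Continuous slitFun := by
  refine continuous_const.add (continuous_comp_torusLift
    (g := fun z => slitBump z • (z * (starRingEnd ℂ) (z - 1) - 1)) ?_ ?_)
  · exact slitBump.continuous.smul (by fun_prop)
  · intro z hz
    rw [slitBump.zero_of_le_dist (by rwa [dist_eq_norm]), zero_smul]

theorem slitFun_near {t : Torus} (h : ‖torusLift slitMid t - slitMid‖ ≤ 3 / 5) :
    slitFun t = torusLift slitMid t * (starRingEnd ℂ) (torusLift slitMid t - 1) := by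
  rw [slitFun, slitBump.one_of_mem_closedBall (by rwa [mem_closedBall_iff_norm]), one_smul,
    add_sub_cancel]

theorem slitFun_toTorus_near {z : ℂ} (h : ‖z - slitMid‖ ≤ 3 / 5) :
    slitFun (toTorus z) = z * (starRingEnd ℂ) (z - 1) := by
  have e := (toTorus_lift_mid_of_norm_lt (z := z) (by linarith)).1
  rw [slitFun_near (by rwa [e]), e]

theorem norm_sub_slitMid_of_mem_Icc {x : ℝ} (hx : x ∈ Set.Icc (0 : ℝ) 1) :
    ‖(x : ℂ) - slitMid‖ < 3 / 5 := by
  have : (x : ℂ) - slitMid = ((x - 1 / 2 : ℝ) : ℂ) := by simp [slitMid]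
  rw [this, Complex.norm_real, Real.norm_eq_abs, abs_lt]
  constructor <;> linarith [hx.1, hx.2]

theorem slitFun_toTorus_ofReal {x : ℝ} (hx : x ∈ Set.Icc (0 : ℝ) 1) :
    slitFun (toTorus x) = ((x * (x - 1) : ℝ) : ℂ) := by
  rw [slitFun_toTorus_near (norm_sub_slitMid_of_mem_Icc hx).le]
  simp

/-- The function takes values in the slit plane away from the slit. -/
theorem slitFun_mem_slitPlane_or (t : Torus) :
    slitFun t ∈ Complex.slitPlane ∨ ∃ x ∈ Set.Icc (0 : ℝ) 1, torusLift slitMid t = x := by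
  set z := torusLift slitMid t with hz
  have h0 : 0 ≤ slitBump z := slitBump.nonneg
  have h1 : slitBump z ≤ 1 := slitBump.le_one
  have hre : (slitFun t).re = 1 + slitBump z * (z.re * (z.re - 1) + z.im * z.im - 1) := by
    simp [slitFun, ← hz]
  have him : (slitFun t).im = - (slitBump z * z.im) := by
    simp [slitFun, ← hz]
    ring
  rw [Complex.mem_slitPlane_iff]
  -- Where the bump vanishes the value is `1`. Elsewhere the imaginary part vanishes only on the
  -- real axis, and there `x (x - 1) > 0` outside `[0,1]` makes the real part positive.
  rcases h0.eq_or_lt with hb | hb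
  · left; left
    rw [hre, ← hb]; simp
  by_cases hi : z.im = 0
  · by_cases hx : z.re ∈ Set.Icc (0 : ℝ) 1
    · right
      exact ⟨z.re, hx, Complex.ext rfl (by simpa using hi)⟩
    · left; left
      rw [hre, hi]
      have : 0 < z.re * (z.re - 1) := by
        rw [Set.mem_Icc, not_and_or, not_le, not_le] at hx
        rcases hx with h | h <;> nlinarith
      nlinarith [mul_pos hb this]
  · left; right
    rw [him]
    exact neg_ne_zero.2 (mul_ne_zero hb.ne' hi)

theorem torusLift_eq_of_slitFun_eq_zero {t : Torus} (h : slitFun t = 0) :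
    torusLift slitMid t = 0 ∨ torusLift slitMid t = 1 := by
  rcases slitFun_mem_slitPlane_or t with h' | ⟨x, hx, e⟩
  · rw [h] at h'
    simp at h'
  · have := slitFun_toTorus_ofReal hx
    rw [← e, toTorus_torusLift, h] at this
    have h2 : x * (x - 1) = 0 := by exact_mod_cast this.symm
    rw [e]
    rcases mul_eq_zero.1 h2 with h3 | h3
    · left; rw [h3]; simp
    · right; rw [sub_eq_zero.1 h3]; simp

theorem slitFun_zero : slitFun (toTorus 0) = 0 := by
  simpa using slitFun_toTorus_ofReal (x := 0) (by simp)

theorem slitFun_one : slitFun (toTorus 1) = 0 := by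
  simpa using slitFun_toTorus_ofReal (x := 1) (by simp)

/-- The values of the function avoid the open negative axis away from the open slit. -/
theorem continuousAt_cpow_slitFun {n : ℕ} (hn : n ≠ 0) {t : Torus}
    (h : slitFun t ∈ Complex.slitPlane ∨ slitFun t = 0) :
    ContinuousAt (fun t => slitFun t ^ ((n : ℂ)⁻¹)) t := by
  have hre : 0 < ((n : ℂ)⁻¹).re := by
    rw [← Complex.ofReal_natCast, ← Complex.ofReal_inv, Complex.ofReal_re]
    positivity
  refine ContinuousAt.comp (f := slitFun)
    (Complex.continuousAt_cpow_const_of_re_pos ?_ hre) continuous_slitFun.continuousAt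
  rcases h with h | h
  · rcases h with h | h
    · exact Or.inl h.le
    · exact Or.inr h
  · left; rw [h]; simp

/-- The `n`-fold cyclic covering of the torus branched at the two ends of the slit. -/
structure CyclicCover (n : ℕ) where
  /-- The projection to the torus. -/
  base : Torus
  /-- The fibre coordinate. -/
  root : ℂ
  root_pow : root ^ n = slitFun base

namespace CyclicCover

variable {n : ℕ}

/-- The coordinates of a point of the covering. -/
def coords (r : CyclicCover n) : Torus × ℂ := (r.base, r.root)

instance : TopologicalSpace (CyclicCover n) := TopologicalSpace.induced coords inferInstance

theorem isInducing_coords : Topology.IsInducing (coords (n := n)) := ⟨rfl⟩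

theorem continuous_base : Continuous (base (n := n)) :=
  continuous_fst.comp isInducing_coords.continuous

theorem continuous_root : Continuous (root (n := n)) :=
  continuous_snd.comp isInducing_coords.continuous

theorem ext {r s : CyclicCover n} (h : r.base = s.base) (h' : r.root = s.root) : r = s := by
  cases r; cases s; cases h; cases h'; rfl

theorem coords_injective : Function.Injective (coords (n := n)) := fun _ _ h =>
  ext (congrArg Prod.fst h) (congrArg Prod.snd h)

instance : T2Space (CyclicCover n) :=
  T2Space.of_injective_continuous coords_injective isInducing_coords.continuous

variable [NeZero n]

/-- The point with given coordinates (and the centre if the coordinates do not satisfy the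
equation). -/
def ofCoords (n : ℕ) [NeZero n] (t : Torus) (u : ℂ) : CyclicCover n :=
  open Classical in
  if h : u ^ n = slitFun t then ⟨t, u, h⟩ else
    ⟨toTorus 0, 0, by rw [slitFun_zero, zero_pow (NeZero.ne n)]⟩

theorem base_ofCoords {t : Torus} {u : ℂ} (h : u ^ n = slitFun t) : (ofCoords n t u).base = t := by
  rw [ofCoords, dif_pos h]

theorem root_ofCoords {t : Torus} {u : ℂ} (h : u ^ n = slitFun t) : (ofCoords n t u).root = u := by
  rw [ofCoords, dif_pos h]

theorem ofCoords_base_root (r : CyclicCover n) : ofCoords n r.base r.root = r :=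
  ext (base_ofCoords r.root_pow) (root_ofCoords r.root_pow)

theorem continuousOn_ofCoords {Y : Type*} [TopologicalSpace Y] {s : Set Y} {t : Y → Torus} {u : Y → ℂ}
    (ht : ContinuousOn t s) (hu : ContinuousOn u s) (h : ∀ y ∈ s, u y ^ n = slitFun (t y)) :
    ContinuousOn (fun y => ofCoords n (t y) (u y)) s := by
  rw [isInducing_coords.continuousOn_iff]
  refine (ht.prodMk hu).congr fun y hy => ?_
  exact Prod.ext (base_ofCoords (h y hy)) (root_ofCoords (h y hy))

/-- The primitive root of unity `exp (2 π i / n)`. -/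
def deckRoot (n : ℕ) : ℂ := Complex.exp (2 * Real.pi * Complex.I / n)

theorem deckRoot_pow_mul_pow (j : ℕ) : (deckRoot n ^ j) ^ n = 1 := by
  rw [← pow_mul, mul_comm, pow_mul, deckRoot, (Complex.isPrimitiveRoot_exp n (NeZero.ne n)).pow_eq_one,
    one_pow]

theorem deckRoot_pow_injective {i j : Fin n} (h : deckRoot n ^ (i : ℕ) = deckRoot n ^ (j : ℕ)) :
    i = j :=
  Fin.ext ((Complex.isPrimitiveRoot_exp n (NeZero.ne n)).pow_inj i.2 j.2 h)

theorem exists_deckRoot_pow {x : ℂ} (h : x ^ n = 1) : ∃ j : Fin n, x = deckRoot n ^ (j : ℕ) := by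
  obtain ⟨i, hi, e⟩ := (Complex.isPrimitiveRoot_exp n (NeZero.ne n)).eq_pow_of_pow_eq_one h
  exact ⟨⟨i, hi⟩, e.symm⟩

/-- The complement is a finite set. In this form it says that a continuously varying `n`-th root of
unity is locally constant. -/
theorem isOpen_unique_root (j : ℕ) : IsOpen {x : ℂ | x ^ n = 1 → x = deckRoot n ^ j} := by
  have hf : {x : ℂ | x ^ n = 1 ∧ x ≠ deckRoot n ^ j}.Finite := by
    refine (Set.finite_range fun i : Fin n => deckRoot n ^ (i : ℕ)).subset ?_
    rintro x ⟨hx, -⟩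
    obtain ⟨i, hi⟩ := exists_deckRoot_pow hx
    exact ⟨i, hi.symm⟩
  convert hf.isClosed.isOpen_compl using 1
  ext x
  simp

/-! ### The charts -/

/-- The branch of the root of `slitFun` on the sheet `j`. -/
def sheetRoot (n j : ℕ) (t : Torus) : ℂ := deckRoot n ^ j * slitFun t ^ ((n : ℂ)⁻¹)

theorem sheetRoot_pow (j : ℕ) (t : Torus) : sheetRoot n j t ^ n = slitFun t := by
  rw [sheetRoot, mul_pow, deckRoot_pow_mul_pow, one_mul, Complex.cpow_nat_inv_pow _ (NeZero.ne n)]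

theorem continuousAt_sheetRoot (j : ℕ) {t : Torus}
    (h : slitFun t ∈ Complex.slitPlane ∨ slitFun t = 0) : ContinuousAt (sheetRoot n j) t :=
  continuousAt_const.mul (continuousAt_cpow_slitFun (NeZero.ne n) h)

/-- The part of the covering over the complement of the slit belonging to the sheet `j`. -/
def sheet (n j : ℕ) : Set (CyclicCover n) :=
  {r | slitFun r.base ∈ Complex.slitPlane ∧ r.root = sheetRoot n j r.base}

/-- Off the slit, the fibre coordinate divided by the principal root is a continuous function with
values in the `n`-th roots of unity. -/
theorem isOpen_sheet (j : ℕ) : IsOpen (sheet n j) := by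
  have hU : IsOpen {r : CyclicCover n | slitFun r.base ∈ Complex.slitPlane} :=
    Complex.isOpen_slitPlane.preimage (continuous_slitFun.comp continuous_base)
  have hc : ContinuousOn (fun r : CyclicCover n => r.root / slitFun r.base ^ ((n : ℂ)⁻¹))
      {r : CyclicCover n | slitFun r.base ∈ Complex.slitPlane} := by
    intro r hr
    refine ContinuousAt.continuousWithinAt (ContinuousAt.div continuous_root.continuousAt
      (ContinuousAt.comp' (continuousAt_cpow_slitFun (NeZero.ne n) (Or.inl hr))
        continuous_base.continuousAt) ?_)
    simp [Complex.cpow_eq_zero_iff, Complex.slitPlane_ne_zero hr]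
  convert hc.isOpen_inter_preimage hU (isOpen_unique_root (n := n) j) using 1
  ext r
  refine and_congr_right fun hr => ?_
  have h0 : slitFun r.base ^ ((n : ℂ)⁻¹) ≠ 0 := by
    simp [Complex.cpow_eq_zero_iff, Complex.slitPlane_ne_zero hr]
  have h1 : (r.root / slitFun r.base ^ ((n : ℂ)⁻¹)) ^ n = 1 := by
    rw [div_pow, r.root_pow, Complex.cpow_nat_inv_pow _ (NeZero.ne n),
      div_self (Complex.slitPlane_ne_zero hr)]
  simp only [Set.mem_preimage, Set.mem_ofPred_eq, h1, forall_const, sheetRoot]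
  rw [div_eq_iff h0]

theorem exists_mem_sheet {r : CyclicCover n} (h : slitFun r.base ∈ Complex.slitPlane) :
    ∃ j : Fin n, r ∈ sheet n j := by
  have h0 : slitFun r.base ^ ((n : ℂ)⁻¹) ≠ 0 := by
    simp [Complex.cpow_eq_zero_iff, Complex.slitPlane_ne_zero h]
  have h1 : (r.root / slitFun r.base ^ ((n : ℂ)⁻¹)) ^ n = 1 := by
    rw [div_pow, r.root_pow, Complex.cpow_nat_inv_pow _ (NeZero.ne n),
      div_self (Complex.slitPlane_ne_zero h)]
  obtain ⟨j, hj⟩ := exists_deckRoot_pow h1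
  exact ⟨j, h, by rw [sheetRoot, ← hj, div_mul_cancel₀ _ h0]⟩

theorem sheet_unique {r : CyclicCover n} {i j : Fin n} (hi : r ∈ sheet n i) (hj : r ∈ sheet n j) :
    i = j := by
  have h0 : slitFun r.base ^ ((n : ℂ)⁻¹) ≠ 0 := by
    simp [Complex.cpow_eq_zero_iff, Complex.slitPlane_ne_zero hi.1]
  exact deckRoot_pow_injective (mul_right_cancel₀ h0 (hi.2.symm.trans hj.2))

/-- The chart of the sheet `j` with values in the diamond centred at `c`. -/
def sheetChart (n : ℕ) [NeZero n] (j : ℕ) (c : ℂ) : OpenPartialHomeomorph (CyclicCover n) ℂ where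
  toFun r := torusLift c r.base
  invFun z := ofCoords n (toTorus z) (sheetRoot n j (toTorus z))
  source := {r | r.base ∈ (torusLift c).source} ∩ sheet n j
  target := {z | InDiamond c z} ∩ {z | slitFun (toTorus z) ∈ Complex.slitPlane}
  map_source' r hr := ⟨inDiamond_torusLift hr.1, by
    simp only [Set.mem_ofPred_eq, toTorus_torusLift]; exact hr.2.1⟩
  map_target' z hz := by
    simp only [Set.mem_inter_iff, Set.mem_ofPred_eq, sheet, base_ofCoords (sheetRoot_pow j (toTorus z)),
      root_ofCoords (sheetRoot_pow j (toTorus z)), and_true]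
    exact ⟨toTorus_mem_source hz.1, hz.2⟩
  left_inv' r hr := by
    rw [toTorus_torusLift, ← hr.2.2, ofCoords_base_root]
  right_inv' z hz := by
    rw [base_ofCoords (sheetRoot_pow j (toTorus z)), torusLift_toTorus hz.1]
  open_source := ((torusLift c).open_source.preimage continuous_base).inter (isOpen_sheet j)
  open_target := (isOpen_inDiamond c).inter
    (Complex.isOpen_slitPlane.preimage (continuous_slitFun.comp continuous_toTorus))
  continuousOn_toFun := (torusLift c).continuousOn.comp continuous_base.continuousOn
    fun r hr => hr.1
  continuousOn_invFun := by
    refine continuousOn_ofCoords continuous_toTorus.continuousOn ?_ fun z _ => sheetRoot_pow j _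
    intro z hz
    exact (ContinuousAt.comp (continuousAt_sheetRoot j (Or.inl hz.2))
      continuous_toTorus.continuousAt).continuousWithinAt

/-! ### Charts around the two branch points -/

/-- The `n`-th root of the square of the norm. -/
def rootScale (n : ℕ) (z : ℂ) : ℂ := ((‖z‖ ^ 2) ^ ((n : ℝ)⁻¹) : ℝ)

theorem continuous_rootScale : Continuous (rootScale n) :=
  Complex.continuous_ofReal.comp ((Real.continuous_rpow_const (by positivity)).comp
    (continuous_norm.pow 2))

theorem rootScale_pow (z : ℂ) : rootScale n z ^ n = z * (starRingEnd ℂ) z := by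
  rw [rootScale, ← Complex.ofReal_pow, Real.rpow_inv_natCast_pow (by positivity) (NeZero.ne n),
    Complex.mul_conj']
  simp

theorem rootScale_ne_zero {z : ℂ} (hz : z ≠ 0) : rootScale n z ≠ 0 := by
  rw [rootScale]
  have : 0 < ‖z‖ := norm_pos_iff.2 hz
  exact_mod_cast (Real.rpow_pos_of_pos (by positivity) _).ne'

theorem conj_rootScale (z : ℂ) : (starRingEnd ℂ) (rootScale n z) = rootScale n z :=
  Complex.conj_ofReal _

/-- The points lying over the disc around the slit. -/
def nearSlit (n : ℕ) : Set (CyclicCover n) := {r | ‖torusLift slitMid r.base - slitMid‖ < 3 / 5}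

theorem isOpen_nearSlit : IsOpen (nearSlit n) := by
  have h : nearSlit n = {r : CyclicCover n | r.base ∈ (torusLift slitMid).source ∩
      torusLift slitMid ⁻¹' Metric.ball slitMid (3 / 5)} := by
    ext r
    simp only [nearSlit, Set.mem_ofPred_eq, Set.mem_inter_iff, Set.mem_preimage,
      mem_ball_iff_norm]
    exact ⟨fun h => ⟨mem_source_of_norm_lt (by linarith), h⟩, fun h => h.2⟩
  rw [h]
  exact ((torusLift slitMid).isOpen_inter_preimage Metric.isOpen_ball).preimage continuous_base

theorem continuousOn_lift_nearSlit :
    ContinuousOn (fun r : CyclicCover n => torusLift slitMid r.base) (nearSlit n) :=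
  (torusLift slitMid).continuousOn.comp continuous_base.continuousOn fun r hr =>
    mem_source_of_norm_lt (lt_trans hr (by norm_num))

theorem isOpen_nearSlit_inter_ne (c : ℂ) :
    IsOpen (nearSlit n ∩ {r | torusLift slitMid r.base ≠ c}) :=
  continuousOn_lift_nearSlit.isOpen_inter_preimage isOpen_nearSlit isOpen_ne

theorem root_pow_nearSlit {r : CyclicCover n} (h : r ∈ nearSlit n) :
    r.root ^ n = torusLift slitMid r.base * (starRingEnd ℂ) (torusLift slitMid r.base - 1) := by
  rw [r.root_pow, slitFun_near (le_of_lt h)]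

theorem isOpen_chart_target (g : ℂ → ℂ) (hg : ContinuousOn g {w | w ^ n ≠ 1}) :
    IsOpen ({w : ℂ | w ^ n ≠ 1} ∩ g ⁻¹' Metric.ball slitMid (3 / 5)) :=
  hg.isOpen_inter_preimage (isOpen_ne.preimage (continuous_pow n)) Metric.isOpen_ball

/-- The coordinate of the torus as a function of the chart at the centre. -/
def centreCoord (n : ℕ) (w : ℂ) : ℂ := w ^ n / (w ^ n - 1)

/-- The coordinate of the torus as a function of the chart at the vertex. -/
def vertexCoord (n : ℕ) (w : ℂ) : ℂ := 1 / (1 - w ^ n)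

theorem centreCoord_root {w : ℂ} (hw : w ^ n ≠ 1) :
    (w * rootScale n (centreCoord n w - 1)) ^ n =
      centreCoord n w * (starRingEnd ℂ) (centreCoord n w - 1) := by
  have h : w ^ n - 1 ≠ 0 := sub_ne_zero.2 hw
  rw [mul_pow, rootScale_pow, ← mul_assoc]
  congr 1
  rw [centreCoord]
  field_simp
  ring

theorem vertexCoord_root {w : ℂ} (hw : w ^ n ≠ 1) :
    ((starRingEnd ℂ) w * rootScale n (vertexCoord n w)) ^ n =
      vertexCoord n w * (starRingEnd ℂ) (vertexCoord n w - 1) := by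
  have h : 1 - w ^ n ≠ 0 := sub_ne_zero.2 (Ne.symm hw)
  have e : vertexCoord n w - 1 = w ^ n * vertexCoord n w := by
    rw [vertexCoord]
    field_simp
    ring
  rw [mul_pow, rootScale_pow, e, map_mul, map_pow]
  ring

theorem centreCoord_ne_one {w : ℂ} (hw : w ^ n ≠ 1) : centreCoord n w ≠ 1 := by
  have h : w ^ n - 1 ≠ 0 := sub_ne_zero.2 hw
  rw [centreCoord, Ne, div_eq_one_iff_eq h]
  intro h2
  have : (1 : ℂ) = 0 := by linear_combination h2
  exact one_ne_zero this

theorem vertexCoord_ne_zero {w : ℂ} (hw : w ^ n ≠ 1) : vertexCoord n w ≠ 0 :=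
  one_div_ne_zero (sub_ne_zero.2 (Ne.symm hw))

/-- Dividing `u ^ n = z * conj (z - 1)` by `‖z - 1‖ ^ 2` gives `z / (z - 1)`. So the `n`-th power of
the coordinate is a Möbius function of `z`, and `centreCoord` inverts this function. -/
theorem centreCoord_chart {r : CyclicCover n} (h : r ∈ nearSlit n)
    (h1 : torusLift slitMid r.base ≠ 1) :
    (r.root / rootScale n (torusLift slitMid r.base - 1)) ^ n ≠ 1 ∧
    centreCoord n (r.root / rootScale n (torusLift slitMid r.base - 1)) =
      torusLift slitMid r.base := by
  set z := torusLift slitMid r.base with hz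
  have hz1 : z - 1 ≠ 0 := sub_ne_zero.2 h1
  have hc : (starRingEnd ℂ) (z - 1) ≠ 0 := (map_ne_zero _).2 hz1
  have e : (r.root / rootScale n (z - 1)) ^ n = z / (z - 1) := by
    rw [div_pow, rootScale_pow, root_pow_nearSlit h, ← hz, mul_div_mul_right _ _ hc]
  rw [centreCoord, e]
  refine ⟨?_, ?_⟩
  · rw [Ne, div_eq_one_iff_eq hz1]
    intro h2
    have : (1 : ℂ) = 0 := by linear_combination h2
    exact one_ne_zero this
  · field_simp
    ring

/-- At the end `1` of the slit the equation involves `conj (z - 1)`, so the root is conjugated: the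
`n`-th power of the coordinate becomes `(z - 1) / z`. -/
theorem vertexCoord_chart {r : CyclicCover n} (h : r ∈ nearSlit n)
    (h1 : torusLift slitMid r.base ≠ 0) :
    ((starRingEnd ℂ) r.root / rootScale n (torusLift slitMid r.base)) ^ n ≠ 1 ∧
    vertexCoord n ((starRingEnd ℂ) r.root / rootScale n (torusLift slitMid r.base)) =
      torusLift slitMid r.base := by
  set z := torusLift slitMid r.base with hz
  have hc : (starRingEnd ℂ) z ≠ 0 := (map_ne_zero _).2 h1
  have e : ((starRingEnd ℂ) r.root / rootScale n z) ^ n = (z - 1) / z := by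
    rw [div_pow, rootScale_pow, ← map_pow, root_pow_nearSlit h, ← hz, map_mul, Complex.conj_conj,
      mul_comm z, mul_div_mul_left _ _ hc]
  rw [vertexCoord, e]
  refine ⟨?_, ?_⟩
  · rw [Ne, div_eq_one_iff_eq h1]
    intro h2
    have : (1 : ℂ) = 0 := by linear_combination -h2
    exact one_ne_zero this
  · field_simp
    ring

theorem continuousOn_centreCoord : ContinuousOn (centreCoord n) {w | w ^ n ≠ 1} := by
  unfold centreCoord
  exact ContinuousOn.div (by fun_prop) (by fun_prop) fun w hw => sub_ne_zero.2 hw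

theorem continuousOn_vertexCoord : ContinuousOn (vertexCoord n) {w | w ^ n ≠ 1} := by
  unfold vertexCoord
  exact ContinuousOn.div (by fun_prop) (by fun_prop) fun w hw => sub_ne_zero.2 (Ne.symm hw)

theorem lift_toTorus_of_mem_ball {z : ℂ} (h : z ∈ Metric.ball slitMid (3 / 5)) :
    torusLift slitMid (toTorus z) = z :=
  (toTorus_lift_mid_of_norm_lt (by rw [mem_ball_iff_norm] at h; linarith)).1

theorem slitFun_toTorus_of_mem_ball {z : ℂ} (h : z ∈ Metric.ball slitMid (3 / 5)) :
    slitFun (toTorus z) = z * (starRingEnd ℂ) (z - 1) :=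
  slitFun_toTorus_near (by rw [mem_ball_iff_norm] at h; linarith)

/-- The chart around the centre. -/
def centreChart (n : ℕ) [NeZero n] : OpenPartialHomeomorph (CyclicCover n) ℂ where
  toFun r := r.root / rootScale n (torusLift slitMid r.base - 1)
  invFun w := ofCoords n (toTorus (centreCoord n w)) (w * rootScale n (centreCoord n w - 1))
  source := nearSlit n ∩ {r | torusLift slitMid r.base ≠ 1}
  target := {w | w ^ n ≠ 1} ∩ centreCoord n ⁻¹' Metric.ball slitMid (3 / 5)
  map_source' r hr := by
    obtain ⟨h1, h2⟩ := centreCoord_chart hr.1 hr.2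
    refine ⟨h1, ?_⟩
    rw [Set.mem_preimage, h2]
    exact mem_ball_iff_norm.2 hr.1
  map_target' w hw := by
    have e := (centreCoord_root hw.1).trans (slitFun_toTorus_of_mem_ball hw.2).symm
    simp only [Set.mem_inter_iff, nearSlit, Set.mem_ofPred_eq, base_ofCoords e,
      lift_toTorus_of_mem_ball hw.2]
    exact ⟨mem_ball_iff_norm.1 hw.2, centreCoord_ne_one hw.1⟩
  left_inv' r hr := by
    rw [(centreCoord_chart hr.1 hr.2).2, toTorus_torusLift,
      div_mul_cancel₀ _ (rootScale_ne_zero (sub_ne_zero.2 hr.2)), ofCoords_base_root]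
  right_inv' w hw := by
    have e := (centreCoord_root hw.1).trans (slitFun_toTorus_of_mem_ball hw.2).symm
    rw [base_ofCoords e, root_ofCoords e, lift_toTorus_of_mem_ball hw.2,
      mul_div_cancel_right₀ _ (rootScale_ne_zero (sub_ne_zero.2 (centreCoord_ne_one hw.1)))]
  open_source := isOpen_nearSlit_inter_ne 1
  open_target := isOpen_chart_target _ continuousOn_centreCoord
  continuousOn_toFun := by
    refine continuous_root.continuousOn.div ?_ fun r hr => rootScale_ne_zero (sub_ne_zero.2 hr.2)
    exact continuous_rootScale.comp_continuousOn
      ((continuousOn_lift_nearSlit.mono Set.inter_subset_left).sub continuousOn_const)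
  continuousOn_invFun := by
    have hc := (continuousOn_centreCoord (n := n)).mono
      (Set.inter_subset_left (t := centreCoord n ⁻¹' Metric.ball slitMid (3 / 5)))
    refine continuousOn_ofCoords (continuous_toTorus.comp_continuousOn hc)
      (continuousOn_id.mul (continuous_rootScale.comp_continuousOn (hc.sub continuousOn_const))) ?_
    intro w hw
    exact (centreCoord_root hw.1).trans (slitFun_toTorus_of_mem_ball hw.2).symm

/-- The chart around the vertex. -/
def vertexChart (n : ℕ) [NeZero n] : OpenPartialHomeomorph (CyclicCover n) ℂ where
  toFun r := (starRingEnd ℂ) r.root / rootScale n (torusLift slitMid r.base)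
  invFun w := ofCoords n (toTorus (vertexCoord n w)) ((starRingEnd ℂ) w * rootScale n (vertexCoord n w))
  source := nearSlit n ∩ {r | torusLift slitMid r.base ≠ 0}
  target := {w | w ^ n ≠ 1} ∩ vertexCoord n ⁻¹' Metric.ball slitMid (3 / 5)
  map_source' r hr := by
    obtain ⟨h1, h2⟩ := vertexCoord_chart hr.1 hr.2
    refine ⟨h1, ?_⟩
    rw [Set.mem_preimage, h2]
    exact mem_ball_iff_norm.2 hr.1
  map_target' w hw := by
    have e := (vertexCoord_root hw.1).trans (slitFun_toTorus_of_mem_ball hw.2).symm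
    simp only [Set.mem_inter_iff, nearSlit, Set.mem_ofPred_eq, base_ofCoords e,
      lift_toTorus_of_mem_ball hw.2]
    exact ⟨mem_ball_iff_norm.1 hw.2, vertexCoord_ne_zero hw.1⟩
  left_inv' r hr := by
    rw [(vertexCoord_chart hr.1 hr.2).2, toTorus_torusLift, map_div₀, conj_rootScale,
      Complex.conj_conj, div_mul_cancel₀ _ (rootScale_ne_zero hr.2), ofCoords_base_root]
  right_inv' w hw := by
    have e := (vertexCoord_root hw.1).trans (slitFun_toTorus_of_mem_ball hw.2).symm
    rw [base_ofCoords e, root_ofCoords e, lift_toTorus_of_mem_ball hw.2, map_mul, Complex.conj_conj,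
      conj_rootScale, mul_div_cancel_right₀ _ (rootScale_ne_zero (vertexCoord_ne_zero hw.1))]
  open_source := isOpen_nearSlit_inter_ne 0
  open_target := isOpen_chart_target _ continuousOn_vertexCoord
  continuousOn_toFun := by
    refine (Complex.continuous_conj.comp continuous_root).continuousOn.div ?_
      fun r hr => rootScale_ne_zero hr.2
    exact continuous_rootScale.comp_continuousOn
      (continuousOn_lift_nearSlit.mono Set.inter_subset_left)
  continuousOn_invFun := by
    have hc := (continuousOn_vertexCoord (n := n)).mono
      (Set.inter_subset_left (t := vertexCoord n ⁻¹' Metric.ball slitMid (3 / 5)))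
    refine continuousOn_ofCoords (continuous_toTorus.comp_continuousOn hc)
      (Complex.continuous_conj.continuousOn.mul (continuous_rootScale.comp_continuousOn hc)) ?_
    intro w hw
    exact (vertexCoord_root hw.1).trans (slitFun_toTorus_of_mem_ball hw.2).symm

end CyclicCover

end

end AbelianPeriods

namespace AbelianPeriods

noncomputable section

/-! ### Complex structures and differentials from local primitives -/

/-- Topological charts with holomorphic functions that differ by constants on overlaps: the
primitives of an abelian differential. The zeros of the differential lie in one chart only. -/
structure PrimitiveAtlas (R : Type*) [TopologicalSpace R] where
  /-- The indices of the charts. -/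
  Index : Type
  /-- The charts. -/
  chart : Index → OpenPartialHomeomorph R ℂ
  /-- The primitives, in the charts. -/
  prim : Index → ℂ → ℂ
  /-- A chart around a point. -/
  index : R → Index
  mem_source : ∀ x, x ∈ (chart (index x)).source
  differentiableOn : ∀ i, DifferentiableOn ℂ (prim i) (chart i).target
  compatible : ∀ i j x, x ∈ (chart i).source → x ∈ (chart j).source →
    ∀ᶠ y in 𝓝 x, prim i (chart i y) - prim j (chart j y) =
      prim i (chart i x) - prim j (chart j x)
  critical : ∀ i j x, x ∈ (chart i).source → x ∈ (chart j).source →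
    chart i = chart j ∨ deriv (prim j) (chart j x) ≠ 0

namespace PrimitiveAtlas

variable {R : Type*} [TopologicalSpace R] (𝒜 : PrimitiveAtlas R)

/-- The charted space given by the charts. -/
@[reducible] def chartedSpace : ChartedSpace ℂ R where
  atlas := Set.range 𝒜.chart
  chartAt x := 𝒜.chart (𝒜.index x)
  mem_chart_source := 𝒜.mem_source
  chart_mem_atlas _ := ⟨_, rfl⟩

theorem differentiableAt (i : 𝒜.Index) {z : ℂ} (hz : z ∈ (𝒜.chart i).target) :
    DifferentiableAt ℂ (𝒜.prim i) z :=
  (𝒜.differentiableOn i).differentiableAt ((𝒜.chart i).open_target.mem_nhds hz)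

theorem hasStrictDerivAt (i : 𝒜.Index) {z : ℂ} (hz : z ∈ (𝒜.chart i).target) :
    HasStrictDerivAt (𝒜.prim i) (deriv (𝒜.prim i) z) z :=
  ((𝒜.differentiableOn i).analyticAt ((𝒜.chart i).open_target.mem_nhds hz)).hasStrictDerivAt

/-- Where `prim j` has nonzero derivative it has a holomorphic local inverse, and the transition map
is this inverse applied to `prim i` minus a constant. At a zero of the differential the two charts
coincide. -/
theorem differentiableAt_transition (i j : 𝒜.Index) {z : ℂ} (hz : z ∈ (𝒜.chart i).target)
    (hz' : (𝒜.chart i).symm z ∈ (𝒜.chart j).source) :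
    DifferentiableAt ℂ (fun w => 𝒜.chart j ((𝒜.chart i).symm w)) z := by
  set x := (𝒜.chart i).symm z with hx
  have hxi : x ∈ (𝒜.chart i).source := (𝒜.chart i).map_target hz
  have hright : ∀ᶠ w in 𝓝 z, 𝒜.chart i ((𝒜.chart i).symm w) = w :=
    (𝒜.chart i).eventually_right_inverse hz
  rcases 𝒜.critical i j x hxi hz' with h | h
  · rw [← h]
    exact differentiableAt_id.congr_of_eventuallyEq hright
  · have hs := 𝒜.hasStrictDerivAt j ((𝒜.chart j).map_source hz')
    set r := hs.localInverse _ _ _ h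
    have hr : DifferentiableAt ℂ r (𝒜.prim j (𝒜.chart j x)) :=
      (hs.to_localInverse h).hasDerivAt.differentiableAt
    have hcont : ContinuousAt (𝒜.chart i).symm z := (𝒜.chart i).continuousAt_symm hz
    have hcont' : ContinuousAt (fun w => 𝒜.chart j ((𝒜.chart i).symm w)) z :=
      ContinuousAt.comp' ((𝒜.chart j).continuousAt hz') hcont
    have hl : ∀ᶠ v in 𝓝 (𝒜.chart j x), r (𝒜.prim j v) = v :=
      (hs.hasStrictFDerivAt_equiv h).eventually_left_inverse
    set c := 𝒜.prim i (𝒜.chart i x) - 𝒜.prim j (𝒜.chart j x) with hc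
    have e : (fun w => 𝒜.chart j ((𝒜.chart i).symm w)) =ᶠ[𝓝 z] fun w => r (𝒜.prim i w - c) := by
      filter_upwards [hcont'.eventually hl, hcont.eventually (𝒜.compatible i j x hxi hz'), hright]
        with w h1 h2 h3
      rw [← h1]
      congr 1
      rw [h3] at h2
      rw [hc, ← h2]
      ring
    refine DifferentiableAt.congr_of_eventuallyEq ?_ e
    refine DifferentiableAt.comp (g := r) z ?_ ((𝒜.differentiableAt i hz).sub_const c)
    have : 𝒜.prim i z - c = 𝒜.prim j (𝒜.chart j x) := by
      rw [hc, hx, (𝒜.chart i).right_inv hz]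
      ring
    rwa [this]

theorem isManifold : @IsManifold ℂ _ ℂ _ _ ℂ _ 𝓘(ℂ, ℂ) ω R _ 𝒜.chartedSpace := by
  let := 𝒜.chartedSpace
  refine isManifold_of_contDiffOn 𝓘(ℂ, ℂ) ω R ?_
  rintro _ _ ⟨i, rfl⟩ ⟨j, rfl⟩
  refine DifferentiableOn.contDiffOn ?_ ?_
  · intro z hz
    have hz1 : z ∈ ((𝒜.chart i).symm.trans (𝒜.chart j)).source := hz.1
    rw [OpenPartialHomeomorph.trans_source] at hz1
    exact (𝒜.differentiableAt_transition i j hz1.1 hz1.2).differentiableWithinAt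
  · simpa using ((𝒜.chart i).symm.trans (𝒜.chart j)).open_source

/-- The differential of the local primitives. -/
def form : letI := 𝒜.chartedSpace
    ∀ x : R, TangentSpace 𝓘(ℂ, ℂ) x →L[ℂ] ℂ :=
  let := 𝒜.chartedSpace
  fun x => mfderiv 𝓘(ℂ, ℂ) 𝓘(ℂ, ℂ) (fun y => 𝒜.prim (𝒜.index x) (𝒜.chart (𝒜.index x) y)) x

/-- The form was defined with one chosen chart at each point. Any other local primitive differs from
the chosen one by a constant, hence has the same differential. -/
theorem hasMFDerivAt (i : 𝒜.Index) {x : R} (hx : x ∈ (𝒜.chart i).source) :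
    letI := 𝒜.chartedSpace
    HasMFDerivAt 𝓘(ℂ, ℂ) 𝓘(ℂ, ℂ) (fun y => 𝒜.prim i (𝒜.chart i y)) x (𝒜.form x) := by
  let := 𝒜.chartedSpace
  have := 𝒜.isManifold
  have : IsManifold 𝓘(ℂ, ℂ) 1 R := IsManifold.of_le (n := ω) le_top
  set k := 𝒜.index x with hk
  have hd : MDifferentiableAt 𝓘(ℂ, ℂ) 𝓘(ℂ, ℂ) (fun y => 𝒜.prim k (𝒜.chart k y)) x := by
    have h1 : MDifferentiableAt 𝓘(ℂ, ℂ) 𝓘(ℂ, ℂ) (𝒜.chart k) x :=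
      mdifferentiableAt_atlas (e := 𝒜.chart k) (Set.mem_range_self k) (𝒜.mem_source x)
    have h2 : MDifferentiableAt 𝓘(ℂ, ℂ) 𝓘(ℂ, ℂ) (𝒜.prim k) (𝒜.chart k x) :=
      (𝒜.differentiableAt k ((𝒜.chart k).map_source (𝒜.mem_source x))).mdifferentiableAt
    exact h2.comp x h1
  have h0 : HasMFDerivAt 𝓘(ℂ, ℂ) 𝓘(ℂ, ℂ) (fun y => 𝒜.prim k (𝒜.chart k y)) x (𝒜.form x) :=
    hd.hasMFDerivAt
  set c := 𝒜.prim i (𝒜.chart i x) - 𝒜.prim k (𝒜.chart k x) with hc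
  have h3 : HasMFDerivAt 𝓘(ℂ, ℂ) 𝓘(ℂ, ℂ) (fun w : ℂ => w + c) (𝒜.prim k (𝒜.chart k x))
      (ContinuousLinearMap.id ℂ ℂ) := ((hasFDerivAt_id _).add_const c).hasMFDerivAt
  have h4 := h3.comp x h0
  refine HasMFDerivAt.congr_of_eventuallyEq (h4 : HasMFDerivAt 𝓘(ℂ, ℂ) 𝓘(ℂ, ℂ) _ x (𝒜.form x)) ?_
  filter_upwards [𝒜.compatible i k x hx (𝒜.mem_source x)] with y hy
  simp only [Function.comp_apply]
  linear_combination hy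

theorem isPrimitiveNear (i : 𝒜.Index) {x : R} (hx : x ∈ (𝒜.chart i).source) :
    letI := 𝒜.chartedSpace
    IsPrimitiveNear 𝒜.form x (fun y => 𝒜.prim i (𝒜.chart i y)) := by
  filter_upwards [(𝒜.chart i).open_source.mem_nhds hx] with y hy
  exact 𝒜.hasMFDerivAt i hy

theorem isAbelianDifferential :
    letI := 𝒜.chartedSpace
    IsAbelianDifferential 𝒜.form := by
  let := 𝒜.chartedSpace
  have := 𝒜.isManifold
  have : IsManifold 𝓘(ℂ, ℂ) 1 R := IsManifold.of_le (n := ω) le_top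
  rintro _ ⟨i, rfl⟩
  refine ((𝒜.differentiableOn i).deriv (𝒜.chart i).open_target).congr fun z hz => ?_
  have hx : (𝒜.chart i).symm z ∈ (𝒜.chart i).source := (𝒜.chart i).map_target hz
  have h1 : MDifferentiableAt 𝓘(ℂ, ℂ) 𝓘(ℂ, ℂ) (𝒜.chart i).symm z :=
    mdifferentiableAt_atlas_symm (e := 𝒜.chart i) (Set.mem_range_self i) hz
  have h2 := (𝒜.hasMFDerivAt i hx).comp z h1.hasMFDerivAt
  let L : ℂ →L[ℂ] ℂ := (𝒜.form ((𝒜.chart i).symm z)).comp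
    (mfderiv 𝓘(ℂ, ℂ) 𝓘(ℂ, ℂ) (𝒜.chart i).symm z)
  have h3 : HasFDerivAt (𝒜.prim i) L z := (h2.congr_of_eventuallyEq (f₁ := 𝒜.prim i) (by
    filter_upwards [(𝒜.chart i).eventually_right_inverse hz] with w hw
    simp only [Function.comp_apply, hw])).hasFDerivAt
  exact h3.hasDerivAt.deriv.symm

end PrimitiveAtlas

end

end AbelianPeriods

namespace AbelianPeriods

noncomputable section

theorem PrimitiveAtlas.isPrimitiveNear_add_const {R : Type*} [TopologicalSpace R]
    (𝒜 : PrimitiveAtlas R) (i : 𝒜.Index) {x : R} (hx : x ∈ (𝒜.chart i).source) (c : ℂ) :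
    let := 𝒜.chartedSpace
    IsPrimitiveNear 𝒜.form x (fun y => 𝒜.prim i (𝒜.chart i y) + c) := by
  let := 𝒜.chartedSpace
  filter_upwards [𝒜.isPrimitiveNear i hx] with y hy
  have h : HasMFDerivAt 𝓘(ℂ, ℂ) 𝓘(ℂ, ℂ) (fun w : ℂ => w + c) (𝒜.prim i (𝒜.chart i y))
      (ContinuousLinearMap.id ℂ ℂ) := ((hasFDerivAt_id _).add_const c).hasMFDerivAt
  exact h.comp y hy

/-! ### Homotopies in convex charts and in the disc -/

/-- The straight-line homotopy in the chart stays in the convex set `B`, and hence in the target of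
the chart. -/
theorem homotopic_of_convex_chart {Y : Type*} [TopologicalSpace Y] (e : OpenPartialHomeomorph Y ℂ)
    {B : Set ℂ} (hB : Convex ℝ B) (hBe : B ⊆ e.target) {a b : Y} (p p' : Path a b)
    (hp : ∀ t, p t ∈ e.source ∧ e (p t) ∈ B) (hp' : ∀ t, p' t ∈ e.source ∧ e (p' t) ∈ B) :
    p.Homotopic p' := by
  have hmem : ∀ x : I × I, AffineMap.lineMap (k := ℝ) (e (p x.2)) (e (p' x.2)) (x.1 : ℝ) ∈ B :=
    fun x => hB.segment_subset (hp x.2).2 (hp' x.2).2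
      (segment_eq_image_lineMap ℝ (e (p x.2)) (e (p' x.2)) ▸ ⟨x.1, x.1.2, rfl⟩)
  have hc : Continuous fun t => e (p t) :=
    e.continuousOn.comp_continuous p.continuous fun t => (hp t).1
  have hc' : Continuous fun t => e (p' t) :=
    e.continuousOn.comp_continuous p'.continuous fun t => (hp' t).1
  refine ⟨⟨⟨⟨fun x => e.symm (AffineMap.lineMap (k := ℝ) (e (p x.2)) (e (p' x.2)) (x.1 : ℝ)),
    ?_⟩, ?_, ?_⟩, ?_⟩⟩
  · refine e.continuousOn_symm.comp_continuous ?_ fun x => hBe (hmem x)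
    simp only [AffineMap.lineMap_apply]
    have h1 := hc.comp (continuous_snd (X := I) (Y := I))
    have h2 := hc'.comp (continuous_snd (X := I) (Y := I))
    have h3 : Continuous fun x : I × I => ((x.1 : I) : ℝ) := by fun_prop
    exact (h3.smul (h2.sub h1)).add h1
  · intro t
    simp [e.left_inv (hp t).1]
  · intro t
    simp [e.left_inv (hp' t).1]
  · intro s t ht
    have h : p t = p' t := by
      rcases ht with rfl | ht
      · simp
      · rw [Set.mem_singleton_iff.1 ht]; simp
    simp [← h, e.left_inv (hp t).1]

instance : SimplyConnectedSpace Disc := by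
  have : ContractibleSpace Disc :=
    (convex_closedBall (0 : ℂ) 1).contractibleSpace ⟨0, by simp⟩
  infer_instance

/-- The straight path in the disc. -/
def segPath (q q' : Disc) : Path q q' where
  toFun t := ⟨AffineMap.lineMap (k := ℝ) (q : ℂ) q' (t : ℝ),
    (convex_closedBall (0 : ℂ) 1).segment_subset q.2 q'.2
      (segment_eq_image_lineMap ℝ (q : ℂ) q' ▸ ⟨t, t.2, rfl⟩)⟩
  continuous_toFun := by
    refine Continuous.subtype_mk ?_ _
    simp only [AffineMap.lineMap_apply]
    fun_prop
  source' := by simp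
  target' := by simp

theorem dist_segPath_le (q q' : Disc) (t : I) : dist (segPath q q' t) q ≤ dist q q' := by
  rw [Subtype.dist_eq]
  change dist (AffineMap.lineMap (k := ℝ) (q : ℂ) q' (t : ℝ)) (q : ℂ) ≤ _
  rw [dist_lineMap_left, Real.norm_of_nonneg t.2.1, Subtype.dist_eq]
  nlinarith [t.2.2, dist_nonneg (x := (q : ℂ)) (y := q')]

/-! ### Tethers -/

namespace Surface

variable {n : ℕ}

/-- The class of the projection of a path in the disc from the first vertex to `q`, as a path
ending at the image `s` of `q`. -/
def tether (s : Surface n) (q : Disc) (h : proj n q = s) : Path.Homotopic.Quotient (base n) s :=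
  Path.Homotopic.Quotient.mk
    (((segPath (side n 0 0) q).map (continuous_proj n)).cast rfl h.symm)

/-- The disc is simply connected, so going to `q` and then along `d` is homotopic to going straight
to `q'`; the homotopy is projected to the surface. -/
theorem tether_trans {a b : Surface n} {q q' : Disc} (h : proj n q = a) (h' : proj n q' = b)
    (d : Path q q') (p : Path a b) (hp : ∀ t, p t = proj n (d t)) :
    (tether a q h).trans (Path.Homotopic.Quotient.mk p) = tether b q' h' := by
  subst h h'
  have e : p = d.map (continuous_proj n) := Path.ext (funext hp)
  rw [e, tether, tether, ← Path.Homotopic.Quotient.mk_trans, Path.Homotopic.Quotient.eq]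
  have h1 : ((segPath (side n 0 0) q).trans d).Homotopic (segPath (side n 0 0) q') :=
    SimplyConnectedSpace.paths_homotopic _ _
  have h2 := h1.map ⟨proj n, continuous_proj n⟩
  rw [Path.map_trans] at h2
  exact h2

theorem tether_base : tether (base n) (side n 0 0) rfl = Path.Homotopic.Quotient.refl _ := by
  have : ((segPath (side n 0 0) (side n 0 0)).map (continuous_proj n)) = Path.refl (base n) := by
    ext t
    simp [segPath, base]
  exact congrArg Path.Homotopic.Quotient.mk this

end Surface

open Surface

variable {n : ℕ}

/-- The value of a character on the class of a loop. -/
def loopValue (χ : Character n) (P : Path.Homotopic.Quotient (base n) (base n)) : ℂ :=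
  χ (Additive.ofMul (Abelianization.of (FundamentalGroup.fromPath P)))

theorem loopValue_trans (χ : Character n) (P Q : Path.Homotopic.Quotient (base n) (base n)) :
    loopValue χ (P.trans Q) = loopValue χ P + loopValue χ Q := by
  -- The group multiplication reverses the order of concatenation; the value in the abelian group
  -- `ℂ` does not depend on it.
  have : FundamentalGroup.fromPath (P.trans Q) =
    FundamentalGroup.fromPath Q * FundamentalGroup.fromPath P := rfl
  rw [loopValue, this, map_mul, ofMul_mul, map_add, add_comm]
  rfl

theorem loopValue_refl (χ : Character n) :
    loopValue χ (Path.Homotopic.Quotient.refl (base n)) = 0 := by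
  have := loopValue_trans χ (Path.Homotopic.Quotient.refl (base n))
    (Path.Homotopic.Quotient.refl (base n))
  rw [Path.Homotopic.Quotient.refl_trans] at this
  simpa using this

theorem loopValue_symm (χ : Character n) (P : Path.Homotopic.Quotient (base n) (base n)) :
    loopValue χ P.symm = - loopValue χ P := by
  have := loopValue_trans χ P P.symm
  rw [Path.Homotopic.Quotient.trans_symm, loopValue_refl] at this
  linear_combination -this

theorem loopValue_diff (χ : Character n) {s : Surface n}
    (P Q T : Path.Homotopic.Quotient (base n) s) :
    loopValue χ (P.trans Q.symm) + loopValue χ (Q.trans T.symm) = loopValue χ (P.trans T.symm) := by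
  rw [← loopValue_trans, Path.Homotopic.Quotient.trans_assoc,
    ← Path.Homotopic.Quotient.trans_assoc Q.symm, Path.Homotopic.Quotient.symm_trans,
    Path.Homotopic.Quotient.refl_trans]

theorem loopValue_diff_trans (χ : Character n) {s s' : Surface n}
    (P Q : Path.Homotopic.Quotient (base n) s) (T : Path.Homotopic.Quotient s s') :
    loopValue χ ((P.trans T).trans (Q.trans T).symm) = loopValue χ (P.trans Q.symm) := by
  induction P using Path.Homotopic.Quotient.ind with | mk p =>
  induction Q using Path.Homotopic.Quotient.ind with | mk q =>
  induction T using Path.Homotopic.Quotient.ind with | mk t =>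
  have : (Path.Homotopic.Quotient.mk q).trans (Path.Homotopic.Quotient.mk t) =
    Path.Homotopic.Quotient.mk (q.trans t) := rfl
  rw [this, ← Path.Homotopic.Quotient.mk_symm, Path.trans_symm, Path.Homotopic.Quotient.mk_trans,
    Path.Homotopic.Quotient.mk_symm, Path.Homotopic.Quotient.mk_symm,
    Path.Homotopic.Quotient.trans_assoc, ← Path.Homotopic.Quotient.trans_assoc (.mk t),
    Path.Homotopic.Quotient.trans_symm, Path.Homotopic.Quotient.refl_trans]

/-! ### Tethers to the vertices and the sides -/

/-- The loop value of the tether to a vertex. -/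
def vertexValue (χ : Character n) (k : ℕ) (h : proj n (side n k 0) = base n) : ℂ :=
  loopValue χ (tether (base n) (side n k 0) h)

/-- The part of a side from its initial point. -/
def sidePath (n k : ℕ) (s : I) : Path (side n k 0) (side n k s) where
  toFun t := side n k (t * s)
  continuous_toFun := (continuous_side n k).comp (by fun_prop)
  source' := by simp
  target' := by simp

/-- The part of a side towards its end point, backwards. -/
def sidePathRev (n k : ℕ) (s : I) : Path (side n (k + 1) 0) (side n k (unitInterval.symm s)) where
  toFun t := side n k (unitInterval.symm (t * s))
  continuous_toFun := (continuous_side n k).comp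
    (unitInterval.continuous_symm.comp (by fun_prop))
  source' := by simp [side_one]
  target' := by simp

theorem vertexValue_forward (χ : Character n) {k : ℕ} (h : proj n (side n k 0) = base n)
    (h' : proj n (side n (k + 1) 0) = base n) (p : Path (base n) (base n))
    (hp : ∀ t, p t = proj n (side n k t)) :
    vertexValue χ (k + 1) h' = vertexValue χ k h + χ (homologyClass p) := by
  have := tether_trans h h' ((sidePath n k 1).cast rfl (side_one n k).symm) p
    (fun t => by rw [hp]; simp [sidePath])
  rw [vertexValue, ← this, loopValue_trans]
  rfl

theorem vertexValue_backward (χ : Character n) {k : ℕ} (h : proj n (side n k 0) = base n)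
    (h' : proj n (side n (k + 1) 0) = base n) (p : Path (base n) (base n))
    (hp : ∀ t, p t = proj n (side n k (unitInterval.symm t))) :
    vertexValue χ k h = vertexValue χ (k + 1) h' + χ (homologyClass p) := by
  have := tether_trans h' h ((sidePathRev n k 1).cast rfl (by simp)) p
    (fun t => by rw [hp]; simp [sidePathRev])
  rw [vertexValue, ← this, loopValue_trans]
  rfl

/-- Both tethers can be routed through the vertices where the paired sides start, side `l` being
traversed backwards from its end `l + 1`. The remaining stretches have the same image and cancel, so
the value does not depend on `s`. -/
theorem loopValue_sides (χ : Character n) {k l : ℕ} (s : I)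
    (hk : proj n (side n k 0) = base n) (hl : proj n (side n (l + 1) 0) = base n)
    (h : ∀ t, proj n (side n k t) = proj n (side n l (unitInterval.symm t))) :
    loopValue χ ((tether _ (side n k s) rfl).trans
      (tether _ (side n l (unitInterval.symm s)) (h s).symm).symm) =
      vertexValue χ k hk - vertexValue χ (l + 1) hl := by
  set p : Path (base n) (proj n (side n k s)) :=
    ((sidePath n k s).map (continuous_proj n)).cast hk.symm rfl with hp
  rw [← tether_trans hk rfl (sidePath n k s) p (fun t => rfl),
    ← tether_trans hl (h s).symm (sidePathRev n l s) p (fun t => h _), loopValue_diff_trans,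
    loopValue_trans, loopValue_symm, vertexValue, vertexValue, sub_eq_add_neg]

/-- Walking along the boundary from vertex `4j` to vertex `4j + 3` reads `x_j y_j x_j⁻¹`, whose
homology class is that of `y_j`. -/
theorem loopValue_x (χ : Character n) (j : Fin n) (s : I) :
    loopValue χ ((tether _ (side n (4 * j) s) rfl).trans
      (tether _ (side n (4 * j + 2) (unitInterval.symm s)) (proj_side_x n j s).symm).symm) =
      -χ (homologyClass (yLoop n j)) := by
  have b0 := proj_vertex n j j.2.le
  have b1 := (proj_handle n j).1.trans b0
  have b2 := (proj_handle n j).2.1.trans b0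
  have b4 := (proj_handle n j).2.2.trans b0
  have b3 : proj n (side n (4 * j + 2 + 1) 0) = base n := by
    have := proj_side_y n j 1
    simp only [unitInterval.symm_one, side_one] at this
    rw [← b2, this]
  rw [loopValue_sides χ s b0 b3 (proj_side_x n j)]
  have e1 := vertexValue_forward χ b0 b1 (xLoop n j) (fun t => rfl)
  have e2 := vertexValue_forward χ b1 b2 (yLoop n j) (fun t => rfl)
  have e3 := vertexValue_backward χ b2 b3 (xLoop n j) (fun t => proj_side_x n j t)
  linear_combination -e1 - e2 + e3

theorem loopValue_y (χ : Character n) (j : Fin n) (s : I) :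
    loopValue χ ((tether _ (side n (4 * j + 1) s) rfl).trans
      (tether _ (side n (4 * j + 3) (unitInterval.symm s)) (proj_side_y n j s).symm).symm) =
      χ (homologyClass (xLoop n j)) := by
  have b0 := proj_vertex n j j.2.le
  have b1 := (proj_handle n j).1.trans b0
  have b2 := (proj_handle n j).2.1.trans b0
  have b4 := (proj_handle n j).2.2.trans b0
  have b3 : proj n (side n (4 * j + 2 + 1) 0) = base n := by
    have := proj_side_y n j 1
    simp only [unitInterval.symm_one, side_one] at this
    rw [← b2, this]
  rw [loopValue_sides χ s b1 b4 (proj_side_y n j)]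
  have e2 := vertexValue_forward χ b1 b2 (yLoop n j) (fun t => rfl)
  have e3 := vertexValue_backward χ b2 b3 (xLoop n j) (fun t => proj_side_x n j t)
  have e4 := vertexValue_backward χ b3 b4 (yLoop n j) (fun t => proj_side_y n j t)
  linear_combination -e2 + e3 + e4

/-- A function on the disc with the increments of the character on paired sides. -/
theorem sub_eq_loopValue (χ : Character n) {D : Disc → ℂ}
    (hx : ∀ (j : Fin n) (s : I), D (side n (4 * j) s) -
      D (side n (4 * j + 2) (unitInterval.symm s)) = -χ (homologyClass (yLoop n j)))
    (hy : ∀ (j : Fin n) (s : I), D (side n (4 * j + 1) s) -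
      D (side n (4 * j + 3) (unitInterval.symm s)) = χ (homologyClass (xLoop n j)))
    {q q' : Disc} {s : Surface n} (h : proj n q = s) (h' : proj n q' = s) :
    D q - D q' = loopValue χ ((tether s q h).trans (tether s q' h').symm) := by
  -- Both sides are additive along chains of identifications, the right one by `loopValue_diff`, so
  -- it suffices to treat a single side identification.
  have key : ∀ q q', Relation.EqvGen (SideRel n) q q' → ∀ s (h : proj n q = s) (h' : proj n q' = s),
      D q - D q' = loopValue χ ((tether s q h).trans (tether s q' h').symm) := by
    intro q q' hqq
    induction hqq with
    | rel q q' hr =>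
      intro s h h'
      subst h
      cases hr with
      | x j s => rw [hx, ← loopValue_x]
      | y j s => rw [hy, ← loopValue_y]
    | refl q =>
      intro s h h'
      rw [Path.Homotopic.Quotient.trans_symm, loopValue_refl, sub_self]
    | symm q q' _ ih =>
      intro s h h'
      have e := loopValue_diff χ (tether s q h') (tether s q' h) (tether s q h')
      rw [Path.Homotopic.Quotient.trans_symm, loopValue_refl, ← ih s h' h] at e
      linear_combination -e
    | trans q q' q'' h1 h2 ih1 ih2 =>
      intro s h h'
      have hm : proj n q' = s := by
        rw [← h]
        exact (Quot.eqvGen_sound h1).symm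
      rw [← loopValue_diff χ (tether s q h) (tether s q' hm) (tether s q'' h'), ← ih1 s h hm,
        ← ih2 s hm h']
      ring
  exact key q q' (Quot.eqvGen_exact (h.trans h'.symm)) s h h'

/-! ### Lifting small paths to the disc -/

instance : CompactSpace (Surface n) := inferInstanceAs (CompactSpace (Quot (SideRel n)))

/-- Every point of the surface has a neighbourhood whose points are joined to it by projections of
segments of the disc within a given neighbourhood. -/
theorem exists_nhds_segment [T2Space (Surface n)] {s : Surface n} {V : Set (Surface n)}
    (hV : IsOpen V) (hs : s ∈ V) :
    ∃ W : Set (Surface n), IsOpen W ∧ s ∈ W ∧ ∀ q, proj n q ∈ W →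
      ∃ q₀, proj n q₀ = s ∧ ∀ t, proj n (segPath q₀ q t) ∈ V := by
  have hK : IsCompact (proj n ⁻¹' {s}) :=
    (isClosed_singleton.preimage (continuous_proj n)).isCompact
  obtain ⟨r, hr, hrV⟩ := hK.exists_thickening_subset_open (hV.preimage (continuous_proj n))
    (fun q hq => by rw [Set.mem_preimage] at hq ⊢; rw [Set.mem_singleton_iff.1 hq]; exact hs)
  set U := Metric.thickening r (proj n ⁻¹' {s}) with hU
  have hcl : IsClosed (proj n '' Uᶜ) :=
    (((Metric.isOpen_thickening).isClosed_compl.isCompact).image (continuous_proj n)).isClosed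
  refine ⟨(proj n '' Uᶜ)ᶜ, hcl.isOpen_compl, ?_, ?_⟩
  · rintro ⟨q, hq, e⟩
    exact hq (Metric.self_subset_thickening hr _ e)
  · intro q hq
    have hqU : q ∈ U := by
      by_contra hqU
      exact hq ⟨q, hqU, rfl⟩
    obtain ⟨q₀, h0, hd⟩ := Metric.mem_thickening_iff.1 hqU
    refine ⟨q₀, h0, fun t => hrV (Metric.mem_thickening_iff.2 ⟨q₀, h0, ?_⟩)⟩
    exact (dist_segPath_le q₀ q t).trans_lt (by rwa [dist_comm])

/-! ### Period integrals from a developing map -/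

/-- The path integrals of the differential of an atlas, given a developing map on the disc. -/
theorem hasPathIntegral_of_developingMap {R : Type*} [TopologicalSpace R] [T2Space R]
    (𝒜 : PrimitiveAtlas R) (Φ : Surface n ≃ₜ R) (χ : Character n) {D : Disc → ℂ}
    (hD : ∀ i q, Φ (proj n q) ∈ (𝒜.chart i).source → ∀ᶠ q' in 𝓝 q,
      𝒜.prim i (𝒜.chart i (Φ (proj n q'))) - D q' = 𝒜.prim i (𝒜.chart i (Φ (proj n q))) - D q)
    (hx : ∀ (j : Fin n) (s : I), D (side n (4 * j) s) -
      D (side n (4 * j + 2) (unitInterval.symm s)) = -χ (homologyClass (yLoop n j)))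
    (hy : ∀ (j : Fin n) (s : I), D (side n (4 * j + 1) s) -
      D (side n (4 * j + 3) (unitInterval.symm s)) = χ (homologyClass (xLoop n j)))
    (γ : Path (base n) (base n)) :
    let := 𝒜.chartedSpace
    HasPathIntegral 𝒜.form (fun t => Φ (γ t)) (χ (homologyClass γ)) := by
  intro
  have : T2Space (Surface n) := Φ.symm.t2Space
  have hrep : ∀ t, ∃ q, proj n q = γ t := fun t => Quot.exists_rep (γ t)
  choose lift hlift using hrep
  let P : ∀ t, Path (base n) (γ t) := fun t => (γ.subpath 0 t).cast γ.source.symm rfl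
  have hP : ∀ t t', (Path.Homotopic.Quotient.mk (P t)).trans
      (Path.Homotopic.Quotient.mk (γ.subpath t t')) = Path.Homotopic.Quotient.mk (P t') := by
    intro t t'
    rw [← Path.Homotopic.Quotient.mk_trans, Path.Homotopic.Quotient.eq]
    have h : ((γ.subpath 0 t).trans (γ.subpath t t')).Homotopic (γ.subpath 0 t') :=
      ⟨Path.Homotopy.subpathTransSubpath γ 0 t t'⟩
    exact h.pathCast γ.source.symm rfl
  -- The primitive along `γ`: the value of the developing map at an arbitrary lift, corrected by the
  -- character of the loop that follows `γ` up to `t` and returns along the tether. By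
  -- `sub_eq_loopValue` the choice of lift does not matter.
  let φ : I → ℂ := fun t => D (lift t) +
    loopValue χ ((Path.Homotopic.Quotient.mk (P t)).trans (tether (γ t) (lift t) (hlift t)).symm)
  have hφ : ∀ t q (h : proj n q = γ t), φ t = D q +
      loopValue χ ((Path.Homotopic.Quotient.mk (P t)).trans (tether (γ t) q h).symm) := by
    intro t q h
    have e1 := sub_eq_loopValue χ hx hy (hlift t) h
    have e2 := loopValue_diff χ (Path.Homotopic.Quotient.mk (P t))
      (tether (γ t) (lift t) (hlift t)) (tether (γ t) q h)
    simp only [φ]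
    linear_combination e1 + e2
  have hlocal : ∀ t₀ : I, ∃ i, Φ (γ t₀) ∈ (𝒜.chart i).source ∧ ∃ c, ∀ᶠ t in 𝓝 t₀,
      φ t = 𝒜.prim i (𝒜.chart i (Φ (γ t))) + c := by
    intro t₀
    set i := 𝒜.index (Φ (γ t₀)) with hi
    have hsrc : Φ (γ t₀) ∈ (𝒜.chart i).source := 𝒜.mem_source _
    let e : OpenPartialHomeomorph (Surface n) ℂ := Φ.transOpenPartialHomeomorph (𝒜.chart i)
    have hes : ∀ s, s ∈ e.source ↔ Φ s ∈ (𝒜.chart i).source := fun s => Iff.rfl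
    have hea : ∀ s, e s = 𝒜.chart i (Φ s) := fun s => rfl
    have hsrc' : γ t₀ ∈ e.source := hsrc
    obtain ⟨ρ, hρ, hball⟩ := Metric.isOpen_iff.1 e.open_target _ (e.map_source hsrc')
    set V : Set (Surface n) := e.source ∩ e ⁻¹' Metric.ball (e (γ t₀)) ρ with hV
    have hVo : IsOpen V := e.isOpen_inter_preimage Metric.isOpen_ball
    obtain ⟨W, hWo, hW0, hW⟩ := exists_nhds_segment hVo ⟨hsrc', Metric.mem_ball_self hρ⟩
    refine ⟨i, hsrc, φ t₀ - 𝒜.prim i (𝒜.chart i (Φ (γ t₀))), ?_⟩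
    obtain ⟨δ, hδ, hδV⟩ := Metric.isOpen_iff.1 (hVo.preimage γ.continuous) t₀
      ⟨hsrc', Metric.mem_ball_self hρ⟩
    filter_upwards [Metric.ball_mem_nhds t₀ hδ,
      (hWo.preimage γ.continuous).mem_nhds hW0] with t htδ htW
    obtain ⟨q₀, h0, hseg⟩ := hW (lift t) (by rw [hlift]; exact htW)
    let p : Path (γ t₀) (γ t) :=
      ((segPath q₀ (lift t)).map (continuous_proj n)).cast h0.symm (hlift t).symm
    -- Inside a chart ball the piece of `γ` can be replaced by the projection of a segment of the
    -- disc. Along that segment the loop term does not change, and `D` changes exactly as the local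
    -- primitive does.
    have hhom : Path.Homotopic.Quotient.mk (γ.subpath t₀ t) = Path.Homotopic.Quotient.mk p := by
      rw [Path.Homotopic.Quotient.eq]
      refine homotopic_of_convex_chart e (convex_ball (e (γ t₀)) ρ) hball _ _ ?_ hseg
      intro u
      have : Set.Icc.convexComb t₀ t u ∈ Metric.ball t₀ δ := by
        rw [Metric.mem_ball, Subtype.dist_eq, Real.dist_eq] at htδ ⊢
        refine lt_of_le_of_lt ?_ htδ
        have : ((Set.Icc.convexComb t₀ t u : I) : ℝ) - t₀ = u * ((t : ℝ) - t₀) := by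
          simp [Set.Icc.convexComb]
          ring
        rw [this, abs_mul, abs_of_nonneg u.2.1]
        nlinarith [u.2.2, abs_nonneg ((t : ℝ) - t₀)]
      exact hδV this
    have e1 := hφ t₀ q₀ h0
    have e2 := hφ t (lift t) (hlift t)
    have e3 : (tether (γ t₀) q₀ h0).trans (Path.Homotopic.Quotient.mk p) =
        tether (γ t) (lift t) (hlift t) :=
      tether_trans h0 (hlift t) (segPath q₀ (lift t)) p (fun u => rfl)
    rw [← hP t₀ t, hhom, ← e3, loopValue_diff_trans] at e2
    have hconst : IsLocallyConstant fun u : I =>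
        𝒜.prim i (𝒜.chart i (Φ (proj n (segPath q₀ (lift t) u)))) - D (segPath q₀ (lift t) u) := by
      rw [IsLocallyConstant.iff_eventually_eq]
      intro u
      exact (segPath q₀ (lift t)).continuous.continuousAt.eventually (hD i _ (hseg u).1)
    have e4 := hconst.apply_eq_of_preconnectedSpace 0 1
    rw [(segPath q₀ (lift t)).source, (segPath q₀ (lift t)).target, hlift, h0] at e4
    linear_combination e2 - e1 + e4
  refine ⟨φ, ?_, ?_, ?_⟩
  · rw [continuous_iff_continuousAt]
    intro t₀
    obtain ⟨i, hsrc, c, h⟩ := hlocal t₀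
    refine ContinuousAt.congr ?_ (h.mono fun t ht => ht.symm)
    refine ContinuousAt.add ?_ continuousAt_const
    exact ContinuousAt.comp' (𝒜.differentiableAt i ((𝒜.chart i).map_source hsrc)).continuousAt
      (ContinuousAt.comp' ((𝒜.chart i).continuousAt hsrc)
        (Φ.continuous.comp γ.continuous).continuousAt)
  · intro t₀
    obtain ⟨i, hsrc, c, h⟩ := hlocal t₀
    exact ⟨_, 𝒜.isPrimitiveNear_add_const i hsrc c, h⟩
  · have h0 : φ 0 = D (side n 0 0) := by
      rw [hφ 0 (side n 0 0) γ.source.symm]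
      have key : ∀ (s : Surface n) (hs : base n = s) (p : Path (base n) s),
          (∀ t, p t = base n) → loopValue χ ((Path.Homotopic.Quotient.mk p).trans
            (tether s (side n 0 0) hs).symm) = 0 := by
        intro s hs p hp
        subst hs
        have : p = Path.refl _ := Path.ext (funext hp)
        rw [this, Path.Homotopic.Quotient.mk_refl, tether_base, Path.Homotopic.Quotient.trans_symm,
          loopValue_refl]
      rw [key _ γ.source.symm _ (fun t => ?_), add_zero]
      simp [P]
    have h1 : φ 1 = D (side n 0 0) + χ (homologyClass γ) := by
      rw [hφ 1 (side n 0 0) γ.target.symm]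
      have key : ∀ (s : Surface n) (hs : base n = s) (p : Path (base n) s),
          (∀ t, p t = γ t) → loopValue χ ((Path.Homotopic.Quotient.mk p).trans
            (tether s (side n 0 0) hs).symm) = χ (homologyClass γ) := by
        intro s hs p hp
        subst hs
        have : p = γ := Path.ext (funext hp)
        rw [this, tether_base, loopValue_trans, loopValue_symm, loopValue_refl, neg_zero, add_zero]
        rfl
      rw [key _ γ.target.symm _ (fun t => ?_)]
      simp [P]
    rw [h0, h1, add_sub_cancel_left]

end

end AbelianPeriods

namespace AbelianPeriods

set_option linter.unusedSectionVars false

noncomputable section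

/-! ### The complex structure of the covering -/

/-- Developing maps of the handles: homeomorphisms of the plane that are equivariant for the
lattice of the torus and agree with a common similarity near the slit. -/
structure HandleMaps (n : ℕ) where
  /-- The periods of the handles. -/
  lin : Fin n → ℂ →L[ℝ] ℂ
  /-- The developing maps. -/
  dev : Fin n → ℂ ≃ₜ ℂ
  /-- The ratio of the similarity. -/
  ratio : ℂ
  ratio_ne_zero : ratio ≠ 0
  dev_add : ∀ j z l, toTorus l = 0 → dev j (z + l) = dev j z + lin j l
  dev_near : ∀ j z, ‖z - slitMid‖ ≤ 3 / 5 → dev j z = ratio * (z - slitMid)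
  oriented : ∀ j z, OrientedDiffAt (dev j) z

namespace CyclicCover

variable {n : ℕ} [NeZero n]

theorem differentiableAt_centreCoord {w : ℂ} (hw : w ^ n ≠ 1) :
    HasDerivAt (centreCoord n) (-(n * w ^ (n - 1)) / (w ^ n - 1) ^ 2) w := by
  have h : w ^ n - 1 ≠ 0 := sub_ne_zero.2 hw
  have := (hasDerivAt_pow n w).div ((hasDerivAt_pow n w).sub_const 1) h
  refine this.congr_deriv ?_
  congr 1
  ring

theorem differentiableAt_vertexCoord {w : ℂ} (hw : w ^ n ≠ 1) :
    HasDerivAt (vertexCoord n) ((n * w ^ (n - 1)) / (1 - w ^ n) ^ 2) w := by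
  have h : 1 - w ^ n ≠ 0 := sub_ne_zero.2 (Ne.symm hw)
  have := (hasDerivAt_const w (1 : ℂ)).div ((hasDerivAt_pow n w).const_sub 1) h
  refine this.congr_deriv ?_
  congr 1
  ring

variable (ℋ : HandleMaps n)

/-- The charts of the covering. -/
def chart : (Fin n × ℂ) ⊕ Bool → OpenPartialHomeomorph (CyclicCover n) ℂ
  | .inl (j, c) => (sheetChart n j c).transHomeomorph (ℋ.dev j)
  | .inr true => centreChart n
  | .inr false => vertexChart n

/-- The local primitives. -/
def prim : (Fin n × ℂ) ⊕ Bool → ℂ → ℂ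
  | .inl _ => id
  | .inr true => fun w => ℋ.ratio * (centreCoord n w - slitMid)
  | .inr false => fun w => ℋ.ratio * (vertexCoord n w - slitMid)

theorem mem_chart_inl {j : Fin n} {c : ℂ} {r : CyclicCover n} :
    r ∈ (chart ℋ (.inl (j, c))).source ↔ r.base ∈ (torusLift c).source ∧ r ∈ sheet n j := by
  rw [chart, OpenPartialHomeomorph.transHomeomorph_source]
  rfl

theorem prim_chart_inl (j : Fin n) (c : ℂ) (r : CyclicCover n) :
    prim ℋ (.inl (j, c)) (chart ℋ (.inl (j, c)) r) = ℋ.dev j (torusLift c r.base) := rfl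

theorem mem_chart_inr {b : Bool} {r : CyclicCover n} (h : r ∈ (chart ℋ (.inr b)).source) :
    r ∈ nearSlit n := by
  cases b
  · exact h.1
  · exact h.1

theorem prim_chart_inr {b : Bool} {r : CyclicCover n} (h : r ∈ (chart ℋ (.inr b)).source) :
    prim ℋ (.inr b) (chart ℋ (.inr b) r) = ℋ.ratio * (torusLift slitMid r.base - slitMid) := by
  cases b
  · exact congrArg (fun z => ℋ.ratio * (z - slitMid)) (vertexCoord_chart h.1 h.2).2
  · exact congrArg (fun z => ℋ.ratio * (z - slitMid)) (centreCoord_chart h.1 h.2).2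

/-- Two lifts of the torus differ locally by a period. -/
theorem eventually_dev_sub (j : Fin n) {c c' : ℂ} {t : Torus} (h : t ∈ (torusLift c).source)
    (h' : t ∈ (torusLift c').source) :
    ∀ᶠ t' in 𝓝 t, ℋ.dev j (torusLift c t') - ℋ.dev j (torusLift c' t') =
      ℋ.dev j (torusLift c t) - ℋ.dev j (torusLift c' t) := by
  have h1 : ContinuousAt (fun t => torusLift c t - torusLift c' t) t :=
    ((torusLift c).continuousAt h).sub ((torusLift c').continuousAt h')
  have h2 : ∀ t, toTorus (torusLift c t - torusLift c' t) = 0 := fun t => by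
    rw [map_sub, toTorus_torusLift, toTorus_torusLift, sub_self]
  have h3 : ∀ t, ℋ.dev j (torusLift c t) - ℋ.dev j (torusLift c' t) =
      ℋ.lin j (torusLift c t - torusLift c' t) := fun t => by
    have := ℋ.dev_add j (torusLift c' t) _ (h2 t)
    rw [add_sub_cancel] at this
    rw [this, add_sub_cancel_left]
  filter_upwards [eventually_eq_of_toTorus_eq_zero h1 h2] with t' ht'
  rw [h3, h3, ht']

/-- Near the slit all developing maps are the same similarity, so the primitive of a branch chart is
also the developing map of handle `j` applied to the lift. Only two lifts of one torus point remain
to be compared. -/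
theorem compatible_inl_inr (j : Fin n) (c : ℂ) (b : Bool) (x : CyclicCover n)
    (hx : x ∈ (chart ℋ (.inl (j, c))).source) (hx' : x ∈ (chart ℋ (.inr b)).source) :
    ∀ᶠ y in 𝓝 x, prim ℋ (.inl (j, c)) (chart ℋ (.inl (j, c)) y) -
        prim ℋ (.inr b) (chart ℋ (.inr b) y) =
      prim ℋ (.inl (j, c)) (chart ℋ (.inl (j, c)) x) - prim ℋ (.inr b) (chart ℋ (.inr b) x) := by
  have hs : x.base ∈ (torusLift slitMid).source :=
    mem_source_of_norm_lt (lt_trans (mem_chart_inr ℋ hx') (by norm_num))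
  have hv : ∀ y ∈ (chart ℋ (.inr b)).source, prim ℋ (.inr b) (chart ℋ (.inr b) y) =
      ℋ.dev j (torusLift slitMid y.base) := fun y hy => by
    rw [prim_chart_inr ℋ hy, ℋ.dev_near j _ (le_of_lt (mem_chart_inr ℋ hy))]
  filter_upwards [(chart ℋ (.inr b)).open_source.mem_nhds hx',
    continuous_base.continuousAt.eventually
      (eventually_dev_sub ℋ j ((mem_chart_inl ℋ).1 hx).1 hs)] with y hy hy'
  rw [hv y hy, hv x hx', prim_chart_inl, prim_chart_inl, hy']

theorem deriv_prim_inr_ne_zero {b : Bool} {w : ℂ} (hw : w ∈ (chart ℋ (.inr b)).target)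
    (h0 : w ≠ 0) : deriv (prim ℋ (.inr b)) w ≠ 0 := by
  have hn : (n : ℂ) ≠ 0 := by exact_mod_cast NeZero.ne n
  cases b
  · have h := ((differentiableAt_vertexCoord (n := n) hw.1).sub_const slitMid).const_mul ℋ.ratio
    rw [show prim ℋ (.inr false) = fun w => ℋ.ratio * (vertexCoord n w - slitMid) from rfl, h.deriv]
    exact mul_ne_zero ℋ.ratio_ne_zero (div_ne_zero (mul_ne_zero hn (pow_ne_zero _ h0))
      (pow_ne_zero _ (sub_ne_zero.2 (Ne.symm hw.1))))
  · have h := ((differentiableAt_centreCoord (n := n) hw.1).sub_const slitMid).const_mul ℋ.ratio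
    rw [show prim ℋ (.inr true) = fun w => ℋ.ratio * (centreCoord n w - slitMid) from rfl, h.deriv]
    exact mul_ne_zero ℋ.ratio_ne_zero (div_ne_zero
      (neg_ne_zero.2 (mul_ne_zero hn (pow_ne_zero _ h0))) (pow_ne_zero _ (sub_ne_zero.2 hw.1)))

theorem root_eq_zero_of_chart_eq_zero {b : Bool} {x : CyclicCover n}
    (hx : x ∈ (chart ℋ (.inr b)).source) (h0 : chart ℋ (.inr b) x = 0) :
    x.root = 0 := by
  cases b
  · have h : (starRingEnd ℂ) x.root / rootScale n (torusLift slitMid x.base) = 0 := h0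
    rcases div_eq_zero_iff.1 h with h | h
    · exact (map_eq_zero _).1 h
    · exact absurd h (rootScale_ne_zero hx.2)
  · have h : x.root / rootScale n (torusLift slitMid x.base - 1) = 0 := h0
    rcases div_eq_zero_iff.1 h with h | h
    · exact h
    · exact absurd h (rootScale_ne_zero (sub_ne_zero.2 hx.2))

theorem exists_chart (x : CyclicCover n) : ∃ i, x ∈ (chart ℋ i).source := by
  by_cases h : slitFun x.base ∈ Complex.slitPlane
  · obtain ⟨j, hj⟩ := exists_mem_sheet h
    refine ⟨.inl (j, torusLift 0 x.base), (mem_chart_inl ℋ).2 ⟨?_, hj⟩⟩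
    have := toTorus_mem_source (inDiamond_self (torusLift 0 x.base))
    rwa [toTorus_torusLift] at this
  · obtain ⟨y, hy, e⟩ := (slitFun_mem_slitPlane_or x.base).resolve_left h
    have hn : x ∈ nearSlit n := by
      rw [nearSlit, Set.mem_ofPred_eq, e]
      exact norm_sub_slitMid_of_mem_Icc hy
    by_cases h1 : torusLift slitMid x.base = 1
    · exact ⟨.inr false, hn, by rw [Set.mem_ofPred_eq, h1]; exact one_ne_zero⟩
    · exact ⟨.inr true, hn, h1⟩

/-- The atlas of the covering determined by developing maps of the handles. -/
def primitiveAtlas : PrimitiveAtlas (CyclicCover n) where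
  Index := (Fin n × ℂ) ⊕ Bool
  chart := chart ℋ
  prim := prim ℋ
  index x := (exists_chart ℋ x).choose
  mem_source x := (exists_chart ℋ x).choose_spec
  differentiableOn i := by
    rcases i with ⟨j, c⟩ | b
    · exact differentiableOn_id
    · cases b
      · intro w hw
        exact (((differentiableAt_vertexCoord (n := n) hw.1).sub_const slitMid).const_mul
          ℋ.ratio).differentiableAt.differentiableWithinAt
      · intro w hw
        exact (((differentiableAt_centreCoord (n := n) hw.1).sub_const slitMid).const_mul
          ℋ.ratio).differentiableAt.differentiableWithinAt
  compatible i i' x hx hx' := by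
    rcases i with ⟨j, c⟩ | b <;> rcases i' with ⟨j', c'⟩ | b'
    · have hj := sheet_unique ((mem_chart_inl ℋ).1 hx).2 ((mem_chart_inl ℋ).1 hx').2
      subst hj
      exact continuous_base.continuousAt.eventually
        (eventually_dev_sub ℋ j ((mem_chart_inl ℋ).1 hx).1 ((mem_chart_inl ℋ).1 hx').1)
    · exact compatible_inl_inr ℋ j c b' x hx hx'
    · filter_upwards [compatible_inl_inr ℋ j' c' b x hx' hx] with y hy
      linear_combination -hy
    · filter_upwards [(chart ℋ (.inr b)).open_source.mem_nhds hx,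
        (chart ℋ (.inr b')).open_source.mem_nhds hx'] with y hy hy'
      rw [prim_chart_inr ℋ hx, prim_chart_inr ℋ hx', prim_chart_inr ℋ hy, prim_chart_inr ℋ hy']
      ring
  critical i i' x hx hx' := by
    rcases i' with ⟨j', c'⟩ | b'
    · right
      exact (hasDerivAt_id _).deriv.trans_ne one_ne_zero
    -- The primitive of a branch chart is critical only at its origin, a point over an end of the
    -- slit. No sheet chart contains such a point, and each of the two branch charts omits the end
    -- belonging to the other.
    · by_cases h0 : chart ℋ (.inr b') x = 0
      · left
        have hr := root_eq_zero_of_chart_eq_zero ℋ hx' h0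
        have hf : slitFun x.base = 0 := by
          rw [← x.root_pow, hr, zero_pow (NeZero.ne n)]
        rcases i with ⟨j, c⟩ | b
        · exact absurd hf (Complex.slitPlane_ne_zero ((mem_chart_inl ℋ).1 hx).2.1)
        · have h01 := torusLift_eq_of_slitFun_eq_zero hf
          cases b <;> cases b'
          · rfl
          · exact absurd h01 (not_or.2 ⟨hx.2, hx'.2⟩)
          · exact absurd h01 (not_or.2 ⟨hx'.2, hx.2⟩)
          · rfl
      · right
        exact deriv_prim_inr_ne_zero ℋ ((chart ℋ (.inr b')).map_source hx') h0

end CyclicCover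

end

end AbelianPeriods

namespace AbelianPeriods

noncomputable section

/-! ### The homeomorphism from the disc to the closed diamond -/

/-- The function `(re ^ 2 - im ^ 2) ^ 2 / ‖z‖ ^ 2`, homogeneous of degree two. -/
def aspect (z : ℂ) : ℝ := (z.re ^ 2 - z.im ^ 2) ^ 2 / (z.re ^ 2 + z.im ^ 2)

/-- The radial factor of the map from the disc to the diamond. -/
def shrink (z : ℂ) : ℝ := (√(1 + √(1 - aspect z)))⁻¹

/-- The radial map from the disc to the diamond. -/
def toDiamond (z : ℂ) : ℂ := shrink z * z

/-- The radial map from the diamond to the disc. -/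
def ofDiamond (z : ℂ) : ℂ := (√(2 - aspect z) : ℝ) * z

/-- The closed diamond. -/
def Diamond : Set ℂ := {z | (z.re + z.im) ^ 2 ≤ 1 ∧ (z.im - z.re) ^ 2 ≤ 1}

theorem norm_sq_eq (z : ℂ) : ‖z‖ ^ 2 = z.re ^ 2 + z.im ^ 2 := by
  rw [Complex.sq_norm, Complex.normSq_apply]; ring

theorem aspect_nonneg (z : ℂ) : 0 ≤ aspect z := by
  unfold aspect; positivity

theorem aspect_mul_norm_sq (z : ℂ) : aspect z * ‖z‖ ^ 2 = (z.re ^ 2 - z.im ^ 2) ^ 2 := by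
  rw [norm_sq_eq, aspect]
  by_cases h : z.re ^ 2 + z.im ^ 2 = 0
  · have h1 : z.re ^ 2 = 0 := by nlinarith [sq_nonneg z.re, sq_nonneg z.im]
    have h2 : z.im ^ 2 = 0 := by nlinarith [sq_nonneg z.re, sq_nonneg z.im]
    simp [h1, h2]
  · rw [div_mul_cancel₀ _ h]

theorem aspect_le_norm_sq (z : ℂ) : aspect z ≤ ‖z‖ ^ 2 := by
  rw [norm_sq_eq, aspect]
  refine div_le_of_le_mul₀ (by positivity) (by positivity) ?_
  nlinarith [mul_nonneg (sq_nonneg z.re) (sq_nonneg z.im)]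

theorem aspect_le_one {z : ℂ} (h : ‖z‖ ≤ 1) : aspect z ≤ 1 :=
  (aspect_le_norm_sq z).trans (pow_le_one₀ (norm_nonneg z) h)

theorem aspect_ofReal_mul (t : ℝ) (z : ℂ) : aspect (t * z) = t ^ 2 * aspect z := by
  simp only [aspect, Complex.re_ofReal_mul, Complex.im_ofReal_mul]
  rcases eq_or_ne t 0 with rfl | ht
  · simp
  · rw [show (t * z.re) ^ 2 + (t * z.im) ^ 2 = t ^ 2 * (z.re ^ 2 + z.im ^ 2) by ring,
      show ((t * z.re) ^ 2 - (t * z.im) ^ 2) ^ 2 = t ^ 2 * (t ^ 2 * (z.re ^ 2 - z.im ^ 2) ^ 2) by ring,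
      mul_div_mul_left _ _ (pow_ne_zero 2 ht), mul_div_assoc]

theorem aspect_I_mul (z : ℂ) : aspect (Complex.I * z) = aspect z := by
  simp only [aspect, Complex.I_mul_re, Complex.I_mul_im]
  congr 1 <;> ring

theorem sq_add_sq_ne_zero {z : ℂ} (h : z ≠ 0) : z.re ^ 2 + z.im ^ 2 ≠ 0 := by
  rw [← norm_sq_eq]
  exact pow_ne_zero 2 (norm_ne_zero_iff.2 h)

theorem continuous_aspect : Continuous aspect := by
  refine continuous_iff_continuousAt.2 fun z => ?_
  rcases eq_or_ne z 0 with rfl | h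
  · have h0 : aspect 0 = 0 := by simp [aspect]
    rw [ContinuousAt, h0]
    refine squeeze_zero aspect_nonneg aspect_le_norm_sq ?_
    have : Continuous fun z : ℂ => ‖z‖ ^ 2 := by fun_prop
    simpa using this.tendsto 0
  · exact ContinuousAt.div (by fun_prop) (by fun_prop) (sq_add_sq_ne_zero h)

theorem one_add_sqrt_pos (x : ℝ) : 0 < 1 + √x := by positivity

theorem shrink_pos (z : ℂ) : 0 < shrink z :=
  inv_pos.2 (Real.sqrt_pos.2 (one_add_sqrt_pos _))

theorem continuous_shrink : Continuous shrink :=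
  Continuous.inv₀ ((continuous_const.add (continuous_const.sub continuous_aspect).sqrt).sqrt)
    fun _ => (Real.sqrt_pos.2 (one_add_sqrt_pos _)).ne'

theorem continuous_toDiamond : Continuous toDiamond :=
  (Complex.continuous_ofReal.comp continuous_shrink).mul continuous_id

theorem toDiamond_zero : toDiamond 0 = 0 := by simp [toDiamond]

theorem toDiamond_eq_zero {z : ℂ} : toDiamond z = 0 ↔ z = 0 := by
  simp [toDiamond, (shrink_pos z).ne']

theorem toDiamond_I_mul (z : ℂ) : toDiamond (Complex.I * z) = Complex.I * toDiamond z := by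
  simp only [toDiamond, shrink, aspect_I_mul]
  ring

theorem aspect_toDiamond {z : ℂ} (h : ‖z‖ ≤ 1) : aspect (toDiamond z) = 1 - √(1 - aspect z) := by
  have h1 := one_add_sqrt_pos (1 - aspect z)
  have h2 : √(1 - aspect z) ^ 2 = 1 - aspect z := Real.sq_sqrt (by linarith [aspect_le_one h])
  rw [toDiamond, aspect_ofReal_mul, shrink, inv_pow, Real.sq_sqrt h1.le,
    inv_mul_eq_iff_eq_mul₀ h1.ne']
  linear_combination h2

theorem ofDiamond_toDiamond {z : ℂ} (h : ‖z‖ ≤ 1) : ofDiamond (toDiamond z) = z := by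
  rw [ofDiamond, aspect_toDiamond h, toDiamond, shrink, ← mul_assoc, ← Complex.ofReal_mul,
    show 2 - (1 - √(1 - aspect z)) = 1 + √(1 - aspect z) by ring,
    mul_inv_cancel₀ (Real.sqrt_pos.2 (one_add_sqrt_pos _)).ne', Complex.ofReal_one, one_mul]

/-- With `a = re + im` and `b = im - re` one has `‖ofDiamond z‖ ^ 2 = a ^ 2 + b ^ 2 - a ^ 2 * b ^
2`. The formula for `ofDiamond` is made for this factorization, which carries the boundary of the
diamond to the unit circle. -/
theorem one_sub_sq_mul_one_sub_sq {z : ℂ} (h : aspect z ≤ 1) :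
    (1 - (z.re + z.im) ^ 2) * (1 - (z.im - z.re) ^ 2) = 1 - ‖ofDiamond z‖ ^ 2 := by
  rw [ofDiamond, norm_mul, mul_pow, Complex.norm_real, Real.norm_eq_abs, sq_abs,
    Real.sq_sqrt (by linarith), sub_mul (2 : ℝ), aspect_mul_norm_sq, norm_sq_eq]
  ring

theorem one_sub_sq_mul_one_sub_sq_toDiamond {z : ℂ} (h : ‖z‖ ≤ 1) :
    (1 - ((toDiamond z).re + (toDiamond z).im) ^ 2) *
      (1 - ((toDiamond z).im - (toDiamond z).re) ^ 2) = 1 - ‖z‖ ^ 2 := by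
  rw [one_sub_sq_mul_one_sub_sq, ofDiamond_toDiamond h]
  rw [aspect_toDiamond h]
  linarith [Real.sqrt_nonneg (1 - aspect z)]

theorem toDiamond_mem {z : ℂ} (h : ‖z‖ ≤ 1) : toDiamond z ∈ Diamond := by
  have h1 := one_sub_sq_mul_one_sub_sq_toDiamond h
  have h2 := aspect_mul_norm_sq (toDiamond z)
  have h3 : aspect (toDiamond z) ≤ 1 := by
    rw [aspect_toDiamond h]
    linarith [Real.sqrt_nonneg (1 - aspect z)]
  rw [norm_sq_eq] at h2
  have h4 : 0 ≤ 1 - ‖z‖ ^ 2 := by nlinarith [norm_nonneg z]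
  rw [← h1] at h4
  set x := (toDiamond z).re
  set y := (toDiamond z).im
  have h5 : 2 * ((x + y) ^ 2 * (y - x) ^ 2) ≤ (x + y) ^ 2 + (y - x) ^ 2 := by
    -- The sign of the product alone would also allow both squares to exceed `1`; the bound on
    -- `aspect` excludes this.
    nlinarith [mul_le_mul_of_nonneg_right h3 (show 0 ≤ x ^ 2 + y ^ 2 by positivity)]
  have h6 := sq_nonneg (x + y)
  have h7 := sq_nonneg (y - x)
  have h8 : (x + y) ^ 2 ≤ 1 ∧ (y - x) ^ 2 ≤ 1 := by
    generalize (x + y) ^ 2 = a at *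
    generalize (y - x) ^ 2 = b at *
    constructor
    · by_contra! hc
      have hb : 1 ≤ b := by nlinarith
      nlinarith
    · by_contra! hc
      have hb : 1 ≤ a := by nlinarith
      nlinarith
  exact h8

theorem inDiamond_toDiamond {z : ℂ} (h : ‖z‖ < 1) : InDiamond 0 (toDiamond z) := by
  have h1 := one_sub_sq_mul_one_sub_sq_toDiamond h.le
  obtain ⟨h2, h3⟩ := toDiamond_mem h.le
  have h4 : 0 < 1 - ‖z‖ ^ 2 := by nlinarith [norm_nonneg z]
  rw [← h1] at h4
  have h5 : ((toDiamond z).re + (toDiamond z).im) ^ 2 < 1 := by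
    refine lt_of_le_of_ne h2 fun e => ?_
    rw [e] at h4; simp at h4
  have h6 : ((toDiamond z).im - (toDiamond z).re) ^ 2 < 1 := by
    refine lt_of_le_of_ne h3 fun e => ?_
    rw [e] at h4; simp at h4
  refine ⟨?_, ?_⟩
  · simpa using (sq_lt_one_iff_abs_lt_one _).1 h5
  · simpa using (sq_lt_one_iff_abs_lt_one _).1 h6

theorem aspect_le_one_of_mem {z : ℂ} (h : z ∈ Diamond) : aspect z ≤ 1 := by
  rw [aspect]
  refine div_le_of_le_mul₀ (by positivity) zero_le_one ?_
  obtain ⟨h1, h2⟩ := h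
  have h3 : z.re ^ 2 + z.im ^ 2 = ((z.re + z.im) ^ 2 + (z.im - z.re) ^ 2) / 2 := by ring
  have h4 : (z.re ^ 2 - z.im ^ 2) ^ 2 = (z.re + z.im) ^ 2 * (z.im - z.re) ^ 2 := by ring
  rw [h3, h4]
  nlinarith [sq_nonneg (z.re + z.im), sq_nonneg (z.im - z.re)]

theorem toDiamond_ofDiamond {z : ℂ} (h : z ∈ Diamond) : toDiamond (ofDiamond z) = z := by
  have h1 := aspect_le_one_of_mem h
  have h2 : aspect (ofDiamond z) = (2 - aspect z) * aspect z := by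
    rw [ofDiamond, aspect_ofReal_mul, Real.sq_sqrt (by linarith)]
  rw [toDiamond, shrink, h2, show 1 - (2 - aspect z) * aspect z = (1 - aspect z) ^ 2 by ring,
    Real.sqrt_sq (by linarith), show 1 + (1 - aspect z) = 2 - aspect z by ring, ofDiamond,
    ← mul_assoc, ← Complex.ofReal_mul, inv_mul_cancel₀ (Real.sqrt_pos.2 (by linarith)).ne',
    Complex.ofReal_one, one_mul]

theorem norm_ofDiamond_le {z : ℂ} (h : z ∈ Diamond) : ‖ofDiamond z‖ ≤ 1 := by
  have h1 := one_sub_sq_mul_one_sub_sq (aspect_le_one_of_mem h)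
  have h2 := mul_nonneg (sub_nonneg.2 h.1) (sub_nonneg.2 h.2)
  rw [h1] at h2
  nlinarith [norm_nonneg (ofDiamond z)]

theorem toDiamond_injOn {z w : ℂ} (hz : ‖z‖ ≤ 1) (hw : ‖w‖ ≤ 1) (h : toDiamond z = toDiamond w) :
    z = w := by
  rw [← ofDiamond_toDiamond hz, h, ofDiamond_toDiamond hw]

/-! ### The boundary of the disc -/

/-- The first barycentric coordinate of the point with parameter `s` on a side of the diamond. -/
def edge (s : I) : ℝ :=
  Real.cos (Real.pi / 2 * s) / (Real.cos (Real.pi / 2 * s) + Real.sin (Real.pi / 2 * s))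

theorem edge_angle (s : I) : 0 ≤ Real.cos (Real.pi / 2 * s) ∧ 0 ≤ Real.sin (Real.pi / 2 * s) ∧
    0 < Real.cos (Real.pi / 2 * s) + Real.sin (Real.pi / 2 * s) := by
  have h0 := s.2.1
  have h1 := s.2.2
  have hp := Real.pi_pos
  have hc : 0 ≤ Real.cos (Real.pi / 2 * s) :=
    Real.cos_nonneg_of_mem_Icc ⟨by nlinarith, by nlinarith⟩
  have hs : 0 ≤ Real.sin (Real.pi / 2 * s) :=
    Real.sin_nonneg_of_nonneg_of_le_pi (by positivity) (by nlinarith)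
  refine ⟨hc, hs, ?_⟩
  have := Real.sin_sq_add_cos_sq (Real.pi / 2 * s)
  by_contra! h
  have h2 : Real.cos (Real.pi / 2 * s) = 0 := by linarith
  have h3 : Real.sin (Real.pi / 2 * s) = 0 := by linarith
  rw [h2, h3] at this
  norm_num at this

theorem one_sub_edge (s : I) : 1 - edge s = Real.sin (Real.pi / 2 * s) /
    (Real.cos (Real.pi / 2 * s) + Real.sin (Real.pi / 2 * s)) := by
  have := (edge_angle s).2.2.ne'
  rw [edge, eq_div_iff this, sub_mul, div_mul_cancel₀ _ this]
  ring

theorem edge_symm (s : I) : edge (unitInterval.symm s) = 1 - edge s := by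
  rw [one_sub_edge, edge, unitInterval.coe_symm_eq,
    show Real.pi / 2 * (1 - (s : ℝ)) = Real.pi / 2 - Real.pi / 2 * s by ring,
    Real.cos_pi_div_two_sub, Real.sin_pi_div_two_sub, add_comm]

theorem edge_mem (s : I) : 0 ≤ edge s ∧ edge s ≤ 1 := by
  obtain ⟨h1, h2, h3⟩ := edge_angle s
  exact ⟨div_nonneg h1 h3.le, div_le_one_of_le₀ (by linarith) h3.le⟩

theorem edge_eq_one {s : I} (h : edge s = 1) : s = 0 := by
  obtain ⟨h1, h2, h3⟩ := edge_angle s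
  have h4 := one_sub_edge s
  rw [h, sub_self, eq_comm, div_eq_zero_iff, or_iff_left h3.ne'] at h4
  have h0 := s.2.1
  have h5 := s.2.2
  have hp := Real.pi_pos
  by_contra hs
  have hpos : 0 < (s : ℝ) := lt_of_le_of_ne h0 fun e => hs (Subtype.ext e.symm)
  exact (Real.sin_pos_of_pos_of_lt_pi (x := Real.pi / 2 * s) (by positivity) (by nlinarith)).ne' h4

/-- On the unit circle `1 - aspect` is the square of `2 cos sin`, so in the first quadrant the
radial factor is `1 / (cos + sin)`, which places the point on the side joining `1` to `i`. -/
theorem toDiamond_exp (s : I) :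
    toDiamond (Complex.exp ((Real.pi / 2 * s : ℝ) * Complex.I)) = ⟨edge s, 1 - edge s⟩ := by
  obtain ⟨h1, h2, h3⟩ := edge_angle s
  have h4 := Real.sin_sq_add_cos_sq (Real.pi / 2 * s)
  have hs : shrink (Complex.exp ((Real.pi / 2 * s : ℝ) * Complex.I)) =
      (Real.cos (Real.pi / 2 * s) + Real.sin (Real.pi / 2 * s))⁻¹ := by
    rw [shrink, aspect, Complex.exp_ofReal_mul_I_re, Complex.exp_ofReal_mul_I_im]
    set c := Real.cos (Real.pi / 2 * s)
    set d := Real.sin (Real.pi / 2 * s)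
    have e1 : 1 - (c ^ 2 - d ^ 2) ^ 2 / (c ^ 2 + d ^ 2) = (2 * c * d) ^ 2 := by
      rw [show c ^ 2 + d ^ 2 = 1 by linarith, div_one]
      linear_combination (-1 - (c ^ 2 + d ^ 2)) * h4
    rw [e1, Real.sqrt_sq (by positivity), show 1 + 2 * c * d = (c + d) ^ 2 by linear_combination -h4,
      Real.sqrt_sq h3.le]
  rw [toDiamond, hs]
  apply Complex.ext
  · show _ = edge s
    rw [Complex.re_ofReal_mul, Complex.exp_ofReal_mul_I_re, edge, div_eq_inv_mul (Real.cos _)]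
  · show _ = 1 - edge s
    rw [Complex.im_ofReal_mul, Complex.exp_ofReal_mul_I_im, one_sub_edge, div_eq_inv_mul (Real.sin _)]

/-! ### Differentiability -/

/-- The determinant of the derivative of `z ↦ κ z * z` at `q` is `κ q * (κ q + κ' q)`; only the
radial derivative of `κ` enters. -/
theorem orientedDiffAt_radial {κ : ℂ → ℝ} {κ' : ℂ →L[ℝ] ℝ} {q : ℂ} (hd : HasFDerivAt κ κ' q)
    (h0 : 0 < κ q) (h1 : 0 ≤ κ' q) : OrientedDiffAt (fun z => κ z * z) q := by
  set g : ℂ := ⟨κ' 1, κ' Complex.I⟩ with hg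
  have key : ∀ v, κ' v = v.re * g.re + v.im * g.im := by
    intro v
    have : v = v.re • (1 : ℂ) + v.im • Complex.I := by simp [Complex.re_add_im]
    conv_lhs => rw [this, map_add, map_smul, map_smul]
    simp [hg]
  refine ⟨κ q + q * (starRingEnd ℂ) g / 2, q * g / 2, ?_, ?_⟩
  · refine lt_of_pow_lt_pow_left₀ 2 (norm_nonneg _) ?_
    rw [key] at h1
    have hpos : 0 < κ q * (κ q + (q.re * g.re + q.im * g.im)) := by positivity
    simp only [← Complex.normSq_eq_norm_sq, Complex.normSq_apply, Complex.add_re, Complex.add_im,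
      Complex.mul_re, Complex.mul_im, Complex.conj_re, Complex.conj_im, Complex.div_ofNat_re,
      Complex.div_ofNat_im, Complex.ofReal_re, Complex.ofReal_im]
    nlinarith
  · refine (((Complex.ofRealCLM.hasFDerivAt.comp q hd).mul (hasFDerivAt_id q))).congr_fderiv ?_
    refine ContinuousLinearMap.ext fun v => ?_
    apply Complex.ext
    · simp [key]
      ring
    · simp [key]
      ring

/-- `aspect` is homogeneous of degree two and `shrink` grows with it. This yields the sign of the
radial derivative without computing it. -/
theorem shrink_exp_smul_mono (q : ℂ) : Monotone fun t : ℝ => shrink (Real.exp t • q) := by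
  intro s t hst
  have h : Real.exp s ^ 2 ≤ Real.exp t ^ 2 :=
    pow_le_pow_left₀ (Real.exp_pos s).le (Real.exp_le_exp.2 hst) 2
  simp only [shrink, Complex.real_smul, aspect_ofReal_mul]
  refine inv_anti₀ (Real.sqrt_pos.2 (one_add_sqrt_pos _)) (Real.sqrt_le_sqrt ?_)
  have := mul_le_mul_of_nonneg_right h (aspect_nonneg q)
  have := Real.sqrt_le_sqrt (show 1 - Real.exp t ^ 2 * aspect q ≤ 1 - Real.exp s ^ 2 * aspect q by
    linarith)
  linarith

theorem differentiableAt_shrink {q : ℂ} (h0 : q ≠ 0) (h1 : ‖q‖ < 1) :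
    DifferentiableAt ℝ shrink q := by
  have hre : DifferentiableAt ℝ (fun z : ℂ => z.re) q := Complex.reCLM.differentiableAt
  have him : DifferentiableAt ℝ (fun z : ℂ => z.im) q := Complex.imCLM.differentiableAt
  have hnum : DifferentiableAt ℝ (fun z : ℂ => (z.re ^ 2 - z.im ^ 2) ^ 2) q := by fun_prop
  have hden : DifferentiableAt ℝ (fun z : ℂ => z.re ^ 2 + z.im ^ 2) q := by fun_prop
  have hM : DifferentiableAt ℝ aspect q := by
    have h := DifferentiableAt.fun_mul hnum (hden.fun_inv (sq_add_sq_ne_zero h0))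
    simp only [← div_eq_mul_inv] at h
    exact h
  have hlt : aspect q < 1 :=
    (aspect_le_norm_sq q).trans_lt (pow_lt_one₀ (norm_nonneg q) h1 two_ne_zero)
  have h2 : DifferentiableAt ℝ (fun z => 1 - aspect z) q := hM.const_sub 1
  have h3 : DifferentiableAt ℝ (fun z => 1 + √(1 - aspect z)) q :=
    (h2.sqrt (by linarith)).const_add 1
  have h4 : DifferentiableAt ℝ (fun z => √(1 + √(1 - aspect z))) q :=
    h3.sqrt (one_add_sqrt_pos _).ne'
  exact h4.inv (Real.sqrt_pos.2 (one_add_sqrt_pos _)).ne'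

theorem orientedDiffAt_toDiamond {q : ℂ} (h0 : q ≠ 0) (h1 : ‖q‖ < 1) :
    OrientedDiffAt toDiamond q := by
  have hd := (differentiableAt_shrink h0 h1).hasFDerivAt
  refine orientedDiffAt_radial hd (shrink_pos q) ?_
  have hp : HasDerivAt (fun t : ℝ => Real.exp t • q) q 0 := by
    simpa using (Real.hasDerivAt_exp 0).smul_const q
  have hd' : HasFDerivAt shrink (fderiv ℝ shrink q) ((fun t : ℝ => Real.exp t • q) 0) := by
    simpa using hd
  have hc := hd'.comp_hasDerivAt 0 hp
  rw [← hc.deriv]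
  exact (shrink_exp_smul_mono q).deriv_nonneg

end

end AbelianPeriods

namespace AbelianPeriods

set_option linter.unusedSectionVars false

noncomputable section

/-! ### Points of the torus in the diamond -/

theorem eq_of_coe_eq_coe {x y : ℝ} (h : (x : AddCircle (2 : ℝ)) = y) (hxy : |x - y| < 2) :
    x = y := by
  have h0 : ((x - y : ℝ) : AddCircle (2 : ℝ)) = 0 := by rw [AddCircle.coe_sub, h, sub_self]
  obtain ⟨m, hm⟩ := (AddCircle.coe_eq_zero_iff 2).1 h0
  rw [zsmul_eq_mul] at hm
  rw [← hm, abs_mul, abs_two] at hxy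
  have h1 : |(m : ℝ)| < 1 := by linarith
  have h2 : m = 0 := by
    rw [← Int.abs_lt_one_iff]
    exact_mod_cast h1
  rw [h2] at hm
  norm_num at hm
  linarith

theorem eq_of_toTorus_eq {z w : ℂ} (h : toTorus z = toTorus w)
    (h1 : |z.re + z.im - (w.re + w.im)| < 2) (h2 : |z.im - z.re - (w.im - w.re)| < 2) : z = w := by
  rw [toTorus_apply, toTorus_apply, Prod.mk.injEq] at h
  have e1 := eq_of_coe_eq_coe h.1 h1
  have e2 := eq_of_coe_eq_coe h.2 h2
  apply Complex.ext <;> linarith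

theorem mem_diamond_iff {z : ℂ} :
    z ∈ Diamond ↔ |z.re + z.im| ≤ 1 ∧ |z.im - z.re| ≤ 1 := by
  rw [← sq_le_one_iff_abs_le_one, ← sq_le_one_iff_abs_le_one]
  rfl

/-- Outside the nonnegative real axis, the disc is mapped to the complement of the open slit. -/
theorem slitFun_toDiamond {p : ℂ} (hp : ‖p‖ ≤ 1) (h : -p ∈ Complex.slitPlane) :
    slitFun (toTorus (toDiamond p)) ∈ Complex.slitPlane ∨
      slitFun (toTorus (toDiamond p)) = 0 := by
  rcases slitFun_mem_slitPlane_or (toTorus (toDiamond p)) with h1 | ⟨x, hx, e⟩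
  · exact Or.inl h1
  have ht : toTorus (toDiamond p) = toTorus x := by rw [← e, toTorus_torusLift]
  rcases hx.2.eq_or_lt with hx1 | hx1
  · right
    rw [ht, hx1, Complex.ofReal_one, slitFun_one]
  exfalso
  obtain ⟨h1, h2⟩ := mem_diamond_iff.1 (toDiamond_mem hp)
  rw [abs_le] at h1 h2
  have hz : toDiamond p = x := by
    refine eq_of_toTorus_eq ht ?_ ?_ <;> rw [abs_lt] <;>
      simp only [Complex.ofReal_re, Complex.ofReal_im] <;> constructor <;> linarith [hx.1]
  have hp' : p = ((√(2 - aspect x) * x : ℝ) : ℂ) := by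
    rw [← ofDiamond_toDiamond hp, hz, ofDiamond]
    push_cast
    rfl
  have : 0 ≤ √(2 - aspect x) * x := mul_nonneg (Real.sqrt_nonneg _) hx.1
  rw [hp', ← Complex.ofReal_neg, Complex.ofReal_mem_slitPlane] at h
  linarith

/-- The points of the disc on the nonnegative real axis are mapped to the slit. -/
theorem exists_toDiamond_eq_ofReal {p : ℂ} (hp : ‖p‖ ≤ 1) (h : -p ∉ Complex.slitPlane) :
    ∃ x ∈ Set.Icc (0 : ℝ) 1, toDiamond p = x := by
  rw [Complex.mem_slitPlane_iff, not_or, not_lt, not_not, Complex.neg_re, Complex.neg_im] at h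
  have hp' : p = (p.re : ℂ) := Complex.ext rfl (by simpa using h.2)
  have hd : toDiamond p = ((shrink p * p.re : ℝ) : ℂ) := by
    rw [toDiamond, Complex.ofReal_mul, ← hp']
  refine ⟨_, ⟨mul_nonneg (shrink_pos p).le (by linarith), ?_⟩, hd⟩
  have := (mem_diamond_iff.1 (toDiamond_mem hp)).1
  rw [hd, Complex.ofReal_re, Complex.ofReal_im, add_zero] at this
  exact (abs_le.1 this).2

/-! ### The covering map on the disc -/

theorem mul_neg_iff_right_neg_of_pos {a b : ℝ} (ha : 0 < a) : a * b < 0 ↔ b < 0 := by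
  rw [← not_le, ← not_le, mul_nonneg_iff_of_pos_left ha]

/-- When `b` is not real, `a` and `b` lie on opposite sides of the real axis, so the sum of their
arguments stays in the principal range and the logarithms add. -/
theorem mul_cpow_of_re_nonneg {a b c : ℂ} (ha : a ≠ 0) (hb : 0 ≤ b.re) (hc : c ≠ 0)
    (h1 : 0 < b.im → a.im < 0) (h2 : b.im < 0 → 0 < a.im) : (a * b) ^ c = a ^ c * b ^ c := by
  rcases eq_or_ne b 0 with rfl | hb0
  · rw [mul_zero, Complex.zero_cpow hc, mul_zero]
  have hlog : Complex.log (a * b) = Complex.log a + Complex.log b := by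
    rw [Complex.log_mul_eq_add_log_iff ha hb0]
    have h3 := abs_le.1 (Complex.abs_arg_le_pi_div_two_iff.2 hb)
    have h4 := Complex.neg_pi_lt_arg a
    have h5 := Complex.arg_le_pi a
    have hp := Real.pi_pos
    rcases lt_trichotomy b.im 0 with h | h | h
    · have h6 := Complex.arg_neg_iff.2 h
      have h7 := Complex.arg_nonneg_iff.2 (h2 h).le
      constructor <;> linarith
    · have h6 : b.arg = 0 := by
        rw [show b = (b.re : ℂ) from Complex.ext rfl (by simpa using h)]
        exact Complex.arg_ofReal_of_nonneg hb
      rw [h6, add_zero]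
      exact ⟨h4, h5⟩
    · have h6 := Complex.arg_nonneg_iff.2 h.le
      have h7 := Complex.arg_neg_iff.2 (h1 h)
      constructor <;> linarith
  rw [Complex.cpow_def_of_ne_zero (mul_ne_zero ha hb0), Complex.cpow_def_of_ne_zero ha,
    Complex.cpow_def_of_ne_zero hb0, hlog, add_mul, Complex.exp_add]

namespace CyclicCover

variable {n : ℕ} [NeZero n]

theorem natCast_inv_re_pos : 0 < ((n : ℂ)⁻¹).re := by
  have := Nat.pos_of_neZero n
  rw [← Complex.ofReal_natCast, ← Complex.ofReal_inv, Complex.ofReal_re]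
  positivity

/-- The root of unity `exp (π i / n)`. -/
def halfRoot (n : ℕ) : ℂ := Complex.exp (Real.pi * Complex.I / n)

theorem halfRoot_ne_zero : halfRoot n ≠ 0 := Complex.exp_ne_zero _

theorem halfRoot_pow : halfRoot n ^ n = -1 := by
  have hn : (n : ℂ) ≠ 0 := by exact_mod_cast NeZero.ne n
  rw [halfRoot, ← Complex.exp_nat_mul, mul_div_cancel₀ _ hn, Complex.exp_pi_mul_I]

/-- The point of the diamond corresponding to a point of the disc. -/
def markPoint (n : ℕ) (q : ℂ) : ℂ := toDiamond (q ^ n)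

/-- The fibre coordinate of the image in the covering of a point of the disc. -/
def markRoot (n : ℕ) (q : ℂ) : ℂ :=
  -- On sector `j` the factor `q` cancels the denominator up to a root of unity, leaving the branch
  -- of sheet `j`. Across the rays bounding the sectors, the jumps of numerator and denominator
  -- cancel.
  (halfRoot n)⁻¹ * q * (slitFun (toTorus (markPoint n q)) ^ ((n : ℂ)⁻¹) /
    (-q ^ n) ^ ((n : ℂ)⁻¹))

/-- The expression of the fibre coordinate near the slit. -/
def nearFactor (n : ℕ) (q : ℂ) : ℂ :=
  ((shrink (q ^ n) : ℂ) * (1 - (starRingEnd ℂ) (markPoint n q))) ^ ((n : ℂ)⁻¹)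

theorem continuous_markPoint : Continuous (markPoint n) :=
  continuous_toDiamond.comp (continuous_pow n)

theorem norm_pow_le_one {q : ℂ} (hq : ‖q‖ ≤ 1) : ‖q ^ n‖ ≤ 1 := by
  rw [norm_pow]
  exact pow_le_one₀ (norm_nonneg q) hq

theorem norm_pow_lt_one {q : ℂ} (hq : ‖q‖ < 1) : ‖q ^ n‖ < 1 := by
  rw [norm_pow]
  exact pow_lt_one₀ (norm_nonneg q) hq (NeZero.ne n)

theorem markPoint_zero : markPoint n 0 = 0 := by
  rw [markPoint, zero_pow (NeZero.ne n), toDiamond_zero]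

theorem markPoint_eq_zero {q : ℂ} : markPoint n q = 0 ↔ q = 0 := by
  rw [markPoint, toDiamond_eq_zero, pow_eq_zero_iff (NeZero.ne n)]

theorem markPoint_mem {q : ℂ} (hq : ‖q‖ ≤ 1) : markPoint n q ∈ Diamond :=
  toDiamond_mem (norm_pow_le_one hq)

theorem neg_cpow_ne_zero {q : ℂ} (hq : q ≠ 0) : (-q ^ n) ^ ((n : ℂ)⁻¹) ≠ 0 := by
  simp [Complex.cpow_eq_zero_iff, hq]

theorem neg_cpow_pow (q : ℂ) : ((-q ^ n) ^ ((n : ℂ)⁻¹)) ^ n = -q ^ n :=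
  Complex.cpow_nat_inv_pow _ (NeZero.ne n)

theorem markRoot_zero : markRoot n 0 = 0 := by simp [markRoot]

theorem markRoot_pow (q : ℂ) : markRoot n q ^ n = slitFun (toTorus (markPoint n q)) := by
  rcases eq_or_ne q 0 with rfl | hq
  · rw [markRoot_zero, markPoint_zero, slitFun_zero, zero_pow (NeZero.ne n)]
  · have : q ^ n ≠ 0 := pow_ne_zero n hq
    rw [markRoot, mul_pow, mul_pow, div_pow, inv_pow, halfRoot_pow, neg_cpow_pow,
      Complex.cpow_nat_inv_pow _ (NeZero.ne n)]
    field_simp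

theorem markRoot_mul {x : ℂ} (hx : x ^ n = 1) (q : ℂ) : markRoot n (x * q) = x * markRoot n q := by
  simp only [markRoot, markPoint, mul_pow, hx, one_mul]
  ring

/-- With `z` the mark point, `z * conj (z - 1)` is `-q ^ n` times `shrink (q ^ n) * (1 - conj z)`.
The second factor has nonnegative real part and imaginary part of sign opposite to that of `-q ^ n`,
so the principal powers multiply and the discontinuous root of `-q ^ n` drops out. -/
theorem markRoot_near {q : ℂ} (hq : ‖q‖ ≤ 1) (h : ‖markPoint n q - slitMid‖ ≤ 3 / 5) :
    markRoot n q = (halfRoot n)⁻¹ * q * nearFactor n q := by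
  rcases eq_or_ne q 0 with rfl | hq0
  · simp [markRoot]
  rw [markRoot]
  congr 1
  rw [div_eq_iff (neg_cpow_ne_zero hq0), nearFactor, mul_comm, slitFun_toTorus_near h,
    ← mul_cpow_of_re_nonneg (neg_ne_zero.2 (pow_ne_zero n hq0))]
  · congr 1
    rw [markPoint, toDiamond]
    simp only [map_sub, map_one]
    ring
  · have h1 := mem_diamond_iff.1 (markPoint_mem (n := n) hq)
    rw [abs_le, abs_le] at h1
    rw [Complex.re_ofReal_mul]
    refine mul_nonneg (shrink_pos _).le ?_
    simp only [Complex.sub_re, Complex.one_re, Complex.conj_re]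
    linarith
  · exact inv_ne_zero (by exact_mod_cast NeZero.ne n)
  · intro hpos
    rw [Complex.im_ofReal_mul, mul_pos_iff_of_pos_left (shrink_pos _)] at hpos
    simp only [Complex.sub_im, Complex.one_im, Complex.conj_im, sub_neg_eq_add, zero_add, markPoint,
      toDiamond, Complex.im_ofReal_mul, mul_pos_iff_of_pos_left (shrink_pos _)] at hpos
    rw [Complex.neg_im]
    linarith
  · intro hneg
    rw [Complex.im_ofReal_mul, mul_neg_iff_right_neg_of_pos (shrink_pos _)] at hneg
    simp only [Complex.sub_im, Complex.one_im, Complex.conj_im, sub_neg_eq_add, zero_add, markPoint,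
      toDiamond, Complex.im_ofReal_mul, mul_neg_iff_right_neg_of_pos (shrink_pos _)] at hneg
    rw [Complex.neg_im]
    linarith

theorem continuousAt_nearFactor {q : ℂ} (h : (markPoint n q).re ≤ 1) :
    ContinuousAt (nearFactor n) q := by
  have hb : Continuous fun q : ℂ =>
      (shrink (q ^ n) : ℂ) * (1 - (starRingEnd ℂ) (markPoint n q)) :=
    (Complex.continuous_ofReal.comp (continuous_shrink.comp (continuous_pow n))).mul
      (continuous_const.sub (Complex.continuous_conj.comp continuous_markPoint))
  refine ContinuousAt.comp (f := fun q : ℂ =>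
      (shrink (q ^ n) : ℂ) * (1 - (starRingEnd ℂ) (markPoint n q)))
    (Complex.continuousAt_cpow_const_of_re_pos (Or.inl ?_) natCast_inv_re_pos) hb.continuousAt
  rw [Complex.re_ofReal_mul]
  refine mul_nonneg (shrink_pos _).le ?_
  simp only [Complex.sub_re, Complex.one_re, Complex.conj_re]
  linarith

theorem re_markPoint_le {q : ℂ} (hq : ‖q‖ ≤ 1) : (markPoint n q).re ≤ 1 := by
  have h1 := mem_diamond_iff.1 (markPoint_mem (n := n) hq)
  rw [abs_le, abs_le] at h1
  linarith

theorem continuousAt_neg_cpow {q : ℂ} (h : -q ^ n ∈ Complex.slitPlane) :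
    ContinuousAt (fun q : ℂ => (-q ^ n) ^ ((n : ℂ)⁻¹)) q :=
  ContinuousAt.comp (f := fun q : ℂ => -q ^ n) (continuousAt_cpow_const h)
    (continuous_pow n).neg.continuousAt

theorem continuousOn_markRoot : ContinuousOn (markRoot n) (Metric.closedBall 0 1) := by
  intro q hq
  rw [mem_closedBall_zero_iff] at hq
  by_cases h : -q ^ n ∈ Complex.slitPlane
  · have hq0 : q ≠ 0 := by
      rintro rfl
      simp [zero_pow (NeZero.ne n)] at h
    have h1 := slitFun_toDiamond (norm_pow_le_one (n := n) hq) h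
    have h2 : ContinuousAt (fun q => slitFun (toTorus (markPoint n q)) ^ ((n : ℂ)⁻¹)) q :=
      ContinuousAt.comp (f := fun q => toTorus (markPoint n q))
        (continuousAt_cpow_slitFun (NeZero.ne n) h1)
        (continuous_toTorus.comp continuous_markPoint).continuousAt
    refine ContinuousAt.continuousWithinAt (ContinuousAt.mul (by fun_prop) (h2.div ?_ ?_))
    · exact continuousAt_neg_cpow h
    · exact neg_cpow_ne_zero hq0
  · obtain ⟨x, hx, e⟩ := exists_toDiamond_eq_ofReal (norm_pow_le_one (n := n) hq) h
    have h1 : ‖markPoint n q - slitMid‖ < 3 / 5 := by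
      rw [markPoint, e]
      exact norm_sub_slitMid_of_mem_Icc hx
    have h2 : ContinuousAt (fun q => (halfRoot n)⁻¹ * q * nearFactor n q) q :=
      ContinuousAt.mul (by fun_prop) (continuousAt_nearFactor (re_markPoint_le hq))
    have h3 : ∀ᶠ q' in 𝓝 q, ‖markPoint n q' - slitMid‖ < 3 / 5 :=
      ((continuous_markPoint.sub continuous_const).norm).continuousAt.eventually_lt_const h1
    refine h2.continuousWithinAt.congr_of_eventuallyEq ?_ (markRoot_near hq h1.le)
    filter_upwards [self_mem_nhdsWithin, nhdsWithin_le_nhds h3] with q' hq' h'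
    exact markRoot_near (mem_closedBall_zero_iff.1 hq') h'.le

/-- The image in the covering of a point of the disc. -/
def markDisc (n : ℕ) [NeZero n] (q : Disc) : CyclicCover n :=
  ⟨toTorus (markPoint n q), markRoot n q, markRoot_pow _⟩

theorem continuous_markDisc : Continuous (markDisc n) := by
  refine isInducing_coords.continuous_iff.2 (Continuous.prodMk ?_ ?_)
  · exact (continuous_toTorus.comp continuous_markPoint).comp continuous_subtype_val
  · exact continuousOn_markRoot.comp_continuous continuous_subtype_val fun q => q.2

/-! ### Sheets -/

/-- The point `q` lies in the sector with number `j`. -/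
def InSector (n : ℕ) (q : ℂ) (j : ℕ) : Prop :=
  q = deckRoot n ^ j * (halfRoot n * (-q ^ n) ^ ((n : ℂ)⁻¹))

theorem sector_root_pow {q : ℂ} (hq : q ≠ 0) :
    (q / (halfRoot n * (-q ^ n) ^ ((n : ℂ)⁻¹))) ^ n = 1 := by
  rw [div_pow, mul_pow, halfRoot_pow, neg_cpow_pow, neg_mul_neg, one_mul,
    div_self (pow_ne_zero n hq)]

theorem inSector_iff {q : ℂ} (hq : q ≠ 0) (j : ℕ) :
    InSector n q j ↔ q / (halfRoot n * (-q ^ n) ^ ((n : ℂ)⁻¹)) = deckRoot n ^ j := by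
  rw [InSector, div_eq_iff (mul_ne_zero halfRoot_ne_zero (neg_cpow_ne_zero hq))]

theorem exists_inSector {q : ℂ} (hq : q ≠ 0) : ∃ j : Fin n, InSector n q j := by
  obtain ⟨j, hj⟩ := exists_deckRoot_pow (sector_root_pow (n := n) hq)
  exact ⟨j, (inSector_iff hq j).2 hj⟩

theorem InSector.unique {q : ℂ} (hq : q ≠ 0) {i j : Fin n} (hi : InSector n q i)
    (hj : InSector n q j) : i = j :=
  deckRoot_pow_injective (((inSector_iff hq i).1 hi).symm.trans ((inSector_iff hq j).1 hj))

theorem InSector.eventually {q : ℂ} (h : -q ^ n ∈ Complex.slitPlane) {j : ℕ}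
    (hj : InSector n q j) : ∀ᶠ q' in 𝓝 q, q' ≠ 0 ∧ InSector n q' j := by
  have hq0 : q ≠ 0 := by
    rintro rfl
    simp [zero_pow (NeZero.ne n)] at h
  have hc : ContinuousAt (fun q : ℂ => q / (halfRoot n * (-q ^ n) ^ ((n : ℂ)⁻¹))) q :=
    continuousAt_id.div (continuousAt_const.mul (continuousAt_neg_cpow h))
      (mul_ne_zero halfRoot_ne_zero (neg_cpow_ne_zero hq0))
  filter_upwards [hc.eventually ((isOpen_unique_root (n := n) j).mem_nhds
    fun _ => (inSector_iff hq0 j).1 hj), isOpen_ne.mem_nhds hq0] with q' h1 h2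
  exact ⟨h2, (inSector_iff h2 j).2 (h1 (sector_root_pow h2))⟩

/-- This is where the sectors of the polygon become the sheets of the covering. -/
theorem InSector.markRoot_eq {q : ℂ} (hq : q ≠ 0) {j : ℕ} (hj : InSector n q j) :
    markRoot n q = sheetRoot n j (toTorus (markPoint n q)) := by
  have h1 := neg_cpow_ne_zero (n := n) hq
  have h2 : (halfRoot n)⁻¹ * q = deckRoot n ^ j * (-q ^ n) ^ ((n : ℂ)⁻¹) := by
    conv_lhs => rw [hj]
    rw [mul_left_comm, inv_mul_cancel_left₀ halfRoot_ne_zero]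
  rw [markRoot, h2, sheetRoot, mul_assoc, mul_div_cancel₀ _ h1]

end CyclicCover

end

end AbelianPeriods

namespace AbelianPeriods

set_option linter.unusedSectionVars false

noncomputable section

/-! ### The sides of the polygon in the covering -/

theorem toDiamond_I_pow_mul (m : ℕ) (z : ℂ) :
    toDiamond (Complex.I ^ m * z) = Complex.I ^ m * toDiamond z := by
  induction m with
  | zero => simp
  | succ m ih => rw [pow_succ', mul_assoc, toDiamond_I_mul, ih, mul_assoc]

theorem toTorus_one_add_I : toTorus (1 + Complex.I) = 0 := by
  rw [toTorus_apply]
  simp only [Complex.add_re, Complex.add_im, Complex.one_re, Complex.one_im, Complex.I_re,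
    Complex.I_im]
  norm_num [AddCircle.coe_period]

theorem toTorus_neg_one_add_I : toTorus (-1 + Complex.I) = 0 := by
  rw [toTorus_apply]
  simp only [Complex.add_re, Complex.add_im, Complex.neg_re, Complex.neg_im, Complex.one_re,
    Complex.one_im, Complex.I_re, Complex.I_im]
  norm_num [AddCircle.coe_period]

namespace CyclicCover

open Surface

variable {n : ℕ} [NeZero n]

theorem I_pow_eq_exp (m : ℕ) :
    Complex.I ^ m = Complex.exp (m * (Real.pi / 2 * Complex.I)) := by
  rw [Complex.exp_nat_mul, Complex.exp_pi_div_two_mul_I]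

theorem side_pow (m : ℕ) (s : I) : (side n m s : ℂ) ^ n =
    Complex.I ^ m * Complex.exp ((Real.pi / 2 * s : ℝ) * Complex.I) := by
  have hn : (n : ℂ) ≠ 0 := by exact_mod_cast NeZero.ne n
  rw [side, ← Complex.exp_nat_mul, I_pow_eq_exp, ← Complex.exp_add]
  congr 1
  push_cast
  field_simp
  ring

theorem markPoint_side (m : ℕ) (s : I) :
    markPoint n (side n m s) = Complex.I ^ m * ⟨edge s, 1 - edge s⟩ := by
  rw [markPoint, side_pow, toDiamond_I_pow_mul, toDiamond_exp]

theorem I_pow_four_mul_add (j k : ℕ) : Complex.I ^ (4 * j + k) = Complex.I ^ k := by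
  rw [pow_add, pow_mul, Complex.I_pow_four, one_pow, one_mul]

theorem markPoint_side_zero (j : ℕ) (s : I) :
    markPoint n (side n (4 * j) s) = ⟨edge s, 1 - edge s⟩ := by
  have := markPoint_side (n := n) (4 * j + 0) s
  rwa [I_pow_four_mul_add, pow_zero, one_mul] at this

theorem markPoint_side_one (j : ℕ) (s : I) :
    markPoint n (side n (4 * j + 1) s) = ⟨edge s - 1, edge s⟩ := by
  rw [markPoint_side, I_pow_four_mul_add]
  apply Complex.ext <;> simp

theorem markPoint_side_two (j : ℕ) (s : I) :
    markPoint n (side n (4 * j + 2) s) = ⟨-edge s, edge s - 1⟩ := by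
  rw [markPoint_side, I_pow_four_mul_add, Complex.I_sq]
  apply Complex.ext <;> simp

theorem markPoint_side_three (j : ℕ) (s : I) :
    markPoint n (side n (4 * j + 3) s) = ⟨1 - edge s, -edge s⟩ := by
  rw [markPoint_side, I_pow_four_mul_add, Complex.I_pow_three]
  apply Complex.ext <;> simp

theorem side_ne_zero (m : ℕ) (s : I) : (side n m s : ℂ) ≠ 0 := Complex.exp_ne_zero _

/-- The angle `π / 2 * (k + s) - π` of `-q ^ n` lies in the principal range `(-π, π]` precisely when
`0 < k + s`. The excluded point, the initial vertex of the sector, belongs to the preceding sector.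
-/
theorem inSector_side (j : ℕ) {k : ℕ} (hk : k ≤ 3) {s : I} (h : 0 < k + (s : ℝ)) :
    InSector n (side n (4 * j + k) s) j := by
  have hn : (n : ℂ) ≠ 0 := by exact_mod_cast NeZero.ne n
  have hp := Real.pi_pos
  have hk' : (k : ℝ) ≤ 3 := by exact_mod_cast hk
  have e : -(side n (4 * j + k) s : ℂ) ^ n =
      Complex.exp ((Real.pi / 2 * (k + s) - Real.pi : ℝ) * Complex.I) := by
    rw [side_pow, I_pow_four_mul_add, I_pow_eq_exp, ← Complex.exp_add,
      neg_eq_iff_eq_neg, ← neg_one_mul, ← Complex.exp_pi_mul_I, ← Complex.exp_add]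
    push_cast
    ring_nf
  rw [InSector, e, Complex.cpow_def_of_ne_zero (Complex.exp_ne_zero _), Complex.log_exp, deckRoot,
    halfRoot, ← Complex.exp_nat_mul, ← Complex.exp_add, ← Complex.exp_add]
  · show Complex.exp _ = Complex.exp _
    congr 1
    push_cast
    field_simp
    ring
  · rw [Complex.im_ofReal_mul, Complex.I_im, mul_one]
    nlinarith
  · rw [Complex.im_ofReal_mul, Complex.I_im, mul_one]
    have := s.2.2
    nlinarith

theorem eq_zero_of_add_nonpos {k : ℕ} {s : I} (h : ¬ 0 < k + (s : ℝ)) : k = 0 ∧ s = 0 := by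
  have h0 := s.2.1
  have h1 : (0 : ℝ) ≤ k := k.cast_nonneg
  have h2 : (k : ℝ) = 0 := by linarith
  exact ⟨by exact_mod_cast h2, Subtype.ext (show (s : ℝ) = 0 by linarith)⟩

theorem edge_zero : edge 0 = 1 := by simp [edge]

theorem edge_eq_zero {s : I} (h : edge s = 0) : s = 1 := by
  have h1 := edge_symm s
  rw [h, sub_zero] at h1
  rw [← unitInterval.symm_symm s, edge_eq_one h1, unitInterval.symm_zero]

theorem markPoint_vertex (j : ℕ) : markPoint n (side n (4 * j) 0) = 1 := by
  rw [markPoint_side_zero, edge_zero]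
  apply Complex.ext <;> simp

/-- At the initial vertex, which is outside the sector, both sides vanish because the vertex lies
over a branch point. -/
theorem markRoot_side (j : ℕ) {k : ℕ} (hk : k ≤ 3) (s : I) :
    markRoot n (side n (4 * j + k) s) =
      sheetRoot n j (toTorus (markPoint n (side n (4 * j + k) s))) := by
  by_cases h : 0 < k + (s : ℝ)
  · exact (inSector_side j hk h).markRoot_eq (side_ne_zero _ _)
  · obtain ⟨rfl, rfl⟩ := eq_zero_of_add_nonpos h
    have h1 : slitFun (toTorus (markPoint n (side n (4 * j + 0) 0))) = 0 := by
      rw [add_zero, markPoint_vertex, slitFun_one]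
    have h2 := (markRoot_pow (n := n) (side n (4 * j + 0) 0)).trans h1
    have h3 := (sheetRoot_pow (n := n) j (toTorus (markPoint n (side n (4 * j + 0) 0)))).trans h1
    rw [pow_eq_zero_iff (NeZero.ne n)] at h2 h3
    rw [h2, h3]

theorem markPoint_side_zero_sub (j : ℕ) (s : I) : markPoint n (side n (4 * j) s) =
    markPoint n (side n (4 * j + 2) (unitInterval.symm s)) + (1 + Complex.I) := by
  rw [markPoint_side_zero, markPoint_side_two, edge_symm]
  apply Complex.ext <;> simp
  ring

theorem markPoint_side_one_sub (j : ℕ) (s : I) : markPoint n (side n (4 * j + 1) s) =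
    markPoint n (side n (4 * j + 3) (unitInterval.symm s)) + (-1 + Complex.I) := by
  rw [markPoint_side_one, markPoint_side_three, edge_symm]
  apply Complex.ext <;> simp
  ring

theorem markDisc_side_eq {j k l : ℕ} (hk : k ≤ 3) (hl : l ≤ 3) {s s' : I}
    (h : toTorus (markPoint n (side n (4 * j + k) s)) =
      toTorus (markPoint n (side n (4 * j + l) s'))) :
    markDisc n (side n (4 * j + k) s) = markDisc n (side n (4 * j + l) s') := by
  refine ext h ?_
  show markRoot n _ = markRoot n _
  rw [markRoot_side j hk, markRoot_side j hl, h]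

theorem markDisc_sideRel {q q' : Disc} (h : SideRel n q q') : markDisc n q = markDisc n q' := by
  cases h with
  | x j s =>
    refine markDisc_side_eq (k := 0) (by norm_num) (by norm_num) ?_
    rw [add_zero, markPoint_side_zero_sub, map_add, toTorus_one_add_I, add_zero]
  | y j s =>
    refine markDisc_side_eq (by norm_num) (by norm_num) ?_
    rw [markPoint_side_one_sub, map_add, toTorus_neg_one_add_I, add_zero]

/-- The map from the surface to the covering. -/
def mark (n : ℕ) [NeZero n] : Surface n → CyclicCover n :=
  Quot.lift (markDisc n) fun _ _ => markDisc_sideRel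

theorem mark_proj (q : Disc) : mark n (proj n q) = markDisc n q := rfl

theorem continuous_mark : Continuous (mark n) :=
  continuous_quot_lift _ continuous_markDisc

/-! ### Bijectivity -/

theorem exists_eq_side {q : Disc} (h : ‖(q : ℂ)‖ = 1) :
    ∃ j : Fin n, ∃ k ≤ 3, ∃ s : I, q = side n (4 * j + k) s := by
  have hn : (0 : ℝ) < n := by exact_mod_cast Nat.pos_of_neZero n
  have hp := Real.pi_pos
  set θ := toIcoMod Real.two_pi_pos 0 (Complex.arg q) with hθ
  have hθm := toIcoMod_mem_Ico Real.two_pi_pos 0 (Complex.arg q)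
  rw [← hθ, zero_add] at hθm
  have hq : (q : ℂ) = Complex.exp (θ * Complex.I) := by
    have e1 : θ = Complex.arg q - toIcoDiv Real.two_pi_pos 0 (Complex.arg q) • (2 * Real.pi) := rfl
    have e2 := Complex.norm_mul_exp_arg_mul_I (q : ℂ)
    rw [h, Complex.ofReal_one, one_mul] at e2
    rw [← e2, e1, zsmul_eq_mul, Complex.ofReal_sub, sub_mul, Complex.exp_sub]
    push_cast
    rw [mul_assoc, Complex.exp_int_mul_two_pi_mul_I, div_one]
  set x : ℝ := θ * (4 * n) / (2 * Real.pi) with hx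
  have hx0 : 0 ≤ x := by have := hθm.1; positivity
  have hx1 : x < 4 * n := by
    rw [hx, div_lt_iff₀ Real.two_pi_pos, mul_comm]
    exact mul_lt_mul_of_pos_left hθm.2 (by positivity)
  set m := ⌊x⌋₊ with hm
  have hm1 : m < 4 * n := by
    rw [hm, Nat.floor_lt hx0]
    exact_mod_cast hx1
  have h1 := Nat.floor_le hx0
  have h2 := Nat.lt_floor_add_one x
  refine ⟨⟨m / 4, by omega⟩, m % 4, by omega, ⟨x - m, by linarith, by linarith⟩, Subtype.ext ?_⟩
  rw [hq, side]
  congr 3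
  have h3 : ((4 * (m / 4) + m % 4 : ℕ) : ℝ) = m := by rw [Nat.div_add_mod]
  simp only [h3, add_sub_cancel]
  rw [hx]
  field_simp

theorem proj_side_vertex (j : Fin n) {k : ℕ} (hk : k ≤ 4) :
    proj n (side n (4 * j + k) 0) = Surface.base n := by
  have h0 := proj_vertex n j j.2.le
  obtain ⟨h1, h2, h4⟩ := proj_handle n j
  have h3 : proj n (side n (4 * j + 3) 0) = proj n (side n (4 * j) 0) := by
    have := (proj_side_x n j 1).symm
    have h5 := proj_side_y n j 1
    rw [unitInterval.symm_one, side_one] at h5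
    rw [← h5, h2]
  interval_cases k
  · exact h0
  · exact h1.trans h0
  · exact h2.trans h0
  · exact h3.trans h0
  · exact h4.trans h0

/-- The half-open diamond. -/
def HalfOpenDiamond : Set ℂ :=
  {z | (-1 ≤ z.re + z.im ∧ z.re + z.im < 1) ∧ (-1 ≤ z.im - z.re ∧ z.im - z.re < 1)}

theorem eq_of_toTorus_eq_of_mem {z w : ℂ} (h : toTorus z = toTorus w) (hz : z ∈ HalfOpenDiamond)
    (hw : w ∈ HalfOpenDiamond) : z = w := by
  obtain ⟨⟨h1, h2⟩, h3, h4⟩ := hz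
  obtain ⟨⟨h5, h6⟩, h7, h8⟩ := hw
  refine eq_of_toTorus_eq h ?_ ?_ <;> rw [abs_lt] <;> constructor <;> linarith

theorem exists_mem_halfOpenDiamond (t : Torus) : ∃ z ∈ HalfOpenDiamond, toTorus z = t := by
  obtain ⟨a, b⟩ := t
  obtain ⟨⟨x, hx⟩, rfl⟩ := (AddCircle.equivIco (2 : ℝ) (-1)).symm.surjective a
  obtain ⟨⟨y, hy⟩, rfl⟩ := (AddCircle.equivIco (2 : ℝ) (-1)).symm.surjective b
  have h1 : (x - y) / 2 + (x + y) / 2 = x := by ring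
  have h2 : (x + y) / 2 - (x - y) / 2 = y := by ring
  refine ⟨⟨(x - y) / 2, (x + y) / 2⟩, ?_, ?_⟩
  · simp only [HalfOpenDiamond, Set.mem_ofPred_eq, h1, h2]
    exact ⟨⟨hx.1, by linarith [hx.2]⟩, hy.1, by linarith [hy.2]⟩
  · rw [toTorus_apply]
    simp only [h1, h2]
    rfl

theorem neg_I_mem : -Complex.I ∈ HalfOpenDiamond := by
  simp [HalfOpenDiamond]

theorem toTorus_neg_I : toTorus (-Complex.I) = toTorus 1 := by
  rw [show -Complex.I = 1 - (1 + Complex.I) by ring, map_sub, toTorus_one_add_I, sub_zero]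

/-- Every point of the surface is represented by a point over the half-open diamond. -/
theorem exists_proj_eq (x : Surface n) :
    ∃ q : Disc, proj n q = x ∧ markPoint n q ∈ HalfOpenDiamond := by
  obtain ⟨q, rfl⟩ := Quot.exists_rep x
  rcases (mem_closedBall_zero_iff.1 q.2).lt_or_eq with h | h
  · refine ⟨q, rfl, ?_⟩
    obtain ⟨h1, h2⟩ := inDiamond_toDiamond (norm_pow_lt_one (n := n) h)
    simp only [Complex.zero_re, Complex.zero_im, add_zero, sub_zero, abs_lt] at h1 h2
    exact ⟨⟨h1.1.le, h1.2⟩, h2.1.le, h2.2⟩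
  -- Sides `4j` and `4j + 1` are exchanged for their partners. Among the corners of the diamond only
  -- `-i` is in the half-open diamond, so every vertex is replaced by one lying over `-i`.
  · have hvertex : ∃ q' : Disc, proj n q' = Surface.base n ∧ markPoint n q' ∈ HalfOpenDiamond := by
      refine ⟨side n (4 * (0 : Fin n) + 3) 0, proj_side_vertex 0 (by norm_num), ?_⟩
      rw [markPoint_side_three, edge_zero]
      convert neg_I_mem using 1
      apply Complex.ext <;> simp
    have key : ∀ (j : Fin n) (k : ℕ) (hk : k = 2 ∨ k = 3) (s : I),
        ∃ q' : Disc, proj n q' = proj n (side n (4 * j + k) s) ∧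
          markPoint n q' ∈ HalfOpenDiamond := by
      intro j k hk s
      by_cases hs : s = 0
      · rw [hs, proj_side_vertex j (by omega)]
        exact hvertex
      by_cases hs1 : s = 1
      · rw [hs1, side_one, add_assoc, proj_side_vertex j (by omega)]
        exact hvertex
      have h1 : edge s < 1 := lt_of_le_of_ne (edge_mem s).2 fun e => hs (edge_eq_one e)
      have h0 : 0 < edge s := lt_of_le_of_ne (edge_mem s).1 fun e => hs1 (edge_eq_zero e.symm)
      refine ⟨_, rfl, ?_⟩
      rcases hk with rfl | rfl
      · rw [markPoint_side_two]
        refine ⟨⟨?_, ?_⟩, ?_, ?_⟩ <;> simp only <;> linarith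
      · rw [markPoint_side_three]
        refine ⟨⟨?_, ?_⟩, ?_, ?_⟩ <;> simp only <;> linarith
    obtain ⟨j, k, hk, s, rfl⟩ := exists_eq_side (n := n) h
    show ∃ q' : Disc, proj n q' = proj n _ ∧ _
    interval_cases k
    · rw [add_zero, proj_side_x]
      exact key j 2 (Or.inl rfl) _
    · rw [proj_side_y]
      exact key j 3 (Or.inr rfl) _
    · exact key j 2 (Or.inl rfl) _
    · exact key j 3 (Or.inr rfl) _

theorem proj_eq_base {q : Disc} (h : (q : ℂ) ^ (4 * n) = 1) : proj n q = Surface.base n := by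
  have hn := Nat.pos_of_neZero n
  have hn' : (n : ℂ) ≠ 0 := by exact_mod_cast NeZero.ne n
  obtain ⟨m, hm, e⟩ :=
    (Complex.isPrimitiveRoot_exp (4 * n) (by omega)).eq_pow_of_pow_eq_one h
  have : q = side n (4 * (m / 4) + m % 4) 0 := by
    refine Subtype.ext ?_
    rw [← e, Nat.div_add_mod, side, ← Complex.exp_nat_mul]
    congr 1
    push_cast
    rw [add_zero]
    field_simp
  rw [this]
  exact proj_side_vertex ⟨m / 4, by omega⟩ (by omega)

theorem slitFun_eq_zero_of_mem {z : ℂ} (hz : z ∈ HalfOpenDiamond) (h : slitFun (toTorus z) = 0) :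
    z = 0 ∨ z = -Complex.I := by
  rcases torusLift_eq_of_slitFun_eq_zero h with h | h
  · left
    refine eq_of_toTorus_eq_of_mem ?_ hz (by simp [HalfOpenDiamond])
    rw [← h, toTorus_torusLift]
  · right
    refine eq_of_toTorus_eq_of_mem ?_ hz neg_I_mem
    rw [toTorus_neg_I, ← h, toTorus_torusLift]

/-- For representatives over the half-open diamond the torus coordinate determines `q ^ n`, and a
nonzero fibre coordinate then determines `q`. Over a branch point, `q` is the centre or a vertex,
and all vertices are identified in the surface. -/
theorem mark_injective : Function.Injective (mark n) := by
  intro x y hxy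
  obtain ⟨q, rfl, hq⟩ := exists_proj_eq x
  obtain ⟨q', rfl, hq'⟩ := exists_proj_eq y
  rw [mark_proj, mark_proj] at hxy
  have h1 : markPoint n q = markPoint n q' :=
    eq_of_toTorus_eq_of_mem (congrArg CyclicCover.base hxy) hq hq'
  have hle := mem_closedBall_zero_iff.1 q.2
  have hle' := mem_closedBall_zero_iff.1 q'.2
  have h2 : (q : ℂ) ^ n = (q' : ℂ) ^ n :=
    toDiamond_injOn (norm_pow_le_one hle) (norm_pow_le_one hle') h1
  have h3 : markRoot n q = markRoot n q' := congrArg CyclicCover.root hxy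
  by_cases h0 : slitFun (toTorus (markPoint n q)) = 0
  · rcases slitFun_eq_zero_of_mem hq h0 with e | e
    · have e' := e
      rw [h1] at e'
      rw [markPoint_eq_zero] at e e'
      rw [Subtype.ext (e.trans e'.symm)]
    · have key : ∀ q : Disc, markPoint n q = -Complex.I → proj n q = Surface.base n := by
        intro q e
        have h4 : (q : ℂ) ^ n = -Complex.I := by
          refine toDiamond_injOn (norm_pow_le_one (mem_closedBall_zero_iff.1 q.2)) (by simp) ?_
          refine e.trans ?_
          have := toDiamond_exp 0
          simp only [edge_zero, Set.Icc.coe_zero, mul_zero, Complex.ofReal_zero, zero_mul,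
            Complex.exp_zero] at this
          have h5 := toDiamond_I_pow_mul 3 1
          rw [this, mul_one, Complex.I_pow_three] at h5
          rw [h5]
          apply Complex.ext <;> simp
        apply proj_eq_base
        rw [mul_comm, pow_mul, h4, neg_pow, Complex.I_pow_four]
        norm_num
      rw [key q e, key q' (h1 ▸ e)]
  · have h5 : markRoot n q ≠ 0 := by
      intro h6
      rw [← markRoot_pow, h6, zero_pow (NeZero.ne n)] at h0
      exact h0 rfl
    have h6 : (q : ℂ) = q' := by
      rw [markRoot, markRoot, h1, h2] at h3
      rw [markRoot, h1, h2] at h5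
      have h7 := mul_right_cancel₀ (mul_ne_zero_iff.1 h5).2 h3
      exact mul_left_cancel₀ (inv_ne_zero halfRoot_ne_zero) h7
    rw [Subtype.ext h6]

/-- Multiplying `q` by an `n`-th root of unity keeps the torus coordinate and multiplies the fibre
coordinate by the same root, so the whole fibre is reached. -/
theorem mark_surjective : Function.Surjective (mark n) := by
  intro r
  obtain ⟨z, hz, ht⟩ := exists_mem_halfOpenDiamond r.base
  have hzD : z ∈ Diamond := by
    rw [mem_diamond_iff, abs_le, abs_le]
    exact ⟨⟨hz.1.1, hz.1.2.le⟩, hz.2.1, hz.2.2.le⟩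
  obtain ⟨q, hq⟩ := IsAlgClosed.exists_pow_nat_eq (ofDiamond z) (Nat.pos_of_neZero n)
  have hn1 : ‖q‖ ≤ 1 := by
    have := norm_ofDiamond_le hzD
    rw [← hq, norm_pow] at this
    exact (pow_le_one_iff_of_nonneg (norm_nonneg q) (NeZero.ne n)).1 this
  have hm : ∀ x : ℂ, x ^ n = 1 → markPoint n (x * q) = z := fun x hx => by
    rw [markPoint, mul_pow, hx, one_mul, hq, toDiamond_ofDiamond hzD]
  have hm1 : markPoint n q = z := by simpa using hm 1 (one_pow n)
  have hr := r.root_pow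
  have hr' := markRoot_pow (n := n) q
  rw [← ht, ← hm1] at hr
  obtain ⟨x, hx, e⟩ : ∃ x : ℂ, x ^ n = 1 ∧ x * markRoot n q = r.root := by
    by_cases h0 : markRoot n q = 0
    · refine ⟨1, one_pow n, ?_⟩
      rw [h0, zero_pow (NeZero.ne n)] at hr'
      rw [← hr', pow_eq_zero_iff (NeZero.ne n)] at hr
      rw [h0, hr, mul_zero]
    · refine ⟨r.root / markRoot n q, ?_, div_mul_cancel₀ _ h0⟩
      rw [div_pow, hr, hr', div_self]
      rw [← hr']
      exact pow_ne_zero n h0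
  have hx1 : ‖x‖ = 1 := Complex.norm_eq_one_of_pow_eq_one hx (NeZero.ne n)
  refine ⟨proj n ⟨x * q, by rw [mem_closedBall_zero_iff, norm_mul, hx1, one_mul]; exact hn1⟩, ?_⟩
  rw [mark_proj]
  refine ext ?_ ?_
  · show toTorus (markPoint n (x * q)) = _
    rw [hm x hx, ht]
  · show markRoot n (x * q) = _
    rw [markRoot_mul hx, e]

/-- The marking of the covering. -/
def marking (n : ℕ) [NeZero n] : Surface n ≃ₜ CyclicCover n :=
  Continuous.homeoOfEquivCompactToT2
    (f := Equiv.ofBijective (mark n) ⟨mark_injective, mark_surjective⟩) continuous_mark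

end CyclicCover

end

end AbelianPeriods

namespace AbelianPeriods

set_option linter.unusedSectionVars false

noncomputable section

namespace CyclicCover

open Surface

variable {n : ℕ} [NeZero n] (ℋ : HandleMaps n)

/-! ### The developing map of the polygon -/

/-- The number of a sector containing a point. -/
def sector (n : ℕ) [NeZero n] (q : ℂ) : Fin n := Classical.epsilon fun j : Fin n => InSector n q j

theorem inSector_sector {q : ℂ} (hq : q ≠ 0) : InSector n q (sector n q) :=
  Classical.epsilon_spec (exists_inSector hq)

theorem sector_eq {q : ℂ} (hq : q ≠ 0) {j : Fin n} (h : InSector n q j) : sector n q = j :=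
  (inSector_sector hq).unique hq h

/-- The developing map of the polygon. -/
def developing (q : Disc) : ℂ := ℋ.dev (sector n q) (markPoint n q)

theorem norm_one_sub_slitMid : ‖(1 : ℂ) - slitMid‖ ≤ 3 / 5 := by
  have := norm_sub_slitMid_of_mem_Icc (x := 1) (by simp)
  rw [Complex.ofReal_one] at this
  exact this.le

/-- At the initial vertex `sector` returns another index in general, but the vertex maps to the end
`1` of the slit, where all developing maps agree. -/
theorem developing_side (j : Fin n) {k : ℕ} (hk : k ≤ 3) (s : I) :
    developing ℋ (side n (4 * j + k) s) = ℋ.dev j (markPoint n (side n (4 * j + k) s)) := by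
  by_cases h : 0 < k + (s : ℝ)
  · rw [developing, sector_eq (side_ne_zero _ _) (inSector_side j hk h)]
  · obtain ⟨rfl, rfl⟩ := eq_zero_of_add_nonpos h
    rw [developing, add_zero, markPoint_vertex, ℋ.dev_near _ _ norm_one_sub_slitMid,
      ℋ.dev_near _ _ norm_one_sub_slitMid]

theorem developing_side_x (j : Fin n) (s : I) : developing ℋ (side n (4 * j) s) -
    developing ℋ (side n (4 * j + 2) (unitInterval.symm s)) = ℋ.lin j (1 + Complex.I) := by
  have := developing_side ℋ j (k := 0) (by norm_num) s
  rw [add_zero] at this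
  rw [this, developing_side ℋ j (by norm_num), markPoint_side_zero_sub,
    ℋ.dev_add _ _ _ toTorus_one_add_I, add_sub_cancel_left]

theorem developing_side_y (j : Fin n) (s : I) : developing ℋ (side n (4 * j + 1) s) -
    developing ℋ (side n (4 * j + 3) (unitInterval.symm s)) = ℋ.lin j (-1 + Complex.I) := by
  rw [developing_side ℋ j (by norm_num), developing_side ℋ j (by norm_num), markPoint_side_one_sub,
    ℋ.dev_add _ _ _ toTorus_neg_one_add_I, add_sub_cancel_left]

theorem markDisc_base (q : Disc) : (markDisc n q).base = toTorus (markPoint n q) := rfl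

theorem ne_zero_of_mem_slitPlane {q : ℂ}
    (h : slitFun (toTorus (markPoint n q)) ∈ Complex.slitPlane) : q ≠ 0 := by
  rintro rfl
  rw [markPoint_zero, slitFun_zero] at h
  exact Complex.slitPlane_ne_zero h rfl

theorem sector_eq_of_mem_sheet {q : Disc} {j : Fin n} (h : markDisc n q ∈ sheet n j) :
    sector n q = j := by
  have hq : (q : ℂ) ≠ 0 := ne_zero_of_mem_slitPlane h.1
  refine sheet_unique (r := markDisc n q) ⟨h.1, ?_⟩ h
  exact (inSector_sector hq).markRoot_eq hq

/-- A lift of the torus differs from the given point of the plane locally by a constant. -/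
theorem torusLift_markPoint_sub (c : ℂ) {q : ℂ}
    (h : toTorus (markPoint n q) ∈ (torusLift c).source) :
    ∀ᶠ q' in 𝓝 q, torusLift c (toTorus (markPoint n q')) =
      markPoint n q' + (torusLift c (toTorus (markPoint n q)) - markPoint n q) :=
  continuous_markPoint.continuousAt.eventually (torusLift_eventually h)

theorem toTorus_torusLift_sub (c z : ℂ) : toTorus (torusLift c (toTorus z) - z) = 0 := by
  rw [map_sub, toTorus_torusLift, sub_self]

theorem norm_torusLift_sub_slitMid_lt {q : Disc} (h : markDisc n q ∈ nearSlit n) :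
    ‖torusLift slitMid (toTorus (markPoint n q)) - slitMid‖ < 3 / 5 := h

theorem markPoint_mem_source {q : Disc} (h : markDisc n q ∈ nearSlit n) :
    toTorus (markPoint n q) ∈ (torusLift slitMid).source :=
  mem_source_of_norm_lt ((norm_torusLift_sub_slitMid_lt h).trans (by norm_num))

theorem prim_chart_inr_markDisc {b : Bool} {q : Disc} (h : markDisc n q ∈ (chart ℋ (.inr b)).source)
    (j : Fin n) : prim ℋ (.inr b) (chart ℋ (.inr b) (markDisc n q)) =
      ℋ.dev j (markPoint n q) +
        ℋ.lin j (torusLift slitMid (toTorus (markPoint n q)) - markPoint n q) := by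
  have h1 := ℋ.dev_add j (markPoint n q) _ (toTorus_torusLift_sub slitMid (markPoint n q))
  rw [add_sub_cancel] at h1
  rw [← h1, prim_chart_inr ℋ h, markDisc_base,
    ℋ.dev_near j _ (norm_torusLift_sub_slitMid_lt (mem_chart_inr ℋ h)).le]

/-- The difference is always a period of the handle containing `q'`, applied to the lattice vector
between two lifts. That vector is locally constant, so only a change of sector could spoil the
claim. -/
theorem prim_sub_developing (i : (Fin n × ℂ) ⊕ Bool) (q : Disc)
    (h : markDisc n q ∈ (chart ℋ i).source) :
    ∀ᶠ q' in 𝓝 q, prim ℋ i (chart ℋ i (markDisc n q')) - developing ℋ q' =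
      prim ℋ i (chart ℋ i (markDisc n q)) - developing ℋ q := by
  have hev := continuous_markDisc.continuousAt.eventually
    ((chart ℋ i).open_source.mem_nhds h)
  rcases i with ⟨j, c⟩ | b
  · have key : ∀ q', markDisc n q' ∈ (chart ℋ (.inl (j, c))).source →
        prim ℋ (.inl (j, c)) (chart ℋ (.inl (j, c)) (markDisc n q')) - developing ℋ q' =
          ℋ.lin j (torusLift c (toTorus (markPoint n q')) - markPoint n q') := by
      intro q' h'
      have h1 := ℋ.dev_add j (markPoint n q') _ (toTorus_torusLift_sub c (markPoint n q'))
      rw [add_sub_cancel] at h1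
      rw [prim_chart_inl, markDisc_base, h1, developing,
        sector_eq_of_mem_sheet ((mem_chart_inl ℋ).1 h').2, add_sub_cancel_left]
    have hl := (continuous_subtype_val (p := fun q : ℂ => q ∈ Metric.closedBall 0 1)).continuousAt
      (x := q) |>.eventually (torusLift_markPoint_sub c ((mem_chart_inl ℋ).1 h).1)
    filter_upwards [hev, hl] with q' h1 h2
    rw [key q' h1, key q h, h2, add_sub_cancel_left]
  · have hs : toTorus (markPoint n q) ∈ (torusLift slitMid).source :=
      markPoint_mem_source (mem_chart_inr ℋ h)
    have key : ∀ q', markDisc n q' ∈ (chart ℋ (.inr b)).source →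
        prim ℋ (.inr b) (chart ℋ (.inr b) (markDisc n q')) - developing ℋ q' =
          ℋ.lin (sector n q')
            (torusLift slitMid (toTorus (markPoint n q')) - markPoint n q') := by
      intro q' h'
      rw [prim_chart_inr_markDisc ℋ h' (sector n q'), developing, add_sub_cancel_left]
    have hl := (continuous_subtype_val (p := fun q : ℂ => q ∈ Metric.closedBall 0 1)).continuousAt
      (x := q) |>.eventually (torusLift_markPoint_sub slitMid hs)
    -- If the lattice vector vanishes, the sector is irrelevant. Otherwise `q` is not on a ray
    -- between sectors, since those rays map into the slit, where the lift is the point itself; then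
    -- the sector is locally constant.
    by_cases h0 : torusLift slitMid (toTorus (markPoint n q)) - markPoint n q = 0
    · filter_upwards [hev, hl] with q' h1 h2
      rw [key q' h1, key q h, h2, add_sub_cancel_left, h0, map_zero, map_zero]
    · have hsl : -(q : ℂ) ^ n ∈ Complex.slitPlane := by
        by_contra hc
        obtain ⟨x, hx, e⟩ := exists_toDiamond_eq_ofReal
          (norm_pow_le_one (n := n) (mem_closedBall_zero_iff.1 q.2)) hc
        refine h0 (sub_eq_zero.2 ((toTorus_lift_mid_of_norm_lt ?_).1))
        rw [markPoint, e]
        exact lt_trans (norm_sub_slitMid_of_mem_Icc hx) (by norm_num)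
      have hq0 : (q : ℂ) ≠ 0 := by
        intro e
        simp [e, zero_pow (NeZero.ne n)] at hsl
      have hsec := (continuous_subtype_val
        (p := fun q : ℂ => q ∈ Metric.closedBall 0 1)).continuousAt (x := q) |>.eventually
          ((inSector_sector (n := n) hq0).eventually hsl)
      filter_upwards [hev, hl, hsec] with q' h1 h2 h3
      rw [key q' h1, key q h, h2, add_sub_cancel_left, sector_eq h3.1 h3.2]

/-! ### Orientation -/

theorem orientedDiffAt_markPoint {q : ℂ} (h0 : q ≠ 0) (h1 : ‖q‖ < 1) :
    OrientedDiffAt (markPoint n) q := by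
  refine OrientedDiffAt.comp (f := toDiamond) (g := fun q => q ^ n)
    (orientedDiffAt_toDiamond (pow_ne_zero n h0) (norm_pow_lt_one h1))
    (orientedDiffAt_of_hasDerivAt ?_ (hasDerivAt_pow n q))
  exact mul_ne_zero (by exact_mod_cast NeZero.ne n) (pow_ne_zero _ h0)

theorem eventually_val {p : Disc} {P : ℂ → Prop} (h : ∀ᶠ q in 𝓝 (p : ℂ), P q) :
    ∀ᶠ q : Disc in 𝓝 p, P q :=
  continuous_subtype_val.continuousAt.eventually h

theorem markRoot_ne_zero {q : ℂ} (h0 : q ≠ 0) (h1 : ‖q‖ < 1) : markRoot n q ≠ 0 := by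
  intro h
  have h2 := markRoot_pow (n := n) q
  rw [h, zero_pow (NeZero.ne n)] at h2
  obtain ⟨h3, h4⟩ := inDiamond_toDiamond (norm_pow_lt_one (n := n) h1)
  simp only [Complex.zero_re, Complex.zero_im, add_zero, sub_zero, abs_lt] at h3 h4
  have h5 : markPoint n q ∈ HalfOpenDiamond := ⟨⟨h3.1.le, h3.2⟩, h4.1.le, h4.2⟩
  rcases slitFun_eq_zero_of_mem h5 h2.symm with e | e
  · exact h0 (markPoint_eq_zero.1 e)
  · have := h3.1
    rw [show toDiamond (q ^ n) = -Complex.I from e] at this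
    simp at this

theorem preservesOrientation_sheet (j : Fin n) (c : ℂ) {p : Disc} (hp : ‖(p : ℂ)‖ < 1)
    (h : markDisc n p ∈ (chart ℋ (.inl (j, c))).source) :
    PreservesOrientationAt (fun q => chart ℋ (.inl (j, c)) (markDisc n q)) p := by
  have hp0 : (p : ℂ) ≠ 0 := ne_zero_of_mem_slitPlane ((mem_chart_inl ℋ).1 h).2.1
  set l := torusLift c (toTorus (markPoint n p)) - markPoint n p
  refine preservesOrientationAt_of_orientedDiffAt (G := ℋ.dev j ∘ fun q => markPoint n q + l)
    ((ℋ.oriented j _).comp ((orientedDiffAt_markPoint hp0 hp).add_const l)) ?_ ?_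
  · exact Filter.Eventually.of_forall fun z =>
      ((ℋ.dev j).continuous.comp (continuous_markPoint.add continuous_const)).continuousAt
  · filter_upwards [eventually_val (torusLift_markPoint_sub c ((mem_chart_inl ℋ).1 h).1)]
      with q hq
    exact congrArg (ℋ.dev j) hq

theorem chart_inr_pow {b : Bool} {r : CyclicCover n} (h : r ∈ (chart ℋ (.inr b)).source) :
    (chart ℋ (.inr b) r) ^ n = if b then torusLift slitMid r.base / (torusLift slitMid r.base - 1)
      else (torusLift slitMid r.base - 1) / torusLift slitMid r.base := by
  cases b
  · have hc : (starRingEnd ℂ) (torusLift slitMid r.base) ≠ 0 := (map_ne_zero _).2 h.2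
    show ((starRingEnd ℂ) r.root / rootScale n (torusLift slitMid r.base)) ^ n = _
    rw [div_pow, rootScale_pow, ← map_pow, root_pow_nearSlit h.1, map_mul, Complex.conj_conj,
      mul_comm (torusLift slitMid r.base), mul_div_mul_left _ _ hc]
    rfl
  · have hc : (starRingEnd ℂ) (torusLift slitMid r.base - 1) ≠ 0 :=
      (map_ne_zero _).2 (sub_ne_zero.2 h.2)
    show (r.root / rootScale n (torusLift slitMid r.base - 1)) ^ n = _
    rw [div_pow, rootScale_pow, root_pow_nearSlit h.1, mul_div_mul_right _ _ hc]
    rfl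

theorem chart_inr_eq_zero {b : Bool} {r : CyclicCover n} (h : r ∈ (chart ℋ (.inr b)).source)
    (h0 : chart ℋ (.inr b) r = 0) : r.root = 0 :=
  root_eq_zero_of_chart_eq_zero ℋ h h0

/-- The coordinate of the torus composed with the coordinate of the root. -/
def moebius (b : Bool) (z : ℂ) : ℂ := if b then z / (z - 1) else (z - 1) / z

theorem hasDerivAt_moebius {b : Bool} {z : ℂ} (h : if b then z ≠ 1 else z ≠ 0) :
    ∃ c ≠ 0, HasDerivAt (moebius b) c z := by
  cases b
  · have h0 : z ≠ 0 := h
    refine ⟨1 / z ^ 2, one_div_ne_zero (pow_ne_zero 2 h0), ?_⟩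
    refine (((hasDerivAt_id z).sub_const 1).div (hasDerivAt_id z) h0).congr_deriv ?_
    simp
  · have h0 : z - 1 ≠ 0 := sub_ne_zero.2 h
    refine ⟨-1 / (z - 1) ^ 2, div_ne_zero (by norm_num) (pow_ne_zero 2 h0), ?_⟩
    refine ((hasDerivAt_id z).div ((hasDerivAt_id z).sub_const 1) h0).congr_deriv ?_
    simp

theorem isOpen_regular (b : Bool) : IsOpen {z : ℂ | if b then z ≠ 1 else z ≠ 0} := by
  cases b
  · exact isOpen_ne
  · exact isOpen_ne

theorem torusLift_mem_regular {b : Bool} {r : CyclicCover n}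
    (h : r ∈ (chart ℋ (.inr b)).source) :
    torusLift slitMid r.base ∈ {z : ℂ | if b then z ≠ 1 else z ≠ 0} := by
  cases b
  · exact h.2
  · exact h.2

theorem chart_inr_markDisc_pow {b : Bool} {q : Disc}
    (h : markDisc n q ∈ (chart ℋ (.inr b)).source) : (chart ℋ (.inr b) (markDisc n q)) ^ n =
      moebius b (torusLift slitMid (toTorus (markPoint n q))) :=
  chart_inr_pow ℋ h

/-- The `n`-th power of the chart is a Möbius function of a translate of `markPoint`, hence
differentiable with positive determinant, and the chart does not vanish at `p`;
`preservesOrientationAt_of_pow` takes the root. -/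
theorem preservesOrientation_near {b : Bool} {p : Disc} (hp : ‖(p : ℂ)‖ < 1) (hp0 : (p : ℂ) ≠ 0)
    (h : markDisc n p ∈ (chart ℋ (.inr b)).source) :
    PreservesOrientationAt (fun q => chart ℋ (.inr b) (markDisc n q)) p := by
  have hs : toTorus (markPoint n p) ∈ (torusLift slitMid).source :=
    markPoint_mem_source (mem_chart_inr ℋ h)
  obtain ⟨l, hz, hlift⟩ : ∃ l, markPoint n p + l = torusLift slitMid (toTorus (markPoint n p)) ∧
      ∀ᶠ q : Disc in 𝓝 p, torusLift slitMid (toTorus (markPoint n q)) = markPoint n q + l :=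
    ⟨_, add_sub_cancel _ _, eventually_val (torusLift_markPoint_sub slitMid hs)⟩
  have hopen : ∀ᶠ z in 𝓝 (markPoint n p + l), if b then z ≠ 1 else z ≠ 0 := by
    rw [hz]
    exact (isOpen_regular b).mem_nhds (torusLift_mem_regular ℋ h)
  have hc : Continuous fun q => markPoint n q + l := continuous_markPoint.add continuous_const
  have hreg : if b then markPoint n p + l ≠ 1 else markPoint n p + l ≠ 0 := hopen.self_of_nhds
  obtain ⟨c, hc0, hd⟩ := hasDerivAt_moebius hreg
  have hG : OrientedDiffAt (moebius b ∘ fun q => markPoint n q + l) p :=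
    OrientedDiffAt.comp (g := fun q => markPoint n q + l) (orientedDiffAt_of_hasDerivAt hc0 hd)
      ((orientedDiffAt_markPoint hp0 hp).add_const l)
  refine preservesOrientationAt_of_pow (NeZero.ne n) hG ?_ ?_ ?_ ?_
  · filter_upwards [hc.continuousAt.eventually hopen] with q hq
    obtain ⟨c', -, hd'⟩ := hasDerivAt_moebius hq
    exact ContinuousAt.comp (f := fun q => markPoint n q + l) hd'.continuousAt hc.continuousAt
  · exact ContinuousAt.comp (f := markDisc n) ((chart ℋ (.inr b)).continuousAt h)
      continuous_markDisc.continuousAt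
  · intro e
    exact markRoot_ne_zero hp0 hp (chart_inr_eq_zero ℋ h e)
  · filter_upwards [hlift,
      continuous_markDisc.continuousAt.eventually ((chart ℋ (.inr b)).open_source.mem_nhds h)]
      with q h1 h2
    rw [chart_inr_markDisc_pow ℋ h2, h1, Function.comp_apply]

/-- At the centre the derivative of `q ^ n` may vanish, so the preceding argument is not available.
Instead the chart is `q * c q` with `c` continuous and nonzero at `0`. -/
theorem preservesOrientation_centre {b : Bool} {p : Disc} (hp0 : (p : ℂ) = 0)
    (h : markDisc n p ∈ (chart ℋ (.inr b)).source) :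
    PreservesOrientationAt (fun q => chart ℋ (.inr b) (markDisc n q)) p := by
  have hmid : ‖(0 : ℂ) - slitMid‖ < 3 / 5 := by
    have := norm_sub_slitMid_of_mem_Icc (x := 0) (by simp)
    rwa [Complex.ofReal_zero] at this
  have hbase : torusLift slitMid (markDisc n p).base = 0 := by
    rw [markDisc_base, hp0, markPoint_zero]
    exact (toTorus_lift_mid_of_norm_lt (lt_trans hmid (by norm_num))).1
  cases b
  · exact absurd hbase h.2
  set c : ℂ → ℂ := fun q => (halfRoot n)⁻¹ * nearFactor n q / rootScale n (markPoint n q - 1)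
    with hc
  have hev : ∀ᶠ q in 𝓝 (0 : ℂ), (markPoint n q).re ≤ 1 ∧ markPoint n q ≠ 1 ∧
      ‖markPoint n q - slitMid‖ < 3 / 5 := by
    have h1 : ∀ᶠ z in 𝓝 (0 : ℂ), z.re < 1 :=
      Complex.continuous_re.continuousAt.eventually_lt_const (by simp)
    have h2 : ∀ᶠ z in 𝓝 (0 : ℂ), z ≠ 1 := isOpen_ne.mem_nhds zero_ne_one
    have h3 : ∀ᶠ z in 𝓝 (0 : ℂ), ‖z - slitMid‖ < 3 / 5 :=
      (continuous_norm.comp (continuous_sub_right slitMid)).continuousAt.eventually_lt_const hmid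
    rw [← markPoint_zero (n := n)] at h1 h2 h3
    filter_upwards [continuous_markPoint.continuousAt.eventually h1,
      continuous_markPoint.continuousAt.eventually h2,
      continuous_markPoint.continuousAt.eventually h3] with q h1 h2 h3
    exact ⟨h1.le, h2, h3⟩
  have hcont : ∀ q, (markPoint n q).re ≤ 1 → markPoint n q ≠ 1 → ContinuousAt c q := by
    intro q h1 h2
    refine ContinuousAt.div (continuousAt_const.mul (continuousAt_nearFactor h1)) ?_
      (rootScale_ne_zero (sub_ne_zero.2 h2))
    exact (continuous_rootScale.comp (continuous_markPoint.sub continuous_const)).continuousAt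
  have hc0 : c 0 ≠ 0 := by
    refine div_ne_zero (mul_ne_zero (inv_ne_zero halfRoot_ne_zero) ?_)
      (rootScale_ne_zero (sub_ne_zero.2 hev.self_of_nhds.2.1))
    rw [nearFactor, markPoint_zero]
    simp [Complex.cpow_eq_zero_iff, (shrink_pos _).ne']
  have hev' := hev.self_of_nhds
  refine preservesOrientationAt_of_orientedDiffAt (G := fun q => q * c q) ?_ ?_ ?_
  · rw [hp0]
    exact orientedDiffAt_mul_self (hcont 0 hev'.1 hev'.2.1) hc0
  · rw [hp0]
    filter_upwards [hev] with q hq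
    exact continuousAt_id.mul (hcont q hq.1 hq.2.1)
  · filter_upwards [eventually_val (p := p) (P := fun q => ‖markPoint n q - slitMid‖ < 3 / 5)
      (by rw [hp0]; filter_upwards [hev] with q hq using hq.2.2)] with q hq
    show markRoot n q / rootScale n (torusLift slitMid (toTorus (markPoint n q)) - 1) = q * c q
    rw [(toTorus_lift_mid_of_norm_lt (lt_trans hq (by norm_num))).1,
      markRoot_near (mem_closedBall_zero_iff.1 q.2) hq.le, hc]
    ring

theorem preservesOrientation_chart (i : (Fin n × ℂ) ⊕ Bool) {p : Disc} (hp : ‖(p : ℂ)‖ < 1)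
    (h : markDisc n p ∈ (chart ℋ i).source) :
    PreservesOrientationAt (fun q => chart ℋ i (markDisc n q)) p := by
  rcases i with ⟨j, c⟩ | b
  · exact preservesOrientation_sheet ℋ j c hp h
  · by_cases hp0 : (p : ℂ) = 0
    · exact preservesOrientation_centre ℋ hp0 h
    · exact preservesOrientation_near ℋ hp hp0 h

/-! ### The marked Riemann surface and its periods -/

/-- The marked Riemann surface determined by developing maps of the handles. -/
def markedRiemannSurface : MarkedRiemannSurface n :=
  letI := (primitiveAtlas ℋ).chartedSpace
  haveI := (primitiveAtlas ℋ).isManifold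
  { carrier := CyclicCover n
    marking := marking n
    preservesOrientation := by
      rintro p hp e ⟨i, rfl⟩ h
      exact preservesOrientation_chart ℋ i hp h }

theorem mem_H10 {χ : Character n}
    (hx : ∀ j, ℋ.lin j (-1 + Complex.I) = χ (homologyClass (xLoop n j)))
    (hy : ∀ j, ℋ.lin j (-1 - Complex.I) = χ (homologyClass (yLoop n j))) :
    χ ∈ H10 (markedRiemannSurface ℋ) := by
  refine ⟨(primitiveAtlas ℋ).form, (primitiveAtlas ℋ).isAbelianDifferential, fun γ => ?_⟩
  refine hasPathIntegral_of_developingMap (primitiveAtlas ℋ) (marking n) χ (D := developing ℋ)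
    (prim_sub_developing ℋ) ?_ ?_ γ
  · intro j s
    rw [developing_side_x, ← hy, ← map_neg]
    congr 1
    ring
  · intro j s
    rw [developing_side_y, hx]

end CyclicCover

/-! ### Existence of the developing maps -/

/-- Cramer's rule for `a` and `b`, with determinant `(-1 + i) ^ 2 - (-1 - i) ^ 2 = -4 i`. The
vectors `-1 + i` and `-1 - i` form a positive basis, so positivity for `x`, `y` means `‖b‖ < ‖a‖`.
-/
theorem exists_planeMap {x y : ℂ} (h : 0 < x.re * y.im - y.re * x.im) :
    ∃ a b : ℂ, ‖b‖ < ‖a‖ ∧ planeMap a b (-1 + Complex.I) = x ∧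
      planeMap a b (-1 - Complex.I) = y := by
  refine ⟨(x * (-1 + Complex.I) - y * (-1 - Complex.I)) / (-4 * Complex.I),
    (y * (-1 + Complex.I) - x * (-1 - Complex.I)) / (-4 * Complex.I), ?_, ?_, ?_⟩
  · rw [norm_div, norm_div]
    refine div_lt_div_of_pos_right ?_ (by simp)
    refine lt_of_pow_lt_pow_left₀ 2 (norm_nonneg _) ?_
    rw [norm_sq_eq, norm_sq_eq]
    simp
    nlinarith
  · rw [planeMap_apply, map_add, map_neg, map_one, Complex.conj_I]
    field_simp
    ring_nf
  · rw [planeMap_apply, map_sub, map_neg, map_one, Complex.conj_I]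
    field_simp
    ring_nf

theorem exists_handleMaps {n : ℕ} [NeZero n] (x y : Fin n → ℂ)
    (h : ∀ j, 0 < (x j).re * (y j).im - (y j).re * (x j).im) :
    ∃ ℋ : HandleMaps n, (∀ j, ℋ.lin j (-1 + Complex.I) = x j) ∧
      ∀ j, ℋ.lin j (-1 - Complex.I) = y j := by
  choose a b hab hx hy using fun j => exists_planeMap (h j)
  choose C hC using fun j => exists_handleHomeomorph (hab j)
  -- One exponent for all handles: the sheets fit together along the slit only if the similarities
  -- there have the same ratio `exp (-M)`.
  obtain ⟨M, hM⟩ := (Set.finite_range C).bddAbove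
  choose H h1 h2 h3 using fun j => hC j M (hM ⟨j, rfl⟩)
  exact ⟨{ lin := fun j => planeMap (a j) (b j)
           dev := H
           ratio := (Real.exp (-M) : ℝ)
           ratio_ne_zero := by exact_mod_cast (Real.exp_pos _).ne'
           dev_add := h1
           dev_near := h2
           oriented := h3 }, hx, hy⟩

end

end AbelianPeriods

theorem theorem2p3 (n : ℕ) : AbelianPeriods.XPlus n ⊆ AbelianPeriods.SigmaSet n := by
  rintro χ ⟨hX, hpos⟩
  refine ⟨hX, Set.mem_iUnion.2 ?_⟩
  rcases Nat.eq_zero_or_pos n with rfl | hn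
  -- For `n = 0` the form `omega` is an empty sum and cannot equal `1`.
  · have h : AbelianPeriods.omega χ = 1 := hX
    simp [AbelianPeriods.omega] at h
  · have : NeZero n := ⟨hn.ne'⟩
    obtain ⟨ℋ, hx, hy⟩ := AbelianPeriods.exists_handleMaps
      (fun j => χ (AbelianPeriods.homologyClass (AbelianPeriods.Surface.xLoop n j)))
      (fun j => χ (AbelianPeriods.homologyClass (AbelianPeriods.Surface.yLoop n j)))
      (fun j => by
        have h := hpos j
        rwa [AbelianPeriods.omegaBlock, Matrix.det_fin_two_of] at h)
    exact ⟨_, AbelianPeriods.CyclicCover.mem_H10 ℋ hx hy⟩
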